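/- Let $p$ be a prime, $m\ge 0$, let $K$ be a separably closed field of characteristic $p$, and let \[K^p=K_0\leq K_1\leq\cdots\leq K_m\leq K_{m+1}=K\] be a chain of subfields of $K$, where $K^p$ is the field of $p$-th powers. Consider the structure $(K,K_1,\dots,K_m)$ in the language of fields $\{+,-,\cdot,{}^{-1},0,1\}$ (with $0^{-1}=0$) with unary predicates for $K_1,\dots,K_m$. Then: (1) The first-order theory of $(K,K_1,\dots,K_m)$ is stable, that is, for some infinite cardinal $\kappa$ there are, over any set of at most $\kappa$ parameters in any model and for every $n$, at most $\kappa$ complete $n$-types. (2) This theory is axiomatized by the stated properties together with a specification of the degrees $[K_{i+1}:K_i]$, $0\le i\le m$, each as a finite value or the formal symbol $\infty$. That is, a structure is a model of it if and only if it is of the form $(M,M_1,\dots,M_m)$ with $M$ a separably closed field of characteristic $p$ and $M^p=M_0\leq M_1\leq\cdots\leq M_m\leq M_{m+1}=M$ a chain of subfields such that $[M_{i+1}:M_i]=[K_{i+1}:K_i]$ for $0\le i\le m$ (all infinite degrees being identified with $\infty$). In particular, the theory given by these properties and degrees is complete. (3) Let $\mathcal L^m$ be the above language together with function symbols $\lambda^{K_j}_{e,n}$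 for $1\le j\le m+1$, $n\ge 0$ and $e\in\{0,\dots,p-1\}^n$, interpreted as follows. For a field $k$ of characteristic $p$, elements $a_1,\dots,a_n$ of $k$ are $p$-independent in $k$ if $[k^p[a_i: i\in s]:k^p]=p^{|s|}$ for all $s\subseteq\{1,\dots,n\}$. If $a_1,\dots,a_n\in k$ are $p$-independent in $k$ and $b\in k^p[a_1,\dots,a_n]$, then the $\lambda^k_{e,n}(a_1,\dots,a_n;b)\in k$ are the unique elements with \[b=\sum_{e\in\{0,\dots,p-1\}^n}\lambda^k_{e,n}(a_1,\dots,a_n;b)^p\,a_1^{e_1}\cdots a_n^{e_n};\] in all other cases $\lambda^k_{e,n}(a_1,\dots,a_n;b)=0$. Then the theory of $(K,K_1,\dots,K_m)$ in $\mathcal L^m$ is axiomatized by the properties and degrees in (2) together with the statement that the $\lambda$-functions are interpreted in this way, and it eliminates quantifiers. -/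

import Mathlib

open FirstOrder Cardinal

universe u w

namespace SepClosedChain

/-! ### Model-theoretic notions -/

/-- The space `S_n(A)` of complete `n`-types over a parameter set `A` in the structure `M`. -/
abbrev TypeSpace {L : FirstOrder.Language.{0, 0}} {M : Type w} [L.Structure M] (A : Set M) (n : ℕ) :
    Type w :=
  (L[[A]].completeTheory M).CompleteType (Fin n)

/-- A theory is stable if it is `κ`-stable for some infinite cardinal `κ`: over any set of at most
`κ` parameters in any model there are at most `κ` complete `n`-types, for every `n`. -/
def IsStable {L : FirstOrder.Language.{0, 0}} (T : L.Theory) : Prop :=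
  ∃ κ : Cardinal.{w}, ℵ₀ ≤ κ ∧
    ∀ (M : Type w) [L.Structure M] [Nonempty M], M ⊨ T →
      ∀ A : Set M, #A ≤ κ → ∀ n : ℕ, #(TypeSpace (L := L) A n) ≤ κ

/-- Elimination of quantifiers: modulo `T`, every formula in finitely many free variables is
equivalent to a quantifier-free formula in the same free variables. -/
def EliminatesQuantifiers {L : FirstOrder.Language.{0, 0}} (T : L.Theory) : Prop :=
  ∀ (n : ℕ) (φ : L.Formula (Fin n)), ∃ ψ : L.Formula (Fin n),
    FirstOrder.Language.BoundedFormula.IsQF ψ ∧ T ⊨ᵇ φ.iff ψ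

/-! ### The two languages -/

/-- The function symbols of the language of fields. -/
inductive FieldFunc : ℕ → Type
  | add : FieldFunc 2
  | mul : FieldFunc 2
  | neg : FieldFunc 1
  | inv : FieldFunc 1
  | zero : FieldFunc 0
  | one : FieldFunc 0

/-- Unary predicates for the fields `K_1, …, K_m`. -/
inductive ChainRel (m : ℕ) : ℕ → Type
  | mem (j : Fin m) : ChainRel m 1

/-- The function symbols of the language of fields together with the symbols
`λ^{K_j}_{e, n}` of arity `n + 1` for `n ≥ 0` and `1 ≤ j ≤ m + 1` (the index `j : Fin (m + 1)`
stands for the field `K_{j+1}`). The `p ^ n` many `p`-monomials in `n` variables are indexed by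
their exponent vectors `e`. -/
inductive LambdaFunc (p m : ℕ) : ℕ → Type
  | field {n : ℕ} (f : FieldFunc n) : LambdaFunc p m n
  | lam (j : Fin (m + 1)) {n : ℕ} (e : Fin n → Fin p) : LambdaFunc p m (n + 1)

/-- The language of fields with `m` unary predicates. -/
def chainLang (m : ℕ) : FirstOrder.Language.{0, 0} := ⟨FieldFunc, ChainRel m⟩

/-- The language of fields with `m` unary predicates and all the `λ`-functions. -/
def lambdaLang (p m : ℕ) : FirstOrder.Language.{0, 0} := ⟨LambdaFunc p m, ChainRel m⟩

/-! ### `p`-independence and `λ`-functions -/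

section Lambda

variable {K : Type u} [Field K] (p : ℕ) [ExpChar K p]

/-- The subfield `k^p` of `p`-th powers of elements of `k`. -/
def pPowers (k : Subfield K) : Subfield K := k.map (frobenius K p)

/-- The tuple `a` of elements of `k` is `p`-independent in `k`: `[k^p(C) : k^p] = p ^ |C|` for
each finite subtuple `C` of `a`. -/
def PIndependent (k : Subfield K) {n : ℕ} (a : Fin n → K) : Prop :=
  (∀ i, a i ∈ k) ∧ ∀ s : Finset (Fin n),
    (pPowers p k).relfinrank (pPowers p k ⊔ Subfield.closure (a '' s)) = p ^ s.card

/-- `c` is a family of elements of `k` such that `b = ∑ e, c_e ^ p a_1 ^ e_1 ⋯ a_n ^ e_n`, the sum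
ranging over all exponent vectors with entries in `{0, …, p - 1}`. Such a family exists if and only
if `b ∈ k^p[a_1, …, a_n]`, and it is unique if `a` is `p`-independent in `k`. -/
def IsExpansion (k : Subfield K) {n : ℕ} (a : Fin n → K) (b : K)
    (c : (Fin n → Fin p) → K) : Prop :=
  (∀ e, c e ∈ k) ∧ b = ∑ e, c e ^ p * ∏ i, a i ^ (e i : ℕ)

open Classical in
/-- The function `λ^k_{e, n}(a_1, …, a_n; b)` of the field `k`, extended by `0`. -/
noncomputable def lambdaFun (k : Subfield K) {n : ℕ} (e : Fin n → Fin p) (a : Fin n → K) (b : K) :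
    K :=
  if h : PIndependent p k a ∧ ∃ c, IsExpansion p k a b c then h.2.choose e else 0

end Lambda

/-! ### Chains of fields as structures -/

section Chain

variable {K : Type u} [Field K] {m : ℕ}

/-- `K^p = K_0 ≤ K_1 ≤ ⋯ ≤ K_m ≤ K_{m+1} = K`. -/
structure IsFrobeniusChain (p : ℕ) [ExpChar K p] (F : Fin (m + 2) → Subfield K) : Prop where
  zero : F 0 = (frobenius K p).fieldRange
  mono : Monotone F
  last : F (Fin.last (m + 1)) = ⊤

/-- The degrees `[K_{i+1} : K_i]` for `0 ≤ i ≤ m`, as natural numbers or `∞`. -/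
noncomputable def degrees (F : Fin (m + 2) → Subfield K) (i : Fin (m + 1)) : ℕ∞ :=
  Cardinal.toENat ((F i.castSucc).relrank (F i.succ))

/-- The interpretation of the field operations (with `0⁻¹ = 0`). -/
def fieldFunMap : {n : ℕ} → FieldFunc n → (Fin n → K) → K
  | _, .add, x => x 0 + x 1
  | _, .mul, x => x 0 * x 1
  | _, .neg, x => -x 0
  | _, .inv, x => (x 0)⁻¹
  | _, .zero, _ => 0
  | _, .one, _ => 1

/-- The interpretation of the predicates for `K_1, …, K_m`. -/
def chainRelMap (F : Fin (m + 2) → Subfield K) : {n : ℕ} → ChainRel m n → (Fin n → K) → Prop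
  | _, .mem j, x => x 0 ∈ F j.castSucc.succ

/-- The interpretation of the field operations and of the `λ`-functions. -/
noncomputable def lambdaFunMap (p : ℕ) [ExpChar K p] (F : Fin (m + 2) → Subfield K) :
    {n : ℕ} → LambdaFunc p m n → (Fin n → K) → K
  | _, .field f, x => fieldFunMap f x
  | _, .lam (n := n) j e, x => lambdaFun p (F j.succ) e (Fin.init x) (x (Fin.last n))

/-- The structure `(K, K_1, …, K_m)`: the field `K` with predicates for the subfields. -/
@[reducible]
def chainStructure (F : Fin (m + 2) → Subfield K) : (chainLang m).Structure K where
  funMap := fun f x => fieldFunMap f x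
  RelMap := fun r x => chainRelMap F r x

/-- The structure `(K, K_1, …, K_m)` with the `λ`-functions of `K_1, …, K_m` and `K_{m+1} = K`. -/
@[reducible]
noncomputable def lambdaStructure (p : ℕ) [ExpChar K p] (F : Fin (m + 2) → Subfield K) :
    (lambdaLang p m).Structure K where
  funMap := fun f x => lambdaFunMap p F f x
  RelMap := fun r x => chainRelMap F r x

/-- The complete first-order theory of `(K, K_1, …, K_m)`. -/
def chainTheory (F : Fin (m + 2) → Subfield K) : (chainLang m).Theory :=
  @FirstOrder.Language.completeTheory (chainLang m) K (chainStructure F)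

/-- The complete first-order theory of `(K, K_1, …, K_m)` with `λ`-functions. -/
def lambdaTheory (p : ℕ) [ExpChar K p] (F : Fin (m + 2) → Subfield K) :
    (lambdaLang p m).Theory :=
  @FirstOrder.Language.completeTheory (lambdaLang p m) K (lambdaStructure p F)

end Chain

/-- A structure for the language with predicates has the stated properties with degrees `d`: it is
a separably closed field of characteristic `p` with predicates for a chain of subfields from
the field of `p`-th powers to the whole field, with successive degrees `d 0, …, d m`. -/
def IsChainModel (p : ℕ) [Fact p.Prime] {m : ℕ} (d : Fin (m + 1) → ℕ∞) (M : Type w)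
    [S : (chainLang m).Structure M] : Prop :=
  ∃ (_ : Field M) (_ : CharP M p) (F : Fin (m + 2) → Subfield M),
    IsSepClosed M ∧ IsFrobeniusChain p F ∧ degrees F = d ∧ S = chainStructure F

/-- The same for the language with `λ`-functions, these being interpreted naturally. -/
def IsLambdaChainModel (p : ℕ) [Fact p.Prime] {m : ℕ} (d : Fin (m + 1) → ℕ∞) (M : Type w)
    [S : (lambdaLang p m).Structure M] : Prop :=
  ∃ (_ : Field M) (_ : CharP M p) (F : Fin (m + 2) → Subfield M),
    IsSepClosed M ∧ IsFrobeniusChain p F ∧ degrees F = d ∧ S = lambdaStructure p F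

end SepClosedChain

set_option linter.unusedSectionVars false

namespace SepClosedChain

/-! ### Monomial independence -/

section Monomials

variable {M : Type*} [Field M] (p : ℕ) {ι : Type*} [Fintype ι]

/-! Everything rests on one kind of embedding. Divide a `p`-basis of a field `E` into parts `X 0, …,
X m`. An embedding `g` of `E` into a chain `F` on `M` is good (`IsGood`) if `X j` goes into `F
j.succ` and stays `p`-independent over `F j.castSucc`, in the sense that monomials with exponents
below `p` are linearly independent. The parts from level `j` upwards are then jointly independent
over `F j`. They generate `E` over `E_j = E^p(X i : i < j)`, so `F j` and `E` are linearly disjoint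
over `E_j` (`IsGood.linearIndependent`). Consequently `E ∩ F j = E_j`, `M` satisfies Mac Lane's
separability criterion over `E`, and the `λ`-functions of `F j` restrict to those of `E_j`: the pair
`(E, X)` determines the atomic formulas true of elements of `E`.

The core is that it determines all formulas, once the degrees are fixed (`lholds_iff_of_isGood`).
This is a back and forth between saturated chains, with countable `E`. Every element of a chain lies
in a larger countable good field, obtained by closing off under coefficients of expansions in a
`p`-basis (`IsGood.exists_extend`). Such an extension `E₁` of `E` can be copied into the other chain
(`Saturated.exists_isGood_extend`). Equality of the degrees and saturation provide images of the new
`p`-basis elements. These elements are algebraically independent over `E` on both sides, because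
over a separably embedded field `p`-independence implies algebraic independence. What remains is a
separable extension; its finitely generated parts have separating transcendence bases, hence embed
in an uncountable separably closed field, and saturation puts these embeddings together. Ultrapowers
supply the saturated chains.

Three applications follow. The prime field is perfect, so it is good with empty `p`-basis in every
chain; hence chains with the same degrees are elementarily equivalent, while the defining properties
and the degrees are expressed by sentences. A subfield closed under the `λ`-functions of all levels
is good, since these functions compute the coefficients of every expansion that lies in the subfield
(`LamClosed.exists_isGood`); so the quantifier-free type of a tuple determines its type, and
compactness gives quantifier elimination. Finally, over a good field of size at most `𝔠`, a type is
coded by the ideal of relations of a countable sequence together with countable combinatorial data,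
and there are at most `𝔠` such codes (`mk_typeSpace_le`). -/

/-- The monomial `∏ a_i ^ e_i`. -/
def pMon (a : ι → M) (e : ι → Fin p) : M := ∏ i, a i ^ (e i : ℕ)

/-- The monomials in `a` with exponents below `p` are linearly independent over `k`. -/
def MonIndep (k : Subfield M) (a : ι → M) : Prop := LinearIndependent k (pMon p a)

variable {p}

theorem linearIndependent_subfield_iff {k : Subfield M} {a : ι → M} :
    LinearIndependent k a ↔
      ∀ c : ι → M, (∀ e, c e ∈ k) → ∑ e, c e * a e = 0 → ∀ e, c e = 0 := by
  rw [Fintype.linearIndependent_iff]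
  constructor
  · intro h c hc hs e
    have := h (fun e => ⟨c e, hc e⟩) (by simpa [Subfield.smul_def] using hs) e
    simpa using congrArg Subtype.val this
  · intro h c hs e
    have := h (fun e => c e) (fun e => (c e).2) (by simpa [Subfield.smul_def] using hs) e
    exact Subtype.ext this

theorem monIndep_iff [DecidableEq ι] {k : Subfield M} {a : ι → M} :
    MonIndep p k a ↔
      ∀ c : (ι → Fin p) → M, (∀ e, c e ∈ k) → ∑ e, c e * pMon p a e = 0 → ∀ e, c e = 0 :=
  linearIndependent_subfield_iff

theorem pMon_comp_equiv {κ : Type*} [Fintype κ] (σ : κ ≃ ι) (a : ι → M) (e : ι → Fin p) :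
    pMon p (a ∘ σ) (e ∘ σ) = pMon p a e :=
  Fintype.prod_equiv σ _ _ (fun _ => rfl)

theorem monIndep_comp_equiv {κ : Type*} [Fintype κ] (σ : κ ≃ ι) {k : Subfield M} {a : ι → M} :
    MonIndep p k (a ∘ σ) ↔ MonIndep p k a := by
  unfold MonIndep
  rw [← linearIndependent_equiv (σ.arrowCongr (Equiv.refl (Fin p)))]
  have : pMon p a ∘ (σ.arrowCongr (Equiv.refl (Fin p))) = pMon p (a ∘ σ) := by
    funext e
    simp only [Function.comp_apply]
    rw [← pMon_comp_equiv σ]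
    congr 1
    funext i
    simp
  rw [this]

theorem pMon_option (a : Option ι → M) (i : Fin p) (e : ι → Fin p) :
    pMon p a ((Equiv.piOptionEquivProd (β := fun _ : Option ι => Fin p)).symm (i, e)) =
      a none ^ (i : ℕ) * pMon p (a ∘ some) e := by
  simp [pMon, Fintype.prod_option, Equiv.piOptionEquivProd]

theorem sum_option [DecidableEq ι] [DecidableEq (Option ι)] (c : (Option ι → Fin p) → M) (a : Option ι → M) :
    ∑ e, c e * pMon p a e = ∑ i : Fin p,
      (∑ e, c ((Equiv.piOptionEquivProd (β := fun _ : Option ι => Fin p)).symm (i, e)) *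
        pMon p (a ∘ some) e) * a none ^ (i : ℕ) := by
  rw [← (Equiv.piOptionEquivProd (β := fun _ : Option ι => Fin p)).symm.sum_comp,
    Fintype.sum_prod_type]
  refine Finset.sum_congr rfl fun i _ => ?_
  rw [Finset.sum_mul]
  refine Finset.sum_congr rfl fun e _ => ?_
  rw [pMon_option]
  ring

theorem closure_range_option {k : Subfield M} (a : Option ι → M) :
    k ⊔ Subfield.closure (Set.range a) =
      (k ⊔ Subfield.closure (Set.range (a ∘ some))) ⊔ Subfield.closure {a none} := by
  rw [sup_assoc, ← Subfield.closure_union]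
  congr 2
  ext x
  simp only [Set.mem_range, Set.mem_union, Option.exists, Function.comp_apply,
    Set.mem_singleton_iff]
  tauto

theorem adjoin_eq_sup_closure (k : Subfield M) (s : Set M) :
    (IntermediateField.adjoin k s).toSubfield = k ⊔ Subfield.closure s := by
  rw [IntermediateField.adjoin_toSubfield, Subfield.closure_union]
  congr 1
  have : Set.range (algebraMap k M) = (k : Set M) := by ext; simp [Subfield.algebraMap_ofSubfield]
  rw [this, Subfield.closure_eq]

variable [Fact p.Prime]

/-- `z` is a root of the monic polynomial `X ^ p - z ^ p` over `k`, so elements of `k(z)` are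
polynomials in `z`, and division with remainder brings their degree below `p`. -/
theorem exists_sum_pow_of_mem {k : Subfield M} {z x : M} (hz : z ^ p ∈ k)
    (hx : x ∈ k ⊔ Subfield.closure {z}) :
    ∃ c : Fin p → M, (∀ i, c i ∈ k) ∧ x = ∑ i, c i * z ^ (i : ℕ) := by
  have hp := (Fact.out : p.Prime)
  rw [← adjoin_eq_sup_closure] at hx
  have hx' : x ∈ IntermediateField.adjoin k {z} := hx
  have hmon := Polynomial.monic_X_pow_sub_C (⟨z ^ p, hz⟩ : k) hp.ne_zero
  have hroot : Polynomial.aeval z (Polynomial.X ^ p - Polynomial.C (⟨z ^ p, hz⟩ : k)) = 0 := by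
    simp [Subfield.algebraMap_ofSubfield]
  have hint : IsIntegral k z := ⟨_, hmon, by simpa [Polynomial.aeval_def] using hroot⟩
  rw [← IntermediateField.mem_toSubalgebra,
    IntermediateField.adjoin_simple_toSubalgebra_of_isAlgebraic hint.isAlgebraic,
    Algebra.adjoin_singleton_eq_range_aeval] at hx'
  obtain ⟨P, hP⟩ := hx'
  set Q := P %ₘ (Polynomial.X ^ p - Polynomial.C (⟨z ^ p, hz⟩ : k)) with hQ
  have hdeg : Q.natDegree < p := by
    have := Polynomial.natDegree_modByMonic_lt P hmon (by
      intro h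
      have := congrArg Polynomial.natDegree h
      rw [Polynomial.natDegree_X_pow_sub_C] at this
      simp [hp.ne_zero] at this)
    rwa [Polynomial.natDegree_X_pow_sub_C] at this
  refine ⟨fun i => Q.coeff i, fun i => (Q.coeff i).2, ?_⟩
  have hPQ : Polynomial.aeval z P = Polynomial.aeval z Q := by
    conv_lhs => rw [← Polynomial.modByMonic_add_div P (Polynomial.X ^ p - Polynomial.C (⟨z ^ p, hz⟩ : k))]
    rw [map_add, map_mul, hroot, zero_mul, add_zero]
  change Polynomial.aeval z P = x at hP
  rw [← hP, hPQ, Polynomial.aeval_eq_sum_range' hdeg, Finset.sum_range]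
  rfl

/-- Generators are adjoined one at a time: the index type is built up from the empty one by adding
points, and each point is a case of `exists_sum_pow_of_mem`. -/
theorem exists_sum_pMon_of_mem [DecidableEq ι] {k : Subfield M} {a : ι → M} (ha : ∀ i, a i ^ p ∈ k) {x : M}
    (hx : x ∈ k ⊔ Subfield.closure (Set.range a)) :
    ∃ c : (ι → Fin p) → M, (∀ e, c e ∈ k) ∧ x = ∑ e, c e * pMon p a e := by
  revert x
  have key : ∀ (κ : Type _) [Fintype κ] [DecidableEq κ] (a : κ → M), (∀ i, a i ^ p ∈ k) → ∀ x : M,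
      x ∈ k ⊔ Subfield.closure (Set.range a) →
      ∃ c : (κ → Fin p) → M, (∀ e, c e ∈ k) ∧ x = ∑ e, c e * pMon p a e := by
    intro κ hκ
    refine Fintype.induction_empty_option (P := fun κ hκ => ∀ [DecidableEq κ] (a : κ → M),
      (∀ i, a i ^ p ∈ k) → ∀ x : M, x ∈ k ⊔ Subfield.closure (Set.range a) →
      ∃ c : (κ → Fin p) → M, (∀ e, c e ∈ k) ∧ x = ∑ e, c e * pMon p a e) ?_ ?_ ?_ κ
    · intro α β _ σ ih _ a ha x hx
      let _ := Fintype.ofEquiv _ σ.symm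
      classical
      obtain ⟨c, hc, h⟩ := ih (a ∘ σ) (fun i => ha _) x (by rwa [Set.range_comp, σ.range_eq_univ,
        Set.image_univ])
      refine ⟨fun e => c (e ∘ σ), fun e => hc _, ?_⟩
      rw [h, ← (σ.arrowCongr (Equiv.refl (Fin p))).sum_comp]
      refine Finset.sum_congr rfl fun e _ => ?_
      have : ((σ.arrowCongr (Equiv.refl (Fin p))) e) ∘ σ = e := by funext i; simp
      rw [← pMon_comp_equiv σ a, this]
      simp only [this]
    · intro _ a ha x hx
      refine ⟨fun _ => x, fun e => ?_, ?_⟩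
      · simpa [Set.range_eq_empty a] using hx
      · simp [pMon]
    · intro α _ ih _ a ha x hx
      rw [closure_range_option] at hx
      obtain ⟨d, hd, h⟩ := exists_sum_pow_of_mem (p := p)
        (le_sup_left (a := k) (b := Subfield.closure (Set.range (a ∘ some))) (ha none)) hx
      classical
      choose c hc h' using fun i => ih (a ∘ some) (fun i => ha _) (d i) (hd i)
      refine ⟨fun e => c (e none) (fun i => e (some i)), fun e => hc _ _, ?_⟩
      rw [h, sum_option]
      refine Finset.sum_congr rfl fun i _ => ?_
      rw [h' i]
      rfl
  exact fun {x} hx => key ι a ha x hx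

theorem sum_pMon_mem [DecidableEq ι] {k k' : Subfield M} (hk : k ≤ k') {a : ι → M} (ha : ∀ i, a i ∈ k')
    {c : (ι → Fin p) → M} (hc : ∀ e, c e ∈ k) : ∑ e, c e * pMon p a e ∈ k' :=
  sum_mem fun e _ => mul_mem (hk (hc e)) (prod_mem fun i _ => pow_mem (ha i) _)

theorem sum_pMon_mem_sup [DecidableEq ι] {k : Subfield M} {a : ι → M}
    {c : (ι → Fin p) → M} (hc : ∀ e, c e ∈ k) :
    ∑ e, c e * pMon p a e ∈ k ⊔ Subfield.closure (Set.range a) :=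
  sum_pMon_mem le_sup_left
    (fun i => (le_sup_right : Subfield.closure (Set.range a) ≤ _)
      (Subfield.subset_closure (Set.mem_range_self i))) hc

variable [CharP M p]

/-- In characteristic `p` the only `p`-th root of `z ^ p` is `z` itself, so `z ∉ k` makes `X ^ p - z
^ p` irreducible and `z` has degree exactly `p`. -/
theorem eq_zero_of_sum_pow_eq_zero {k : Subfield M} {z : M} (hz : z ^ p ∈ k) (hzk : z ∉ k)
    {c : Fin p → M} (hc : ∀ i, c i ∈ k) (h : ∑ i, c i * z ^ (i : ℕ) = 0) : ∀ i, c i = 0 := by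
  have hp := (Fact.out : p.Prime)
  have hirr : Irreducible (Polynomial.X ^ p - Polynomial.C (⟨z ^ p, hz⟩ : k)) := by
    refine X_pow_sub_C_irreducible_of_prime hp fun b hb => hzk ?_
    have : (b : M) ^ p = z ^ p := by simpa using congrArg Subtype.val hb
    have : (b : M) = z := frobenius_inj M p this
    exact this ▸ b.2
  have hmin : minpoly k z = Polynomial.X ^ p - Polynomial.C (⟨z ^ p, hz⟩ : k) :=
    (minpoly.eq_of_irreducible_of_monic hirr (by simp [Subfield.algebraMap_ofSubfield])
      (Polynomial.monic_X_pow_sub_C _ hp.ne_zero)).symm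
  have hdeg : (minpoly k z).natDegree = p := by rw [hmin, Polynomial.natDegree_X_pow_sub_C]
  have hli := linearIndependent_pow (K := k) z
  rw [hdeg] at hli
  exact linearIndependent_subfield_iff.1 hli c hc h

/-- An element with `p`-th power in `k` either lies in the field generated by the others or has
degree `p` over it, with nothing in between. Independent families can thus be built up one element
at a time, by leaving the field generated so far. -/
theorem monIndep_option {k : Subfield M} {a : Option ι → M} (ha : ∀ i, a i ^ p ∈ k) :
    MonIndep p k a ↔
      MonIndep p k (a ∘ some) ∧ a none ∉ k ⊔ Subfield.closure (Set.range (a ∘ some)) := by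
  classical
  have hp := (Fact.out : p.Prime)
  simp only [monIndep_iff]
  constructor
  · intro h
    constructor
    · intro c hc hs e
      have := h (fun e' => if (e' none : ℕ) = 0 then c (fun i => e' (some i)) else 0)
        (fun e' => by split_ifs <;> simp [hc]) ?_ (fun i => i.elim ⟨0, hp.pos⟩ e)
      · simpa using this
      · rw [sum_option, Finset.sum_eq_zero]
        intro i _
        simp only [Equiv.piOptionEquivProd, Equiv.coe_fn_symm_mk]
        by_cases hi : (i : ℕ) = 0
        · simp [hi, hs]
        · simp [hi]
    · intro hmem
      obtain ⟨c, hc, hs⟩ := exists_sum_pMon_of_mem (fun i => ha (some i)) hmem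
      let z0 : Fin p := ⟨0, hp.pos⟩
      let z1 : Fin p := ⟨1, hp.one_lt⟩
      have h01 : z1 ≠ z0 := by simp [z0, z1]
      -- The relation to be excluded is `a none - ∑ c e * a ^ e = 0`: coefficients `-c` in degree
      -- zero in `a none`, and `1` at the constant monomial in degree one.
      let d : Fin p → (ι → Fin p) → M := fun i e =>
        if i = z0 then - c e else if i = z1 ∧ e = fun _ => z0 then 1 else 0
      have hd : ∀ i e, d i e ∈ k := fun i e => by
        simp only [d]; split_ifs <;> simp [hc]
      have := h (fun e' => d (e' none) (fun i => e' (some i))) (fun e' => hd _ _) ?_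
        (fun i => i.elim z1 fun _ => z0)
      · simp [d, h01] at this
      · rw [sum_option]
        change ∑ i, (∑ e, d i e * pMon p (a ∘ some) e) * a none ^ (i : ℕ) = 0
        rw [Finset.sum_eq_add z0 z1 h01.symm]
        · have e0 : ∑ e, d z0 e * pMon p (a ∘ some) e = - a none := by
            rw [hs]
            simp only [d, if_true, neg_mul, Finset.sum_neg_distrib]
            rfl
          have e1 : ∑ e, d z1 e * pMon p (a ∘ some) e = 1 := by
            simp only [d, if_neg h01, true_and, ite_mul, one_mul, zero_mul, Finset.sum_ite_eq',
              Finset.mem_univ, if_true]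
            simp [pMon, z0]
          rw [e0, e1]
          simp [z0, z1]
        · intro i _ hi
          rw [Finset.sum_eq_zero, zero_mul]
          intro e _
          simp [d, hi.1, hi.2]
        · simp
        · simp
  · rintro ⟨h, hn⟩ c hc hs e
    rw [sum_option] at hs
    have h1 := eq_zero_of_sum_pow_eq_zero (p := p)
      (le_sup_left (a := k) (b := Subfield.closure (Set.range (a ∘ some))) (ha none)) hn
      (fun i => sum_pMon_mem_sup fun e => hc _) hs (e none)
    have := h _ (fun e => hc _) h1 (fun i => e (some i))
    convert! this using 2
    funext i
    cases i <;> simp [Equiv.piOptionEquivProd]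

end Monomials

/-! ### Independent sets -/

section PIndSet

variable {M : Type*} [Field M] (p : ℕ)

/-- Every finite subset of `Z` is monomially independent over `k`. -/
def PIndSet (k : Subfield M) (Z : Set M) : Prop :=
  ∀ s : Finset M, ↑s ⊆ Z → MonIndep p k (fun x : s => (x : M))

variable {p}

theorem PIndSet.mono {k : Subfield M} {Z W : Set M} (h : PIndSet p k Z) (hW : W ⊆ Z) :
    PIndSet p k W := fun s hs => h s (hs.trans hW)

theorem monIndep_of_isEmpty {ι : Type*} [Fintype ι] [IsEmpty ι] (k : Subfield M) (a : ι → M) :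
    MonIndep p k a := by
  classical
  refine monIndep_iff.2 fun c _ h e => ?_
  rw [Fintype.sum_unique] at h
  rw [Subsingleton.elim e default]
  simpa [pMon] using h

theorem pIndSet_empty (k : Subfield M) : PIndSet p k ∅ := by
  intro s hs
  have : IsEmpty s := ⟨fun x => Set.notMem_empty _ (hs (Finset.mem_coe.2 x.2))⟩
  exact monIndep_of_isEmpty k _

theorem PIndSet.monIndep {k : Subfield M} {Z : Set M} (h : PIndSet p k Z) {ι : Type*} [Fintype ι]
    {a : ι → M} (ha : Function.Injective a) (haZ : ∀ i, a i ∈ Z) : MonIndep p k a := by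
  classical
  obtain ⟨T, hT⟩ : ∃ T : Finset M, ∀ x, x ∈ T ↔ ∃ i, a i = x :=
    ⟨Finset.univ.image a, by simp⟩
  have h1 := h T (fun x hx => by
    obtain ⟨i, rfl⟩ := (hT x).1 hx
    exact haZ i)
  let σ : ι ≃ T := Equiv.ofBijective (fun i => ⟨a i, (hT _).2 ⟨i, rfl⟩⟩)
      ⟨fun i j hij => ha (congrArg Subtype.val hij), fun ⟨x, hx⟩ => by
        obtain ⟨i, rfl⟩ := (hT x).1 hx
        exact ⟨i, rfl⟩⟩
  have h2 : (fun x : T => (x : M)) ∘ σ = a := rfl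
  rw [← h2]
  exact (monIndep_comp_equiv σ).2 h1

theorem exists_finset_of_mem_sup_closure {k : Subfield M} {W : Set M} {x : M}
    (hx : x ∈ k ⊔ Subfield.closure W) :
    ∃ t : Finset M, ↑t ⊆ W ∧ x ∈ k ⊔ Subfield.closure (t : Set M) := by
  rw [← adjoin_eq_sup_closure] at hx
  obtain ⟨T, hT, h⟩ := IntermediateField.exists_finset_of_mem_adjoin (F := k) (S := W) hx
  exact ⟨T, hT, by rw [← adjoin_eq_sup_closure]; exact h⟩

theorem exists_finset_of_forall_mem_sup_closure {k : Subfield M} {W : Set M} {ι : Type*}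
    [Fintype ι] {x : ι → M} (hx : ∀ i, x i ∈ k ⊔ Subfield.closure W) :
    ∃ t : Finset M, ↑t ⊆ W ∧ ∀ i, x i ∈ k ⊔ Subfield.closure (t : Set M) := by
  classical
  choose t ht h using fun i => exists_finset_of_mem_sup_closure (hx i)
  refine ⟨Finset.univ.biUnion t, by simpa using ht, fun i => ?_⟩
  refine sup_le_sup_left (Subfield.closure_mono ?_) k (h i)
  exact_mod_cast Finset.subset_biUnion_of_mem t (Finset.mem_univ i)

theorem range_subtype_finset (t : Finset M) : Set.range (fun x : t => (x : M)) = ↑t := by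
  ext; simp

variable [Fact p.Prime]

/-- Scalar extension along a monomially independent set: a tuple of elements of `k` that is linearly
independent over `C` stays so over `C(Z)` if `Z` is independent over `k`. -/
theorem PIndSet.linearIndependent {k C A : Subfield M} {Z : Set M} (h : PIndSet p k Z)
    (hC : C ≤ k) (hA : A ≤ C ⊔ Subfield.closure Z) (hZ : ∀ z ∈ Z, z ^ p ∈ C) {κ : Type*}
    [Fintype κ] {s : κ → M} (hs : ∀ i, s i ∈ k) (hli : LinearIndependent C s) :
    LinearIndependent A s := by
  classical
  rw [linearIndependent_subfield_iff] at hli ⊢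
  intro c hc hsum
  obtain ⟨t, htZ, ht⟩ := exists_finset_of_forall_mem_sup_closure fun i => hA (hc i)
  rw [← range_subtype_finset t] at ht
  choose d hd hcd using fun i =>
    exists_sum_pMon_of_mem (fun x : t => hZ x (htZ x.2)) (ht i)
  -- Sorted by monomials in `t`, the relation has coefficients `∑ i, d i e * s i` in `k`.
  -- Independence over `k` kills each of them, and then independence of `s` over `C` kills every `d
  -- i e`.
  have h0 := monIndep_iff.1 (h t htZ) (fun e => ∑ i, d i e * s i)
    (fun e => sum_mem fun i _ => mul_mem (hC (hd i e)) (hs i)) (by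
      rw [← hsum]
      simp only [hcd, Finset.sum_mul]
      rw [Finset.sum_comm]
      refine Finset.sum_congr rfl fun i _ => Finset.sum_congr rfl fun e _ => by ring)
  intro i
  rw [hcd i]
  exact Finset.sum_eq_zero fun e _ => by rw [hli (fun i => d i e) (fun i => hd i e) (h0 e) i, zero_mul]

variable [CharP M p]

theorem PIndSet.insert {k : Subfield M} (hk : ∀ x : M, x ^ p ∈ k) {Z : Set M}
    (h : PIndSet p k Z) {x : M} (hx : x ∉ k ⊔ Subfield.closure Z) :
    PIndSet p k (insert x Z) := by
  classical
  intro s hs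
  by_cases hxs : x ∈ s
  · have hst : s = Insert.insert x (s.erase x) := (Finset.insert_erase hxs).symm
    have hsub : ((s.erase x : Finset M) : Set M) ⊆ Z := by
      intro y hy
      rw [Finset.coe_erase] at hy
      exact (hs hy.1).resolve_left hy.2
    rw [hst]
    generalize s.erase x = t at *
    clear hst
    have hxt : x ∉ t := fun hxt => hx ((le_sup_right : Subfield.closure Z ≤ _)
      (Subfield.subset_closure (hsub hxt)))
    rw [← monIndep_comp_equiv (Finset.subtypeInsertEquivOption hxt).symm,
      monIndep_option fun i => hk _]
    refine ⟨h t hsub, ?_⟩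
    intro hmem
    refine hx (sup_le_sup_left (Subfield.closure_mono ?_) k hmem)
    rintro _ ⟨y, rfl⟩
    exact hsub y.2
  · exact h s fun y hy => (hs hy).resolve_left fun e => hxs (e ▸ hy)

theorem PIndSet.notMem {k : Subfield M} (hk : ∀ x : M, x ^ p ∈ k) {Z : Set M}
    (h : PIndSet p k Z) {x : M} (hx : x ∈ Z) {W : Set M} (hW : W ⊆ Z \ {x}) :
    x ∉ k ⊔ Subfield.closure W := by
  classical
  intro hmem
  obtain ⟨t, ht, hxt⟩ := exists_finset_of_mem_sup_closure hmem
  have hnt : x ∉ t := fun hh => (hW (ht hh)).2 rfl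
  have := h (Insert.insert x t) (by
    intro y hy
    rcases Finset.mem_insert.1 hy with rfl | hy
    · exact hx
    · exact (hW (ht hy)).1)
  rw [← monIndep_comp_equiv (Finset.subtypeInsertEquivOption hnt).symm,
    monIndep_option fun i => hk _] at this
  apply this.2
  rw [← range_subtype_finset t] at hxt
  exact hxt

/-- Elements of `Z'` are added to `Z` one by one. Since `Z ⊆ k'`, what `Z` and earlier elements of
`Z'` generate over `k` lies inside what the latter generate over `k'`, and the next element avoids
that. Independent sets of successive levels are stacked in this way. -/
theorem PIndSet.union {k k' : Subfield M} (hk : ∀ x : M, x ^ p ∈ k) (hkk' : k ≤ k') {Z Z' : Set M}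
    (h : PIndSet p k Z) (hZ : Z ⊆ k') (h' : PIndSet p k' Z') : PIndSet p k (Z ∪ Z') := by
  classical
  have key : ∀ t : Finset M, ↑t ⊆ Z' → PIndSet p k (Z ∪ ↑t) := by
    intro t
    induction t using Finset.induction_on with
    | empty => intro _; simpa using h
    | insert x t hxt ih =>
      intro ht
      rw [Finset.coe_insert, Set.insert_subset_iff] at ht
      rw [Finset.coe_insert, Set.union_insert]
      refine (ih ht.2).insert hk fun hmem => ?_
      refine h'.notMem (fun x => hkk' (hk x)) ht.1 (W := ↑t)
        (fun y hy => ⟨ht.2 hy, fun e => hxt (by rw [Set.mem_singleton_iff] at e; exact e ▸ hy)⟩) ?_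
      rw [Subfield.closure_union] at hmem
      refine (sup_le (hkk'.trans le_sup_left) (sup_le ?_ le_sup_right)) hmem
      exact (Subfield.closure_le.2 hZ).trans le_sup_left
  intro s hs
  refine key (s.filter (· ∈ Z')) (by intro x; simp) s fun x hx => ?_
  rcases hs hx with h1 | h1
  · exact Or.inl h1
  · exact Or.inr (by simpa using ⟨hx, h1⟩)

/-- A monomially independent subset of `B` extends to a maximal one, which then generates. -/
theorem PIndSet.exists_maximal {k B : Subfield M} (hk : ∀ x : M, x ^ p ∈ k) {Z : Set M}
    (h : PIndSet p k Z) (hZ : Z ⊆ B) :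
    ∃ Y, Z ⊆ Y ∧ Y ⊆ B ∧ PIndSet p k Y ∧ B ≤ k ⊔ Subfield.closure Y := by
  obtain ⟨Y, hZY, hY⟩ := zorn_subset_nonempty {Y : Set M | Y ⊆ B ∧ PIndSet p k Y} (by
    intro c hc hchain hne
    refine ⟨⋃₀ c, ⟨Set.sUnion_subset fun s hs => (hc hs).1, ?_⟩, fun s hs => Set.subset_sUnion_of_mem hs⟩
    intro s hs
    obtain ⟨t, htc, hst⟩ := DirectedOn.exists_mem_subset_of_finset_subset_biUnion (f := id) hne
      hchain.directedOn (by simpa [Set.sUnion_eq_biUnion] using hs)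
    exact (hc htc).2 s hst) Z ⟨hZ, h⟩
  refine ⟨Y, hZY, hY.prop.1, hY.prop.2, fun x hx => ?_⟩
  by_contra hxY
  have := hY.eq_of_subset ⟨Set.insert_subset hx hY.prop.1, hY.prop.2.insert hk hxY⟩
    (Set.subset_insert x Y)
  exact hxY ((le_sup_right : Subfield.closure Y ≤ _) (Subfield.subset_closure
    (this ▸ Set.mem_insert x Y)))

end PIndSet

/-! ### Symmetry of linear disjointness -/

section Symmetry

variable {M : Type*} [Field M]

/-- Linear disjointness over `C` is symmetric. -/
theorem linearIndependent_of_linDisj {C A B : Subfield M} (hCB : C ≤ B)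
    (h : ∀ (n : ℕ) (s : Fin n → M), (∀ i, s i ∈ A) → LinearIndependent C s →
      LinearIndependent B s) {κ : Type*} [Fintype κ] {u : κ → M} (hu : ∀ i, u i ∈ B)
    (hli : LinearIndependent C u) (hCA : C ≤ A) : LinearIndependent A u := by
  classical
  rw [linearIndependent_subfield_iff] at hli ⊢
  intro c hc hsum
  -- The coefficients `c` span a finite-dimensional `C`-space inside `A`. Rewritten in a basis `b`
  -- of it, the relation among `u` becomes one among `b` with coefficients in `B`, to which the
  -- hypothesis applies.
  let V : Submodule C M := Submodule.span C (Set.range c)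
  have : FiniteDimensional C V := FiniteDimensional.span_of_finite C (Set.finite_range c)
  let b := Module.finBasis C V
  have hV : ∀ x ∈ V, x ∈ A := by
    intro x hx
    induction hx using Submodule.span_induction with
    | mem x hx => obtain ⟨i, rfl⟩ := hx; exact hc i
    | zero => exact zero_mem A
    | add x y _ _ hx hy => exact add_mem hx hy
    | smul r x _ hx => exact mul_mem (hCA r.2) hx
  have hbli : LinearIndependent C (fun i => (b i : M)) :=
    b.linearIndependent.map' V.subtype (Submodule.ker_subtype V)
  have hB := linearIndependent_subfield_iff.1 (h _ _ (fun i => hV _ (b i).2) hbli)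
  let c' : κ → V := fun i => ⟨c i, Submodule.subset_span ⟨i, rfl⟩⟩
  have hexp : ∀ i, c i = ∑ k, (b.repr (c' i) k : M) * b k := by
    intro i
    have := congrArg Subtype.val (b.sum_repr (c' i))
    rw [Submodule.coe_sum] at this
    exact this.symm
  have h0 := hB (fun k => ∑ i, (b.repr (c' i) k : M) * u i)
    (fun k => sum_mem fun i _ => mul_mem (hCB (b.repr (c' i) k).2) (hu i)) (by
      rw [← hsum]
      simp only [Finset.sum_mul]
      rw [Finset.sum_comm]
      refine Finset.sum_congr rfl fun i _ => ?_
      rw [hexp i, Finset.sum_mul]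
      exact Finset.sum_congr rfl fun e _ => by ring)
  intro i
  rw [hexp i]
  exact Finset.sum_eq_zero fun k _ => by
    rw [hli (fun i => (b.repr (c' i) k : M)) (fun i => (b.repr (c' i) k).2) (h0 k) i, zero_mul]

end Symmetry

/-! ### Degrees and extension of independent tuples -/

section Rank

variable {M : Type*} [Field M]

/-- An element of `ℕ∞` is determined by its finite lower bounds, and in this form each bound is a
first-order condition. -/
theorem natCast_le_degrees {m : ℕ} {F : Fin (m + 2) → Subfield M} (hF : Monotone F)
    (j : Fin (m + 1)) (n : ℕ) :
    (n : ℕ∞) ≤ degrees F j ↔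
      ∃ y : Fin n → M, (∀ i, y i ∈ F j.succ) ∧ LinearIndependent (F j.castSucc) y := by
  have hle : F j.castSucc ≤ F j.succ := hF (Fin.castSucc_le_succ j)
  unfold degrees
  rw [Subfield.relrank_eq_rank_of_le hle, Cardinal.natCast_le_toENat]
  constructor
  · intro h
    obtain ⟨s, hs, hli⟩ := le_rank_iff_exists_linearIndependent_finset.1 h
    let σ : Fin n ≃ s := (Fin.castOrderIso hs.symm).toEquiv.trans s.equivFin.symm
    refine ⟨fun i => ((σ i : Subfield.extendScalars hle) : M), fun i => (σ i).1.2, ?_⟩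
    have h1 := hli.comp σ σ.injective
    exact h1.map' (Subfield.extendScalars hle).val.toLinearMap (LinearMap.ker_eq_bot.2
      Subtype.val_injective)
  · rintro ⟨y, hy, hli⟩
    let y' : Fin n → Subfield.extendScalars hle := fun i => ⟨y i, hy i⟩
    have h1 : LinearIndependent (F j.castSucc) y' :=
      LinearIndependent.of_comp (Subfield.extendScalars hle).val.toLinearMap hli
    simpa using h1.cardinal_lift_le_rank

end Rank

section Extend

variable {M : Type*} [Field M] {p : ℕ} [Fact p.Prime] [CharP M p] {m : ℕ}

/-- A monomially independent tuple whose length is not maximal for the degree can be extended. -/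
theorem exists_notMem_of_le_degrees {F : Fin (m + 2) → Subfield M} (hF : Monotone F)
    {j : Fin (m + 1)} {ι : Type*} [Fintype ι] {a : ι → M}
    (ha : ∀ i, a i ^ p ∈ F j.castSucc)
    (hd : ((p ^ (Fintype.card ι + 1) : ℕ) : ℕ∞) ≤ degrees F j) :
    ∃ x ∈ F j.succ, x ∉ F j.castSucc ⊔ Subfield.closure (Set.range a) := by
  classical
  -- Otherwise the `p ^ card ι` monomials in `a` would span `F j.succ` over `F j.castSucc`, too few
  -- for `p ^ (card ι + 1)` independent elements.
  by_contra! hcon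
  obtain ⟨y, hy, hli⟩ := (natCast_le_degrees hF j _).1 hd
  have hle : Set.range y ⊆ Submodule.span (F j.castSucc) (Set.range (pMon p a)) := by
    rintro _ ⟨i, rfl⟩
    obtain ⟨c, hc, h⟩ := exists_sum_pMon_of_mem ha (hcon _ (hy i))
    rw [h]
    exact sum_mem fun e _ =>
      Submodule.smul_mem _ (⟨c e, hc e⟩ : F j.castSucc) (Submodule.subset_span ⟨e, rfl⟩)
  have := linearIndependent_le_span' y hli (Set.range (pMon p a)) hle
  have h2 : Fintype.card (Set.range (pMon p a)) ≤ Fintype.card (ι → Fin p) :=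
    Fintype.card_range_le _
  rw [Cardinal.mk_fintype, Fintype.card_fin] at this
  have h3 : p ^ (Fintype.card ι + 1) ≤ p ^ Fintype.card ι := by
    have := (Nat.cast_le.1 this).trans h2
    simpa using this
  have hp := (Fact.out : p.Prime)
  exact absurd h3 (not_le.2 (Nat.pow_lt_pow_right hp.one_lt (Nat.lt_succ_self _)))

end Extend

/-! ### Degree form of `p`-independence, and uniqueness of expansions -/

section PIndependent

variable {M : Type*} [Field M] {p : ℕ} [Fact p.Prime] [CharP M p]

theorem mem_pPowers {k : Subfield M} {x : M} : x ∈ pPowers p k ↔ ∃ y ∈ k, y ^ p = x := by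
  simp [pPowers, Subfield.mem_map, frobenius_def]

theorem MonIndep.comp {ι κ : Type*} [Fintype ι] [Fintype κ] {k : Subfield M} {a : ι → M}
    (h : MonIndep p k a) {f : κ → ι} (hf : Function.Injective f) : MonIndep p k (a ∘ f) := by
  have hp := (Fact.out : p.Prime)
  have hext : ∀ (e : κ → Fin p), pMon p a (Function.extend f e fun _ => ⟨0, hp.pos⟩) =
      pMon p (a ∘ f) e := by
    classical
    intro e
    simp only [pMon, Function.comp_apply]
    rw [← Finset.prod_subset (Finset.subset_univ (Finset.univ.image f))]
    · rw [Finset.prod_image fun x _ y _ h => hf h]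
      exact Finset.prod_congr rfl fun i _ => by rw [hf.extend_apply]
    · intro i _ hi
      rw [Function.extend_apply' _ _ _ (by rintro ⟨x, rfl⟩; exact hi (by simp)), pow_zero]
  have := LinearIndependent.comp h (fun e => Function.extend f e fun _ => (⟨0, hp.pos⟩ : Fin p))
    (Function.extend_injective hf _)
  unfold MonIndep
  convert! this using 1
  funext e
  exact (hext e).symm

/-- The monomials always span `k(a)` over `k`, so the degree reaches their number exactly when they
are independent. -/
theorem relfinrank_sup_closure {ι : Type*} [Fintype ι] [DecidableEq ι] {k : Subfield M} {a : ι → M}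
    (ha : ∀ i, a i ^ p ∈ k) :
    k.relfinrank (k ⊔ Subfield.closure (Set.range a)) = p ^ Fintype.card ι ↔ MonIndep p k a := by
  set W := Subfield.extendScalars (le_sup_left : k ≤ k ⊔ Subfield.closure (Set.range a)) with hW
  rw [Subfield.relfinrank_eq_finrank_of_le le_sup_left]
  have hmem : ∀ e, pMon p a e ∈ W := fun e => prod_mem fun i _ => pow_mem
    ((le_sup_right : Subfield.closure (Set.range a) ≤ _)
      (Subfield.subset_closure (Set.mem_range_self i))) _
  let v : (ι → Fin p) → W := fun e => ⟨pMon p a e, hmem e⟩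
  have hspan : ⊤ ≤ Submodule.span k (Set.range v) := by
    rintro ⟨x, hx⟩ -
    obtain ⟨c, hc, rfl⟩ := exists_sum_pMon_of_mem ha hx
    have : (⟨_, hx⟩ : W) = ∑ e, (⟨c e, hc e⟩ : k) • v e := by
      apply Subtype.ext
      rw [← IntermediateField.coe_val W, map_sum]
      rfl
    rw [this]
    exact sum_mem fun e _ => Submodule.smul_mem _ _ (Submodule.subset_span ⟨e, rfl⟩)
  have hv : MonIndep p k a ↔ LinearIndependent k v :=
    ⟨fun h => LinearIndependent.of_comp W.val.toLinearMap h, fun h =>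
      h.map' W.val.toLinearMap (LinearMap.ker_eq_bot.2 Subtype.val_injective)⟩
  have hcard : Fintype.card (ι → Fin p) = p ^ Fintype.card ι := by simp
  rw [hv, ← hcard]
  constructor
  · intro h
    exact linearIndependent_of_top_le_span_of_card_eq_finrank hspan h.symm
  · intro h
    exact Module.finrank_eq_card_basis (Module.Basis.mk h hspan)

/-- The condition on the full tuple implies the one on every subtuple, because the monomials in a
subtuple are among the monomials in the tuple. -/
theorem pIndependent_iff {k : Subfield M} {n : ℕ} {a : Fin n → M} :
    PIndependent p k a ↔ (∀ i, a i ∈ k) ∧ MonIndep p (pPowers p k) a := by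
  classical
  unfold PIndependent
  refine and_congr_right fun hk => ?_
  have ha : ∀ i, a i ^ p ∈ pPowers p k := fun i => mem_pPowers.2 ⟨_, hk i, rfl⟩
  constructor
  · intro h
    rw [← relfinrank_sup_closure ha]
    simpa using h Finset.univ
  · intro h s
    have h1 := h.comp (f := fun x : s => (x : Fin n)) Subtype.val_injective
    replace h1 := (relfinrank_sup_closure (a := a ∘ fun x : s => (x : Fin n)) fun i => ha _).2 h1
    simpa [Set.range_comp] using h1

end PIndependent

section Lambda

variable {M : Type*} [Field M] {p : ℕ} [Fact p.Prime] [CharP M p]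

theorem isExpansion_iff {k : Subfield M} {n : ℕ} {a : Fin n → M} {b : M}
    {c : (Fin n → Fin p) → M} :
    IsExpansion p k a b c ↔ (∀ e, c e ∈ k) ∧ b = ∑ e, c e ^ p * pMon p a e := Iff.rfl

theorem IsExpansion.unique {k : Subfield M} {n : ℕ} {a : Fin n → M} {b : M}
    {c c' : (Fin n → Fin p) → M} (ha : PIndependent p k a) (h : IsExpansion p k a b c)
    (h' : IsExpansion p k a b c') : c = c' := by
  rw [isExpansion_iff] at h h'
  have := monIndep_iff.1 (pIndependent_iff.1 ha).2 (fun e => (c e - c' e) ^ p)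
    (fun e => mem_pPowers.2 ⟨_, sub_mem (h.1 e) (h'.1 e), rfl⟩) (by
      simp only [sub_pow_char, sub_mul, Finset.sum_sub_distrib]
      rw [← h.2, ← h'.2, sub_self])
  funext e
  exact sub_eq_zero.1 (pow_eq_zero_iff (Fact.out : p.Prime).ne_zero |>.1 (this e))

theorem lambdaFun_eq {k : Subfield M} {n : ℕ} {a : Fin n → M} {b : M}
    {c : (Fin n → Fin p) → M} (ha : PIndependent p k a) (h : IsExpansion p k a b c)
    (e : Fin n → Fin p) : lambdaFun p k e a b = c e := by
  have hh : PIndependent p k a ∧ ∃ c, IsExpansion p k a b c := ⟨ha, c, h⟩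
  rw [lambdaFun, dif_pos hh, hh.2.choose_spec.unique ha h]

theorem lambdaFun_eq_zero {k : Subfield M} {n : ℕ} {a : Fin n → M} {b : M}
    (h : ¬ (PIndependent p k a ∧ ∃ c, IsExpansion p k a b c))
    (e : Fin n → Fin p) : lambdaFun p k e a b = 0 := by
  rw [lambdaFun, dif_neg h]

end Lambda

theorem pPowers_mono {M : Type*} [Field M] {p : ℕ} [Fact p.Prime] [CharP M p]
    {k k' : Subfield M} (h : k ≤ k') : pPowers p k ≤ pPowers p k' :=
  (Subfield.gc_map_comap _).monotone_l h

/-! ### Transport along field embeddings -/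

section Transport

variable {M E : Type*} [Field M] [Field E] (g : E →+* M)

theorem linearIndependent_map {ι : Type*} [Fintype ι] {k : Subfield E} {s : ι → E} :
    LinearIndependent (k.map g) (fun i => g (s i)) ↔ LinearIndependent k s := by
  simp only [linearIndependent_subfield_iff]
  constructor
  · intro h c hc hs i
    have := h (fun i => g (c i)) (fun i => Subfield.mem_map.2 ⟨_, hc i, rfl⟩)
      (by rw [← map_zero g, ← hs]; simp) i
    simpa using this
  · intro h c hc hs i
    choose d hd hdc using fun i => Subfield.mem_map.1 (hc i)
    rw [← hdc i, h d hd, map_zero]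
    apply g.injective
    rw [map_zero, ← hs]
    simp [hdc]

theorem map_pMon {p : ℕ} {ι : Type*} [Fintype ι] (a : ι → E) (e : ι → Fin p) :
    g (pMon p a e) = pMon p (fun i => g (a i)) e := by
  simp [pMon]

theorem monIndep_map {p : ℕ} {ι : Type*} [Fintype ι] {k : Subfield E} {a : ι → E} :
    MonIndep p (k.map g) (fun i => g (a i)) ↔ MonIndep p k a := by
  classical
  unfold MonIndep
  rw [← linearIndependent_map g]
  simp only [map_pMon]

theorem LinearIndependent.mono_subfield {k k' : Subfield M} (hk : k ≤ k') {ι : Type*} [Fintype ι]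
    {s : ι → M} (h : LinearIndependent k' s) : LinearIndependent k s := by
  rw [linearIndependent_subfield_iff] at h ⊢
  exact fun c hc => h c fun e => hk (hc e)

end Transport

/-! ### Good embeddings and linear disjointness -/

section Good

variable {M E : Type*} [Field M] [Field E] (p : ℕ) [Fact p.Prime] [CharP M p] [CharP E p] {m : ℕ}

/-- `g` embeds `E` separably into the chain `F`: `X` is a `p`-basis of `E`, divided into parts
`X j ⊆ F (j + 1)` that stay independent over `F j`. -/
structure IsGood (F : Fin (m + 2) → Subfield M) (g : E →+* M) (X : Fin (m + 1) → Set E) :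
    Prop where
  gen : (frobenius E p).fieldRange ⊔ Subfield.closure (⋃ j, X j) = ⊤
  mem : ∀ j, ∀ x ∈ X j, g x ∈ F j.succ
  ind : ∀ j, PIndSet p (F j.castSucc) (g '' X j)

/-- The members of the chain on `E` determined by a divided `p`-basis. -/
def levelField (X : Fin (m + 1) → Set E) (j : Fin (m + 2)) : Subfield E :=
  (frobenius E p).fieldRange ⊔ Subfield.closure (⋃ i, ⋃ (_ : i.castSucc < j), X i)

/-- The part of a divided `p`-basis above level `j`. -/
def upperPart (X : Fin (m + 1) → Set E) (j : Fin (m + 2)) : Set E :=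
  ⋃ i, ⋃ (_ : j ≤ i.castSucc), X i

variable {p} {F : Fin (m + 2) → Subfield M} {g : E →+* M} {X : Fin (m + 1) → Set E}

theorem IsFrobeniusChain.pow_mem (hF : IsFrobeniusChain p F) (j : Fin (m + 2)) (x : M) :
    x ^ p ∈ F j := by
  apply hF.mono (Fin.zero_le j)
  rw [hF.zero]
  exact ⟨x, rfl⟩

theorem levelField_zero : levelField p X 0 = (frobenius E p).fieldRange := by
  have : (⋃ i : Fin (m + 1), ⋃ (_ : i.castSucc < 0), X i) = ∅ := by
    simp only [Set.iUnion_eq_empty]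
    exact fun i hi => absurd hi (Fin.not_lt_zero _)
  rw [levelField, this, Subfield.closure_empty, sup_bot_eq]

theorem IsGood.map_mem (hF : IsFrobeniusChain p F) (hg : IsGood p F g X) {j : Fin (m + 2)} {x : E}
    (hx : x ∈ levelField p X j) : g x ∈ F j := by
  have : levelField p X j ≤ (F j).comap g := by
    refine sup_le ?_ (Subfield.closure_le.2 ?_)
    · rintro _ ⟨y, rfl⟩
      simpa [frobenius_def] using hF.pow_mem j (g y)
    · intro x hx
      simp only [Set.mem_iUnion] at hx
      obtain ⟨i, hi, hx⟩ := hx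
      exact hF.mono (Fin.castSucc_lt_iff_succ_le.1 hi) (hg.mem i x hx)
  exact this hx

/-- Downward induction: the part from level `i` upwards is `X i`, which lies in `F i.succ` and is
independent over `F i.castSucc`, together with the part from the next level upwards, which is
independent over `F i.succ`. `PIndSet.union` joins them. -/
theorem IsGood.pIndSet_upperPart (hF : IsFrobeniusChain p F) (hg : IsGood p F g X)
    (j : Fin (m + 2)) : PIndSet p (F j) (g '' upperPart X j) := by
  induction j using Fin.reverseInduction with
  | last =>
    have : upperPart X (Fin.last (m + 1)) = ∅ := by
      simp only [upperPart, Set.iUnion_eq_empty]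
      intro i hi
      exact absurd (Fin.castSucc_lt_last i) (not_lt.2 hi)
    rw [this, Set.image_empty]
    exact pIndSet_empty _
  | cast i ih =>
    have : upperPart X i.castSucc = X i ∪ upperPart X i.succ := by
      ext x
      simp only [upperPart, Set.mem_iUnion, Set.mem_union, exists_prop]
      constructor
      · rintro ⟨k, hk, hx⟩
        rcases (Fin.castSucc_le_castSucc_iff.1 hk).eq_or_lt with rfl | h
        · exact Or.inl hx
        · exact Or.inr ⟨k, Fin.succ_le_castSucc_iff.2 h, hx⟩
      · rintro (hx | ⟨k, hk, hx⟩)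
        · exact ⟨i, le_rfl, hx⟩
        · exact ⟨k, (Fin.castSucc_le_succ i).trans hk, hx⟩
    rw [this, Set.image_union]
    refine PIndSet.union (hF.pow_mem _) (hF.mono (Fin.castSucc_le_succ i)) (hg.ind i) ?_ ih
    rintro _ ⟨x, hx, rfl⟩
    exact hg.mem i x hx

/-- `g(E)` is generated over the image of its `j`-th level by the upper part of the `p`-basis, which
is independent over `F j` and has its `p`-th powers in that image. Hence `F j` and `g(E)` are
linearly disjoint over the image; the transfer properties of good embeddings all come from this. -/
theorem IsGood.linearIndependent (hF : IsFrobeniusChain p F) (hg : IsGood p F g X)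
    (j : Fin (m + 2)) {κ : Type*} [Fintype κ] {s : κ → M} (hs : ∀ i, s i ∈ F j)
    (hli : LinearIndependent ((levelField p X j).map g) s) :
    LinearIndependent g.fieldRange s := by
  refine (hg.pIndSet_upperPart hF j).linearIndependent (C := (levelField p X j).map g) ?_ ?_ ?_
    hs hli
  · rintro _ ⟨x, hx, rfl⟩
    exact hg.map_mem hF hx
  · rw [g.fieldRange_eq_map, ← hg.gen, Subfield.map_sup, levelField, Subfield.map_sup,
      RingHom.map_field_closure, RingHom.map_field_closure, sup_assoc]
    refine sup_le_sup_left ?_ _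
    rw [← Subfield.closure_union, ← Set.image_union]
    refine Subfield.closure_mono (Set.image_mono ?_)
    refine Set.iUnion_subset fun i x hx => ?_
    simp only [upperPart, Set.mem_union, Set.mem_iUnion, exists_prop]
    rcases lt_or_ge i.castSucc j with h | h
    · exact Or.inl ⟨i, h, hx⟩
    · exact Or.inr ⟨i, h, hx⟩
  · rintro _ ⟨x, hx, rfl⟩
    refine ⟨x ^ p, ?_, by simp⟩
    exact (le_sup_left : (frobenius E p).fieldRange ≤ levelField p X j) ⟨x, rfl⟩

/-- For `x` outside the level, `1` and `g x` are independent over the image of the level. If `g x`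
were in `F j`, they would stay independent over `g(E)`, which contains `g x`. -/
theorem IsGood.mem_iff (hF : IsFrobeniusChain p F) (hg : IsGood p F g X) {j : Fin (m + 2)} {x : E} :
    g x ∈ F j ↔ x ∈ levelField p X j := by
  refine ⟨fun hx => ?_, hg.map_mem hF⟩
  by_contra hxl
  have h1 : LinearIndependent ((levelField p X j).map g) ![1, g x] := by
    rw [LinearIndependent.pair_iff]
    intro s t hst
    obtain ⟨s', hs', hs⟩ := Subfield.mem_map.1 s.2
    obtain ⟨t', ht', ht⟩ := Subfield.mem_map.1 t.2
    have h2 : g s' + g (t' * x) = 0 := by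
      rw [map_mul, hs, ht]
      simpa [Subfield.smul_def] using hst
    have h3 : s' + t' * x = 0 := by
      apply g.injective
      simpa using h2
    have ht0 : t' = 0 := by
      by_contra hne
      apply hxl
      have : x = t'⁻¹ * (- s') := by field_simp; linear_combination h3
      rw [this]
      exact mul_mem (inv_mem ht') (neg_mem hs')
    have hs0 : s' = 0 := by simpa [ht0] using h3
    constructor
    · apply Subtype.ext; rw [← hs, hs0]; simp
    · apply Subtype.ext; rw [← ht, ht0]; simp
  have h2 := hg.linearIndependent hF j (s := ![1, g x]) (by
    intro i; fin_cases i
    · exact one_mem _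
    · exact hx) h1
  rw [LinearIndependent.pair_iff] at h2
  have := (h2 ⟨g x, x, rfl⟩ ⟨-1, -1, by simp⟩ (by simp [Subfield.smul_def])).2
  have := congrArg Subtype.val this
  simp at this

theorem pow_linearIndependent {k : Subfield M} {κ : Type*} [Fintype κ] {t : κ → M}
    (h : LinearIndependent k t) : LinearIndependent (pPowers p k) (fun i => t i ^ p) := by
  rw [linearIndependent_subfield_iff] at h ⊢
  intro c hc hs i
  choose d hd hdc using fun i => mem_pPowers.1 (hc i)
  rw [← hdc i, h d hd, zero_pow (Fact.out : p.Prime).ne_zero]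
  apply frobenius_inj M p
  rw [map_zero, ← hs, map_sum]
  simp [frobenius_def, mul_pow, hdc]

theorem linearIndependent_of_pow {k : Subfield M} {κ : Type*} [Fintype κ] {t : κ → M}
    (h : LinearIndependent (pPowers p k) (fun i => t i ^ p)) : LinearIndependent k t := by
  rw [linearIndependent_subfield_iff] at h ⊢
  intro c hc hs i
  have := h (fun i => c i ^ p) (fun i => mem_pPowers.2 ⟨_, hc i, rfl⟩) (by
    simp_rw [← mul_pow, ← frobenius_def]
    rw [← map_sum, hs, map_zero]) i
  exact pow_eq_zero_iff (Fact.out : p.Prime).ne_zero |>.1 this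

theorem levelField_zero_map : (levelField p X 0).map g = pPowers p g.fieldRange := by
  ext x
  rw [mem_pPowers]
  simp only [levelField_zero, Subfield.mem_map, RingHom.mem_fieldRange, frobenius_def]
  constructor
  · rintro ⟨_, ⟨y, rfl⟩, rfl⟩
    exact ⟨g y, ⟨y, rfl⟩, by simp⟩
  · rintro ⟨_, ⟨y, rfl⟩, rfl⟩
    exact ⟨_, ⟨y, rfl⟩, by simp⟩

/-- Mac Lane's criterion for a separable embedding. -/
theorem IsGood.pow_linearIndependent (hF : IsFrobeniusChain p F) (hg : IsGood p F g X)
    {κ : Type*} [Fintype κ] {t : κ → M} (h : LinearIndependent g.fieldRange t) :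
    LinearIndependent g.fieldRange (fun i => t i ^ p) := by
  -- Disjointness at level zero: the `t i ^ p` lie in `F 0 = M ^ p`, so independence over `g(E) ^ p`
  -- suffices, and that is the Frobenius image of the hypothesis.
  refine hg.linearIndependent hF 0 (fun i => hF.pow_mem _ _) ?_
  rw [levelField_zero_map]
  exact SepClosedChain.pow_linearIndependent h

/-- For a tuple `t i ^ p` from `(F j) ^ p`, independence passes to `t` by taking roots, from the
`j`-th level to `g(E)` by disjointness, and back to the `t i ^ p` by Mac Lane's criterion. Symmetry
of linear disjointness turns this into a statement on tuples from `g(E)`. -/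
theorem IsGood.linearIndependent_pPowers (hF : IsFrobeniusChain p F) (hg : IsGood p F g X)
    (j : Fin (m + 2)) {κ : Type*} [Fintype κ] {u : κ → M} (hu : ∀ i, u i ∈ g.fieldRange)
    (hli : LinearIndependent (pPowers p ((levelField p X j).map g)) u) :
    LinearIndependent (pPowers p (F j)) u := by
  have hle : (levelField p X j).map g ≤ F j := by
    rintro _ ⟨x, hx, rfl⟩
    exact hg.map_mem hF hx
  refine linearIndependent_of_linDisj (B := g.fieldRange) ?_ ?_ hu hli ?_
  · intro x hx
    obtain ⟨y, hy, rfl⟩ := mem_pPowers.1 hx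
    obtain ⟨z, -, rfl⟩ := Subfield.mem_map.1 hy
    exact ⟨z ^ p, by simp⟩
  · intro n s hs h
    choose t ht hts using fun i => mem_pPowers.1 (hs i)
    obtain rfl : s = fun i => t i ^ p := funext fun i => (hts i).symm
    exact hg.pow_linearIndependent hF (hg.linearIndependent hF j ht (linearIndependent_of_pow h))
  · exact pPowers_mono hle

theorem map_pPowers (k : Subfield E) : (pPowers p k).map g = pPowers p (k.map g) := by
  ext x
  simp only [mem_pPowers, Subfield.mem_map]
  constructor
  · rintro ⟨_, ⟨y, hy, rfl⟩, rfl⟩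
    exact ⟨g y, ⟨y, hy, rfl⟩, by simp⟩
  · rintro ⟨_, ⟨y, hy, rfl⟩, rfl⟩
    exact ⟨_, ⟨y, hy, rfl⟩, by simp⟩

theorem IsGood.pIndependent_iff (hF : IsFrobeniusChain p F) (hg : IsGood p F g X)
    {j : Fin (m + 2)} {n : ℕ} {a : Fin n → E} :
    PIndependent p (F j) (fun i => g (a i)) ↔ PIndependent p (levelField p X j) a := by
  rw [SepClosedChain.pIndependent_iff, SepClosedChain.pIndependent_iff]
  refine and_congr (forall_congr' fun i => hg.mem_iff hF) ?_
  rw [← monIndep_map g, map_pPowers]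
  have hle : (levelField p X j).map g ≤ F j := by
    rintro _ ⟨x, hx, rfl⟩
    exact hg.map_mem hF hx
  refine ⟨fun h => LinearIndependent.mono_subfield (pPowers_mono hle) h,
    fun h => hg.linearIndependent_pPowers hF j (fun e => ?_) h⟩
  rw [← map_pMon]
  exact ⟨_, rfl⟩

theorem IsExpansion.map {k : Subfield E} {k' : Subfield M} (hk : ∀ x ∈ k, g x ∈ k') {n : ℕ}
    {a : Fin n → E} {b : E} {c : (Fin n → Fin p) → E} (h : IsExpansion p k a b c) :
    IsExpansion p k' (fun i => g (a i)) (g b) (fun e => g (c e)) := by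
  rw [isExpansion_iff] at h ⊢
  refine ⟨fun e => hk _ (h.1 e), ?_⟩
  rw [h.2]
  simp [map_pMon]

/-- If `b` were not spanned by the monomials over the `p`-th powers of the level, then `b` and the
monomials would be independent over these, hence over `(F j) ^ p`, against the expansion that exists
in the chain. -/
theorem IsGood.exists_isExpansion (hF : IsFrobeniusChain p F) (hg : IsGood p F g X)
    {j : Fin (m + 2)} {n : ℕ} {a : Fin n → E} {b : E}
    (ha : PIndependent p (levelField p X j) a)
    (h : ∃ c, IsExpansion p (F j) (fun i => g (a i)) (g b) c) :
    ∃ c, IsExpansion p (levelField p X j) a b c := by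
  by_contra hcon
  obtain ⟨c, hc⟩ := h
  rw [isExpansion_iff] at hc
  let s : Option (Fin n → Fin p) → E := fun o => o.elim b (pMon p a)
  have h1 : LinearIndependent (pPowers p (levelField p X j)) s := by
    rw [linearIndependent_option]
    refine ⟨(SepClosedChain.pIndependent_iff.1 ha).2, fun hmem => hcon ?_⟩
    obtain ⟨d, hd⟩ := (Submodule.mem_span_range_iff_exists_fun _).1 hmem
    choose d' hd' hdd using fun e => mem_pPowers.1 (d e).2
    refine ⟨d', isExpansion_iff.2 ⟨hd', ?_⟩⟩
    change _ = b at hd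
    rw [← hd]
    simp only [hdd]
    rfl
  rw [← linearIndependent_map g, map_pPowers] at h1
  have h2 := hg.linearIndependent_pPowers hF j (fun i => ⟨_, rfl⟩) h1
  have h3 := linearIndependent_subfield_iff.1 h2 (fun o => o.elim (-1) fun e => c e ^ p) (by
    rintro (_ | e)
    · exact neg_mem (one_mem _)
    · exact mem_pPowers.2 ⟨_, hc.1 e, rfl⟩) (by
    rw [Fintype.sum_option]
    simp only [Option.elim, s, map_pMon]
    rw [← hc.2]
    ring) none
  simp at h3

theorem IsGood.lambdaFun_map (hF : IsFrobeniusChain p F) (hg : IsGood p F g X)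
    (j : Fin (m + 2)) {n : ℕ} (e : Fin n → Fin p) (a : Fin n → E) (b : E) :
    lambdaFun p (F j) e (fun i => g (a i)) (g b) = g (lambdaFun p (levelField p X j) e a b) := by
  by_cases h : PIndependent p (levelField p X j) a ∧ ∃ c, IsExpansion p (levelField p X j) a b c
  · obtain ⟨ha, c, hc⟩ := h
    rw [lambdaFun_eq ha hc, lambdaFun_eq ((hg.pIndependent_iff hF).2 ha)
      (hc.map fun x => hg.map_mem hF)]
  · rw [lambdaFun_eq_zero h, lambdaFun_eq_zero, map_zero]
    rintro ⟨ha, hex⟩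
    exact h ⟨(hg.pIndependent_iff hF).1 ha, hg.exists_isExpansion hF
      ((hg.pIndependent_iff hF).1 ha) hex⟩

end Good

/-! ### Closing off -/

section Closing

theorem exists_closed_superset {α : Type u} (h : α → Finset α) (S : Set α) :
    ∃ C : Set α, S ⊆ C ∧ (∀ c ∈ C, (h c : Set α) ⊆ C) ∧ #C ≤ max #S ℵ₀ := by
  let step : Set α → Set α := fun T => T ∪ ⋃ x ∈ T, (h x : Set α)
  have hstep : ∀ T, #(step T) ≤ max #T ℵ₀ := by
    intro T
    have h1 : #(⋃ x ∈ T, (h x : Set α)) ≤ max #T ℵ₀ := by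
      refine (Cardinal.mk_biUnion_le _ _).trans ?_
      refine (mul_le_mul' le_rfl (ciSup_le' fun x : T => ?_) : _ ≤ #T * ℵ₀).trans
        (Cardinal.mul_le_max_of_aleph0_le_right le_rfl)
      exact ((h x).finite_toSet.countable).le_aleph0
    refine (Cardinal.mk_union_le _ _).trans ?_
    refine (add_le_add (le_max_left #T ℵ₀) h1).trans ?_
    rw [Cardinal.add_eq_self (le_max_right _ _)]
  have hiter : ∀ n, #(step^[n] S) ≤ max #S ℵ₀ := by
    intro n
    induction n with
    | zero => exact le_max_left _ _
    | succ n ih =>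
      rw [Function.iterate_succ_apply']
      exact (hstep _).trans (max_le ih (le_max_right _ _))
  refine ⟨⋃ n, step^[n] S, Set.subset_iUnion (fun n => step^[n] S) 0, ?_, ?_⟩
  · intro c hc
    obtain ⟨n, hn⟩ := Set.mem_iUnion.1 hc
    refine Set.Subset.trans ?_ (Set.subset_iUnion (fun n => step^[n] S) (n + 1))
    rw [Function.iterate_succ_apply']
    exact Set.Subset.trans (Set.subset_biUnion_of_mem (u := fun x => (h x : Set α)) hn)
      Set.subset_union_right
  · have h1 := Cardinal.mk_iUnion_le_lift (fun n : ℕ => step^[n] S)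
    have h2 : Cardinal.lift.{0} #(⋃ n, step^[n] S) ≤ ℵ₀ * max #S ℵ₀ := by
      refine h1.trans ?_
      simp only [Cardinal.lift_uzero, Cardinal.mk_nat, Cardinal.lift_aleph0]
      exact mul_le_mul' le_rfl (ciSup_le' hiter)
    rw [Cardinal.lift_uzero] at h2
    exact h2.trans ((Cardinal.mul_le_max_of_aleph0_le_left le_rfl).trans
      (max_le (le_max_right _ _) le_rfl))

variable {M : Type u} [Field M] {p : ℕ} [Fact p.Prime] [CharP M p]

/-- Since `M = M ^ p(Z)`, each `x` is rational in finitely many `p`-th powers and elements of `Z`;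
`h x` contains the latter and roots of the former. A set closed under `h` generates a field that is
generated over its own `p`-th powers by elements of `Z`. -/
theorem exists_finset_root {Z : Set M}
    (hZ : (frobenius M p).fieldRange ⊔ Subfield.closure Z = ⊤) :
    ∃ h : M → Finset M, ∀ x,
      x ∈ Subfield.closure ((fun y => y ^ p) '' (h x : Set M) ∪ (h x : Set M) ∩ Z) := by
  classical
  suffices H : ∀ x, ∃ t : Finset M,
      x ∈ Subfield.closure ((fun y => y ^ p) '' (t : Set M) ∪ (t : Set M) ∩ Z) from
    ⟨fun x => (H x).choose, fun x => (H x).choose_spec⟩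
  intro x
  have hx : x ∈ (⊥ : Subfield M) ⊔
      Subfield.closure (((frobenius M p).fieldRange : Set M) ∪ Z) := by
    rw [bot_sup_eq, Subfield.closure_union, Subfield.closure_eq, hZ]
    trivial
  obtain ⟨t, ht, hxt⟩ := exists_finset_of_mem_sup_closure hx
  rw [bot_sup_eq] at hxt
  have hroot : ∀ y : M, ∃ z : M, y ∈ (frobenius M p).fieldRange → z ^ p = y := by
    intro y
    by_cases hy : y ∈ (frobenius M p).fieldRange
    · obtain ⟨z, hz⟩ := hy
      exact ⟨z, fun _ => hz⟩
    · exact ⟨0, fun h => absurd h hy⟩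
  choose r hr using hroot
  refine ⟨t ∪ t.image r, Subfield.closure_mono ?_ hxt⟩
  intro y hy
  rcases ht hy with h1 | h1
  · exact Or.inl ⟨r y, by simp only [Finset.coe_union, Finset.coe_image]; exact Or.inr ⟨y, hy, rfl⟩,
      hr y h1⟩
  · exact Or.inr ⟨by simp only [Finset.coe_union]; exact Or.inl hy, h1⟩

/-- Closing off a set under the coefficients of expansions in a `p`-basis `Z`. -/
theorem exists_closed_pGen {Z : Set M}
    (hZ : (frobenius M p).fieldRange ⊔ Subfield.closure Z = ⊤) (S : Set M) :
    ∃ C : Set M, S ⊆ C ∧ #C ≤ max #S ℵ₀ ∧ ∀ (A₀ : Subfield M) (Z₀ : Set M),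
      A₀ ≤ pPowers p A₀ ⊔ Subfield.closure Z₀ →
      A₀ ⊔ Subfield.closure C ≤
        pPowers p (A₀ ⊔ Subfield.closure C) ⊔ Subfield.closure (Z₀ ∪ C ∩ Z) := by
  obtain ⟨h, hh⟩ := exists_finset_root hZ
  obtain ⟨C, hSC, hC, hcard⟩ := exists_closed_superset h S
  refine ⟨C, hSC, hcard, fun A₀ Z₀ hA => sup_le (hA.trans ?_) (Subfield.closure_le.2 fun x hx => ?_)⟩
  · exact sup_le_sup (pPowers_mono le_sup_left) (Subfield.closure_mono Set.subset_union_left)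
  · refine (Subfield.closure_le.2 ?_ : _ ≤ _) (hh x)
    rintro _ (⟨y, hy, rfl⟩ | hy)
    · refine (le_sup_left : pPowers p _ ≤ _) (mem_pPowers.2 ⟨y, ?_, rfl⟩)
      exact (le_sup_right : Subfield.closure C ≤ _) (Subfield.subset_closure (hC x hx hy))
    · exact (le_sup_right : Subfield.closure (Z₀ ∪ C ∩ Z) ≤ _)
        (Subfield.subset_closure (Or.inr ⟨hC x hx hy.1, hy.2⟩))

theorem gen_subtype {A : Subfield M} {ι : Type*} {X : ι → Set M}
    (hX : ∀ j, X j ⊆ A) (hA : A ≤ pPowers p A ⊔ Subfield.closure (⋃ j, X j)) :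
    (frobenius A p).fieldRange ⊔ Subfield.closure (⋃ j, (Subtype.val ⁻¹' X j : Set A)) = ⊤ := by
  rw [eq_top_iff]
  intro x _
  have h1 : (pPowers p A ⊔ Subfield.closure (⋃ j, X j)) ≤
      ((frobenius A p).fieldRange ⊔
        Subfield.closure (⋃ j, (Subtype.val ⁻¹' X j : Set A))).map A.subtype := by
    refine sup_le ?_ (Subfield.closure_le.2 ?_)
    · intro y hy
      obtain ⟨z, hz, rfl⟩ := mem_pPowers.1 hy
      refine ⟨(⟨z, hz⟩ : A) ^ p, ?_, rfl⟩
      exact (le_sup_left : (frobenius A p).fieldRange ≤ _) ⟨⟨z, hz⟩, rfl⟩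
    · intro y hy
      obtain ⟨j, hj⟩ := Set.mem_iUnion.1 hy
      refine ⟨(⟨y, hX j hj⟩ : A), ?_, rfl⟩
      exact (le_sup_right : Subfield.closure (⋃ j, (Subtype.val ⁻¹' X j : Set A)) ≤ _)
        (Subfield.subset_closure (Set.mem_iUnion.2 ⟨j, hj⟩))
  obtain ⟨y, hy, hyx⟩ := Subfield.mem_map.1 (h1 (hA x.2))
  have : y = x := Subtype.ext hyx
  exact this ▸ hy

variable {m : ℕ} {F : Fin (m + 2) → Subfield M}

/-- Independent sets at all levels extend to a divided `p`-basis of the whole field. -/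
theorem exists_isGood_id (hF : IsFrobeniusChain p F) {Z : Fin (m + 1) → Set M}
    (hZ : ∀ j, Z j ⊆ F j.succ) (hind : ∀ j, PIndSet p (F j.castSucc) (Z j)) :
    ∃ Y : Fin (m + 1) → Set M, (∀ j, Z j ⊆ Y j) ∧ IsGood p F (RingHom.id M) Y := by
  choose Y hZY hYF hY hgen using fun j =>
    (hind j).exists_maximal (hF.pow_mem _) (hZ j)
  refine ⟨Y, hZY, ⟨?_, fun j x hx => hYF j hx, fun j => by simpa using hY j⟩⟩
  have key : ∀ j, F j ≤ (frobenius M p).fieldRange ⊔ Subfield.closure (⋃ j, Y j) := by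
    intro j
    induction j using Fin.induction with
    | zero => rw [hF.zero]; exact le_sup_left
    | succ j ih =>
      refine (hgen j).trans (sup_le ih ?_)
      exact (Subfield.closure_mono (Set.subset_iUnion Y j)).trans le_sup_right
  rw [eq_top_iff, ← hF.last]
  exact key _

end Closing

/-- `Saturated` quantifies over index types in the lowest universe, so countable fields are moved
there. -/
theorem exists_ringEquiv_of_countable (A : Type u) [Field A] [Countable A] :
    ∃ (B : Type) (_ : Field B), Nonempty (B ≃+* A) := by
  obtain ⟨B, ⟨e⟩⟩ := (Countable.toSmall.{0} A).equiv_small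
  exact ⟨B, e.symm.field, ⟨e.symm.ringEquiv⟩⟩

/-! ### Enlarging and shrinking well embedded fields -/

section Extension

variable {M : Type u} [Field M] {p : ℕ} [Fact p.Prime] [CharP M p] {m : ℕ}
  {F : Fin (m + 2) → Subfield M}

theorem IsGood.fieldRange_le {E : Type*} [Field E] [CharP E p] {g : E →+* M}
    {X : Fin (m + 1) → Set E} (hg : IsGood p F g X) :
    g.fieldRange ≤ pPowers p g.fieldRange ⊔ Subfield.closure (⋃ j, g '' X j) := by
  have h : g.fieldRange = _ := g.fieldRange_eq_map
  rw [← hg.gen, Subfield.map_sup, RingHom.map_field_closure] at h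
  rw [← Set.image_iUnion]
  refine h.le.trans (sup_le_sup_right ?_ _)
  rintro _ ⟨_, ⟨x, rfl⟩, rfl⟩
  exact mem_pPowers.2 ⟨g x, ⟨x, rfl⟩, by simp [frobenius_def]⟩

/-- Enlarging a separably embedded field inside the ambient chain by countably many generators. -/
theorem IsGood.exists_closed (hF : IsFrobeniusChain p F) {E : Type*} [Field E] [CharP E p]
    {g : E →+* M} {X : Fin (m + 1) → Set E} (hg : IsGood p F g X) (S : Set M) :
    ∃ (C : Set M) (X' : Fin (m + 1) → Set M), S ⊆ C ∧ #C ≤ max #S ℵ₀ ∧ (∀ j, X' j ⊆ C) ∧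
      (∀ j, ∀ x ∈ X' j, x ∈ F j.succ) ∧ (∀ j, PIndSet p (F j.castSucc) (g '' X j ∪ X' j)) ∧
      g.fieldRange ⊔ Subfield.closure C ≤ pPowers p (g.fieldRange ⊔ Subfield.closure C) ⊔
        Subfield.closure (⋃ j, (g '' X j ∪ X' j)) := by
  obtain ⟨Y, hXY, hY⟩ := exists_isGood_id hF (Z := fun j => g '' X j)
    (fun j => by rintro _ ⟨x, hx, rfl⟩; exact hg.mem j x hx) hg.ind
  obtain ⟨C, hSC, hcard, hC⟩ := exists_closed_pGen hY.gen S
  refine ⟨C, fun j => C ∩ Y j, hSC, hcard, fun j => Set.inter_subset_left,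
    fun j x hx => hY.mem j x hx.2, fun j => ?_, ?_⟩
  · have := hY.ind j
    simp only [RingHom.coe_id, Set.image_id] at this
    exact this.mono (Set.union_subset (hXY j) Set.inter_subset_right)
  · have := hC _ _ hg.fieldRange_le
    rwa [Set.inter_iUnion, ← Set.iUnion_union_distrib] at this

theorem isGood_subtype {A : Subfield M} {X : Fin (m + 1) → Set M}
    (hXA : ∀ j, X j ⊆ A) (hA : A ≤ pPowers p A ⊔ Subfield.closure (⋃ j, X j))
    (hmem : ∀ j, ∀ x ∈ X j, x ∈ F j.succ) (hind : ∀ j, PIndSet p (F j.castSucc) (X j)) :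
    IsGood p F A.subtype (fun j => Subtype.val ⁻¹' X j) where
  gen := gen_subtype hXA hA
  mem := fun j x hx => hmem j _ hx
  ind := fun j => (hind j).mono (by rintro _ ⟨x, hx, rfl⟩; exact hx)

theorem IsGood.comp_ringEquiv {E E' : Type*} [Field E] [CharP E p] [Field E'] [CharP E' p]
    {g : E →+* M} {X : Fin (m + 1) → Set E} (hg : IsGood p F g X) (σ : E' ≃+* E) :
    IsGood p F (g.comp (σ : E' →+* E)) (fun j => σ ⁻¹' X j) where
  gen := by
    have h := congrArg (Subfield.map (σ.symm : E →+* E')) hg.gen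
    rw [Subfield.map_sup, RingHom.map_field_closure, ← RingHom.fieldRange_eq_map] at h
    have h1 : (σ.symm : E →+* E').fieldRange = ⊤ :=
      RingHom.fieldRange_eq_top_iff.2 σ.symm.surjective
    rw [h1] at h
    rw [← h]
    congr 1
    · ext x
      simp only [RingHom.mem_fieldRange, Subfield.mem_map, frobenius_def]
      constructor
      · rintro ⟨y, rfl⟩
        exact ⟨_, ⟨σ y, rfl⟩, by simp⟩
      · rintro ⟨_, ⟨y, rfl⟩, rfl⟩
        exact ⟨σ.symm y, by simp⟩
    · congr 1
      rw [Set.image_iUnion]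
      refine Set.iUnion_congr fun j => ?_
      ext x
      constructor
      · intro hx
        exact ⟨σ x, hx, by simp⟩
      · rintro ⟨y, hy, rfl⟩
        simpa using hy
  mem := fun j x hx => hg.mem j _ hx
  ind := fun j => (hg.ind j).mono (by
    rintro _ ⟨x, hx, rfl⟩
    exact ⟨σ x, hx, rfl⟩)

/-- A countable separably embedded field can be enlarged to contain a given element. -/
theorem IsGood.exists_extend (hF : IsFrobeniusChain p F) {E : Type} [Field E] [CharP E p]
    [Countable E] {g : E →+* M} {X : Fin (m + 1) → Set E} (hg : IsGood p F g X) (c : M) :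
    ∃ (E' : Type) (_ : Field E') (_ : CharP E' p) (_ : Countable E') (i : E →+* E')
      (g' : E' →+* M) (X' : Fin (m + 1) → Set E'), IsGood p F g' X' ∧ g'.comp i = g ∧
      (∀ j, i '' X j ⊆ X' j) ∧ ∃ c', g' c' = c := by
  obtain ⟨C, X', hSC, hcard, hX'C, hmem, hind, hA⟩ := hg.exists_closed hF {c}
  set A := g.fieldRange ⊔ Subfield.closure C with hAdef
  have hCc : C.Countable := by
    rw [← Cardinal.le_aleph0_iff_set_countable]
    simpa using hcard
  have hAc : Countable A := by
    have h1 : A = Subfield.closure (Set.range g ∪ C) := by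
      rw [Subfield.closure_union, hAdef, ← RingHom.coe_fieldRange, Subfield.closure_eq]
    rw [← Cardinal.mk_le_aleph0_iff, h1]
    refine (Subfield.cardinalMk_closure_le_max _).trans (max_le ?_ le_rfl)
    rw [Cardinal.le_aleph0_iff_set_countable]
    exact (Set.countable_range g).union hCc
  have hXA : ∀ j, g '' X j ∪ X' j ⊆ A := by
    intro j
    refine Set.union_subset ?_ ?_
    · rintro _ ⟨x, hx, rfl⟩
      exact (le_sup_left : g.fieldRange ≤ A) ⟨x, rfl⟩
    · intro x hx
      exact (le_sup_right : Subfield.closure C ≤ A) (Subfield.subset_closure (hX'C j hx))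
  have hgood := isGood_subtype (F := F) hXA hA (by
    rintro j x (⟨y, hy, rfl⟩ | hx)
    · exact hg.mem j y hy
    · exact hmem j x hx) hind
  obtain ⟨B, _, ⟨σ⟩⟩ := exists_ringEquiv_of_countable A
  have : CharP B p := (RingHom.charP_iff σ.toRingHom σ.injective p).2 inferInstance
  have hcount : Countable B := σ.injective.countable
  let i : E →+* A := g.codRestrict A fun x => (le_sup_left : g.fieldRange ≤ A) ⟨x, rfl⟩
  refine ⟨B, inferInstance, inferInstance, hcount, (σ.symm : A →+* _).comp i, _, _,
    hgood.comp_ringEquiv σ, ?_, ?_, ?_⟩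
  · ext x
    simp [i]
  · rintro j _ ⟨x, hx, rfl⟩
    simp only [RingHom.coe_comp, RingHom.coe_coe, Function.comp_apply, Set.mem_preimage,
      RingEquiv.apply_symm_apply]
    exact Or.inl ⟨x, hx, rfl⟩
  · refine ⟨σ.symm ⟨c, (le_sup_right : Subfield.closure C ≤ A)
      (Subfield.subset_closure (hSC rfl))⟩, by simp⟩

/-- A countable part of a field, separably embedded with it. -/
theorem exists_countable_isGood {N : Type w} [Field N] [CharP N p] {G : Fin (m + 2) → Subfield N}
    {E : Type*} [Field E] [CharP E p] {g : E →+* M} {f : E →+* N} {X : Fin (m + 1) → Set E}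
    (hg : IsGood p F g X) (hf : IsGood p G f X) {S : Set E} (hS : S.Countable) :
    ∃ (E' : Type) (_ : Field E') (_ : CharP E' p) (_ : Countable E') (i : E' →+* E)
      (X' : Fin (m + 1) → Set E'), IsGood p F (g.comp i) X' ∧ IsGood p G (f.comp i) X' ∧
      ∀ x ∈ S, ∃ y, i y = x := by
  obtain ⟨C, hSC, hcard, hC⟩ := exists_closed_pGen hg.gen S
  have hCc : C.Countable := by
    rw [← Cardinal.le_aleph0_iff_set_countable]
    exact hcard.trans (max_le (Cardinal.le_aleph0_iff_set_countable.2 hS) le_rfl)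
  have hA := hC ⊥ ∅ bot_le
  rw [bot_sup_eq, Set.empty_union, Set.inter_iUnion] at hA
  set A := Subfield.closure C with hAdef
  have hAc : Countable A := by
    rw [← Cardinal.mk_le_aleph0_iff]
    exact (Subfield.cardinalMk_closure_le_max _).trans
      (max_le (Cardinal.le_aleph0_iff_set_countable.2 hCc) le_rfl)
  have hXA : ∀ j, C ∩ X j ⊆ A := fun j x hx => Subfield.subset_closure hx.1
  have hgen := gen_subtype hXA hA
  have hgoodg : IsGood p F (g.comp A.subtype) (fun j => Subtype.val ⁻¹' (C ∩ X j)) :=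
    ⟨hgen, fun j x hx => hg.mem j _ hx.2, fun j => (hg.ind j).mono (by
      rintro _ ⟨x, hx, rfl⟩; exact ⟨_, hx.2, rfl⟩)⟩
  have hgoodf : IsGood p G (f.comp A.subtype) (fun j => Subtype.val ⁻¹' (C ∩ X j)) :=
    ⟨hgen, fun j x hx => hf.mem j _ hx.2, fun j => (hf.ind j).mono (by
      rintro _ ⟨x, hx, rfl⟩; exact ⟨_, hx.2, rfl⟩)⟩
  obtain ⟨B, _, ⟨σ⟩⟩ := exists_ringEquiv_of_countable A
  have : CharP B p := (RingHom.charP_iff σ.toRingHom σ.injective p).2 inferInstance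
  have hcount : Countable B := σ.injective.countable
  refine ⟨B, inferInstance, inferInstance, hcount, A.subtype.comp (σ : _ →+* A), _,
    hgoodg.comp_ringEquiv σ, hgoodf.comp_ringEquiv σ, fun x hx => ?_⟩
  exact ⟨σ.symm ⟨x, Subfield.subset_closure (hSC hx)⟩, by simp⟩

end Extension

/-! ### Formulas for chains of fields -/

section Terms

open FirstOrder.Language

variable {m : ℕ} {α : Type*}

/-- Terms of the language of fields with predicates. -/
abbrev FTerm (m : ℕ) (α : Type*) := (chainLang m).Term α

/-- Formulas of the language of fields with predicates. -/
abbrev FForm (m : ℕ) (α : Type*) := (chainLang m).Formula α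

namespace FTerm

/-- The sum of two terms. -/
def add (t s : FTerm m α) : FTerm m α := Term.func (L := chainLang m) FieldFunc.add ![t, s]

/-- The product of two terms. -/
def mul (t s : FTerm m α) : FTerm m α := Term.func (L := chainLang m) FieldFunc.mul ![t, s]

/-- The negative of a term. -/
def neg (t : FTerm m α) : FTerm m α := Term.func (L := chainLang m) FieldFunc.neg ![t]

/-- The inverse of a term. -/
def inv (t : FTerm m α) : FTerm m α := Term.func (L := chainLang m) FieldFunc.inv ![t]

/-- The term `0`. -/
def zero : FTerm m α := Term.func (L := chainLang m) FieldFunc.zero ![]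

/-- The term `1`. -/
def one : FTerm m α := Term.func (L := chainLang m) FieldFunc.one ![]

/-- Powers of a term. -/
def pow (t : FTerm m α) : ℕ → FTerm m α
  | 0 => one
  | n + 1 => mul (pow t n) t

/-- The sum of a finite family of terms. -/
noncomputable def sum {ι : Type*} [Fintype ι] (t : ι → FTerm m α) : FTerm m α :=
  ((Finset.univ : Finset ι).toList.map t).foldr add zero

/-- The product of a finite family of terms. -/
noncomputable def prod {ι : Type*} [Fintype ι] (t : ι → FTerm m α) : FTerm m α :=
  ((Finset.univ : Finset ι).toList.map t).foldr mul one

end FTerm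

variable {M : Type*} [Field M] (F : Fin (m + 2) → Subfield M)

/-- The value of a term in the chain `F`. -/
def tval (t : FTerm m α) (v : α → M) : M :=
  @Term.realize (chainLang m) M (chainStructure F) α v t

/-- Truth of a formula in the chain `F`. -/
def Holds (φ : FForm m α) (v : α → M) : Prop :=
  @Formula.Realize (chainLang m) M (chainStructure F) α φ v

@[simp] theorem tval_var (x : α) (v : α → M) : tval F (Term.var x) v = v x := rfl

@[simp] theorem tval_add (t s : FTerm m α) (v : α → M) :
    tval F (t.add s) v = tval F t v + tval F s v := rfl

@[simp] theorem tval_mul (t s : FTerm m α) (v : α → M) :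
    tval F (t.mul s) v = tval F t v * tval F s v := rfl

@[simp] theorem tval_neg (t : FTerm m α) (v : α → M) : tval F t.neg v = - tval F t v := rfl

@[simp] theorem tval_inv (t : FTerm m α) (v : α → M) : tval F t.inv v = (tval F t v)⁻¹ := rfl

@[simp] theorem tval_zero (v : α → M) : tval F FTerm.zero v = 0 := rfl

@[simp] theorem tval_one (v : α → M) : tval F FTerm.one v = 1 := rfl

@[simp] theorem tval_pow (t : FTerm m α) (n : ℕ) (v : α → M) :
    tval F (t.pow n) v = tval F t v ^ n := by
  induction n with
  | zero => simp [FTerm.pow]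
  | succ n ih => simp [FTerm.pow, ih, pow_succ]

@[simp] theorem tval_sum {ι : Type*} [Fintype ι] (t : ι → FTerm m α) (v : α → M) :
    tval F (FTerm.sum t) v = ∑ i, tval F (t i) v := by
  rw [FTerm.sum, ← Finset.sum_map_toList]
  induction (Finset.univ : Finset ι).toList with
  | nil => simp
  | cons a l ih => simp [ih]

@[simp] theorem tval_prod {ι : Type*} [Fintype ι] (t : ι → FTerm m α) (v : α → M) :
    tval F (FTerm.prod t) v = ∏ i, tval F (t i) v := by
  rw [FTerm.prod, ← Finset.prod_map_toList]
  induction (Finset.univ : Finset ι).toList with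
  | nil => simp
  | cons a l ih => simp [ih]

@[simp] theorem holds_equal (t s : FTerm m α) (v : α → M) :
    Holds F (Term.equal t s) v ↔ tval F t v = tval F s v :=
  @Formula.realize_equal _ _ (chainStructure F) _ _ _ _

@[simp] theorem holds_inf (φ ψ : FForm m α) (v : α → M) :
    Holds F (φ ⊓ ψ) v ↔ Holds F φ v ∧ Holds F ψ v :=
  @Formula.realize_inf _ _ (chainStructure F) _ _ _ _

@[simp] theorem holds_sup (φ ψ : FForm m α) (v : α → M) :
    Holds F (φ ⊔ ψ) v ↔ Holds F φ v ∨ Holds F ψ v :=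
  @Formula.realize_sup _ _ (chainStructure F) _ _ _ _

@[simp] theorem holds_imp (φ ψ : FForm m α) (v : α → M) :
    Holds F (Formula.imp φ ψ) v ↔ (Holds F φ v → Holds F ψ v) :=
  @Formula.realize_imp _ _ (chainStructure F) _ _ _ _

@[simp] theorem holds_not (φ : FForm m α) (v : α → M) :
    Holds F (Formula.not φ) v ↔ ¬ Holds F φ v := Iff.rfl

@[simp] theorem holds_top (v : α → M) : Holds F (⊤ : FForm m α) v :=
  (@Formula.realize_top _ _ (chainStructure F) _ _).2 trivial

@[simp] theorem holds_relabel {β : Type*} (φ : FForm m α) (g : α → β) (v : β → M) :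
    Holds F (φ.relabel g) v ↔ Holds F φ (v ∘ g) :=
  @Formula.realize_relabel _ _ (chainStructure F) _ _ _ _ _

@[simp] theorem holds_iInf {β : Type*} [Finite β] (φ : β → FForm m α) (v : α → M) :
    Holds F (Formula.iInf φ) v ↔ ∀ b, Holds F (φ b) v :=
  @Formula.realize_iInf _ _ (chainStructure F) _ _ _ _ _

@[simp] theorem holds_iAlls {β : Type*} [Finite β] (φ : FForm m (α ⊕ β)) (v : α → M) :
    Holds F (Formula.iAlls β φ) v ↔ ∀ i : β → M, Holds F φ (Sum.elim v i) := by
  rw [Holds, @Formula.realize_iAlls _ _ (chainStructure F) _ _ _ _ _]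
  refine forall_congr' fun i => ?_
  rw [Holds]

@[simp] theorem holds_iExs {β : Type*} [Finite β] (φ : FForm m (α ⊕ β)) (v : α → M) :
    Holds F (Formula.iExs β φ) v ↔ ∃ i : β → M, Holds F φ (Sum.elim v i) := by
  rw [Holds, @Formula.realize_iExs _ _ (chainStructure F) _ _ _ _ _]
  refine exists_congr fun i => ?_
  rw [Holds]

/-- The formula expressing membership in the `j`-th field of a chain. -/
noncomputable def memF (p : ℕ) (j : Fin (m + 2)) : FForm m Unit :=
  Fin.cases (Formula.iExs Unit (Term.equal (FTerm.pow (Term.var (Sum.inr ())) p)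
      (Term.var (Sum.inl ()))))
    (fun i => Fin.lastCases (motive := fun _ => FForm m Unit) ⊤
      (fun k => Relations.formula (L := chainLang m) (ChainRel.mem k) ![Term.var ()]) i) j

theorem holds_memF {p : ℕ} [Fact p.Prime] [CharP M p] {F : Fin (m + 2) → Subfield M}
    (hF : IsFrobeniusChain p F) (j : Fin (m + 2)) (v : Unit → M) :
    Holds F (memF p j) v ↔ v () ∈ F j := by
  induction j using Fin.cases with
  | zero =>
    rw [hF.zero]
    simp only [memF, Fin.cases_zero, holds_iExs, holds_equal, tval_pow, tval_var, Sum.elim_inr,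
      Sum.elim_inl, RingHom.mem_fieldRange, frobenius_def]
    exact ⟨fun ⟨i, hi⟩ => ⟨_, hi⟩, fun ⟨x, hx⟩ => ⟨fun _ => x, hx⟩⟩
  | succ i =>
    simp only [memF, Fin.cases_succ]
    induction i using Fin.lastCases with
    | last =>
      simp only [Fin.lastCases_last, holds_top, true_iff, Fin.succ_last, hF.last]
      trivial
    | cast k =>
      simp only [Fin.lastCases_castSucc]
      exact @Formula.realize_rel (chainLang m) M (chainStructure F) Unit v 1 (ChainRel.mem k) _

/-- Membership of a variable in the `j`-th field. -/
noncomputable def memVar (p : ℕ) (j : Fin (m + 2)) (x : α) : FForm m α :=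
  (memF p j).relabel fun _ => x

@[simp] theorem holds_memVar {p : ℕ} [Fact p.Prime] [CharP M p] {F : Fin (m + 2) → Subfield M}
    (hF : IsFrobeniusChain p F) (j : Fin (m + 2)) (x : α) (v : α → M) :
    Holds F (memVar p j x) v ↔ v x ∈ F j := by
  rw [memVar, holds_relabel, holds_memF hF]
  rfl

/-- Linear independence of a tuple of terms over the `j`-th field. -/
noncomputable def linIndF (p : ℕ) (j : Fin (m + 2)) {ι κ : Type*} [Fintype ι]
    (t : ι → FTerm m κ) : FForm m κ :=
  Formula.iAlls ι <| Formula.imp (Formula.iInf fun i : ι => memVar p j (Sum.inr i)) <|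
    Formula.imp (Term.equal (FTerm.sum fun i : ι =>
      FTerm.mul (Term.var (Sum.inr i)) ((t i).relabel Sum.inl)) FTerm.zero)
      (Formula.iInf fun i : ι => Term.equal (Term.var (Sum.inr i)) FTerm.zero)

@[simp] theorem tval_relabel {β : Type*} (t : FTerm m α) (g : α → β) (v : β → M) :
    tval F (t.relabel g) v = tval F t (v ∘ g) :=
  @Term.realize_relabel _ _ (chainStructure F) _ _ _ _ _

theorem holds_linIndF {p : ℕ} [Fact p.Prime] [CharP M p] {F : Fin (m + 2) → Subfield M}
    (hF : IsFrobeniusChain p F) (j : Fin (m + 2)) {ι κ : Type*} [Fintype ι]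
    (t : ι → FTerm m κ) (v : κ → M) :
    Holds F (linIndF p j t) v ↔ LinearIndependent (F j) (fun i => tval F (t i) v) := by
  rw [linearIndependent_subfield_iff]
  simp [linIndF, hF]

/-- Monomial independence over the `j`-th field. -/
noncomputable def monIndF (p : ℕ) (j : Fin (m + 2)) (ι : Type*) [Fintype ι] [DecidableEq ι] :
    FForm m ι :=
  linIndF p j fun e : ι → Fin p => FTerm.prod fun i => FTerm.pow (Term.var i) (e i : ℕ)

theorem holds_monIndF {p : ℕ} [Fact p.Prime] [CharP M p] {F : Fin (m + 2) → Subfield M}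
    (hF : IsFrobeniusChain p F) (j : Fin (m + 2)) {ι : Type*} [Fintype ι] [DecidableEq ι]
    (v : ι → M) : Holds F (monIndF p j ι) v ↔ MonIndep p (F j) v := by
  rw [monIndF, holds_linIndF hF, MonIndep]
  simp only [tval_prod, tval_pow, tval_var]
  rfl

theorem pIndependent_iff_forall {p : ℕ} [Fact p.Prime] [CharP M p] {k : Subfield M} {n : ℕ}
    {a : Fin n → M} : PIndependent p k a ↔ (∀ i, a i ∈ k) ∧
      ∀ c : (Fin n → Fin p) → M, (∀ e, c e ∈ k) → ∑ e, c e ^ p * ∏ i, a i ^ (e i : ℕ) = 0 →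
        ∀ e, c e = 0 := by
  rw [pIndependent_iff, monIndep_iff]
  refine and_congr_right fun _ => ⟨fun h c hc hs e => ?_, fun h c hc hs e => ?_⟩
  · have := h (fun e => c e ^ p) (fun e => mem_pPowers.2 ⟨_, hc e, rfl⟩) hs e
    exact pow_eq_zero_iff (Fact.out : p.Prime).ne_zero |>.1 this
  · choose d hd hdc using fun e => mem_pPowers.1 (hc e)
    rw [← hdc e, h d hd, zero_pow (Fact.out : p.Prime).ne_zero]
    simp only [hdc]
    exact hs

/-- The expansion `∑ c_e ^ p ∏ a_i ^ e_i` as a term; `a` are the first `n` variables of the left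
summand and the `c` are those on the right. -/
noncomputable def expTerm (p : ℕ) (n : ℕ) :
    FTerm m ((Fin (n + 1) ⊕ Unit) ⊕ (Fin n → Fin p)) :=
  FTerm.sum fun e : Fin n → Fin p => FTerm.mul (FTerm.pow (Term.var (Sum.inr e)) p)
    (FTerm.prod fun i : Fin n => FTerm.pow (Term.var (Sum.inl (Sum.inl i.castSucc))) (e i : ℕ))

/-- `p`-independence of the first `n` variables in the `j`-th field. -/
noncomputable def pIndF (p : ℕ) (j : Fin (m + 2)) (n : ℕ) : FForm m (Fin (n + 1) ⊕ Unit) :=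
  (Formula.iInf fun i : Fin n => memVar p j (Sum.inl i.castSucc)) ⊓
    Formula.iAlls (Fin n → Fin p) (Formula.imp
      (Formula.iInf fun e : Fin n → Fin p => memVar p j (Sum.inr e))
      (Formula.imp (Term.equal (expTerm p n) FTerm.zero)
        (Formula.iInf fun e : Fin n → Fin p => Term.equal (Term.var (Sum.inr e)) FTerm.zero)))

/-- The variables on the right form an expansion of the last variable. -/
noncomputable def expF (p : ℕ) (j : Fin (m + 2)) (n : ℕ) :
    FForm m ((Fin (n + 1) ⊕ Unit) ⊕ (Fin n → Fin p)) :=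
  (Formula.iInf fun e : Fin n → Fin p => memVar p j (Sum.inr e)) ⊓
    Term.equal (Term.var (Sum.inl (Sum.inl (Fin.last n)))) (expTerm p n)

/-- The graph of a `λ`-function of the `j`-th field. -/
noncomputable def lamF (p : ℕ) (j : Fin (m + 2)) {n : ℕ} (e : Fin n → Fin p) :
    FForm m (Fin (n + 1) ⊕ Unit) :=
  (pIndF p j n ⊓ Formula.iExs (Fin n → Fin p) (expF p j n ⊓
      Term.equal (Term.var (Sum.inl (Sum.inr ()))) (Term.var (Sum.inr e)))) ⊔
    (Formula.not (pIndF p j n ⊓ Formula.iExs (Fin n → Fin p) (expF p j n)) ⊓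
      Term.equal (Term.var (Sum.inr ())) FTerm.zero)

/-- The graph of a `λ`-function is definable without `λ`-functions. This is how their natural
interpretation is recovered in an arbitrary model of the theory in the larger language. -/
theorem holds_lamF {p : ℕ} [Fact p.Prime] [CharP M p] {F : Fin (m + 2) → Subfield M}
    (hF : IsFrobeniusChain p F) (j : Fin (m + 2)) {n : ℕ} (e : Fin n → Fin p)
    (x : Fin (n + 1) → M) (y : M) :
    Holds F (lamF p j e) (Sum.elim x fun _ => y) ↔
      y = lambdaFun p (F j) e (Fin.init x) (x (Fin.last n)) := by
  have h1 : Holds F (pIndF p j n) (Sum.elim x fun _ => y) ↔ PIndependent p (F j) (Fin.init x) := by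
    rw [pIndependent_iff_forall]
    simp [pIndF, expTerm, hF, Fin.init]
  have h2 : ∀ c, Holds F (expF p j n) (Sum.elim (Sum.elim x fun _ => y) c) ↔
      IsExpansion p (F j) (Fin.init x) (x (Fin.last n)) c := by
    intro c
    simp [expF, expTerm, hF, Fin.init, IsExpansion]
  simp only [lamF, holds_sup, holds_inf, holds_not, h1, holds_iExs, h2, holds_equal, tval_var,
    Sum.elim_inl, Sum.elim_inr, tval_zero]
  by_cases h : PIndependent p (F j) (Fin.init x) ∧
      ∃ c, IsExpansion p (F j) (Fin.init x) (x (Fin.last n)) c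
  · obtain ⟨ha, c, hc⟩ := h
    rw [lambdaFun_eq ha hc]
    constructor
    · rintro (⟨-, c', hc', rfl⟩ | ⟨hn, -⟩)
      · rw [hc'.unique ha hc]
      · exact absurd ⟨ha, c, hc⟩ hn
    · intro hy
      exact Or.inl ⟨ha, c, hc, hy⟩
  · rw [lambdaFun_eq_zero h]
    constructor
    · rintro (⟨ha, c', hc', -⟩ | ⟨-, hy⟩)
      · exact absurd ⟨ha, c', hc'⟩ h
      · exact hy
    · exact fun hy => Or.inr ⟨h, hy⟩

end Terms

/-! ### Separable embeddings and algebraic independence -/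

section Separable

variable {M : Type*} [Field M] {p : ℕ} [Fact p.Prime] [CharP M p] {m : ℕ}
  {F : Fin (m + 2) → Subfield M} {E : Type*} [Field E] [CharP E p] {g : E →+* M}
  {X : Fin (m + 1) → Set E}

theorem linearIndependent_iff_fieldRange {K : Type*} [Field K] [Algebra E K] (k : K →+* M)
    (hk : k.comp (algebraMap E K) = g) {κ : Type*} [Fintype κ] {t : κ → K} :
    LinearIndependent E t ↔ LinearIndependent g.fieldRange (fun i => k (t i)) := by
  rw [linearIndependent_subfield_iff, Fintype.linearIndependent_iff]
  have hk' : ∀ x, k (algebraMap E K x) = g x := fun x => RingHom.congr_fun hk x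
  constructor
  · intro h c hc hs i
    choose d hd using hc
    have := h d (by
      apply k.injective
      rw [map_zero, ← hs, map_sum]
      simp [Algebra.smul_def, hk', hd]) i
    rw [← hd i, this, map_zero]
  · intro h c hs i
    have := h (fun i => g (c i)) (fun i => ⟨_, rfl⟩) (by
      rw [← map_zero k, ← hs, map_sum]
      simp [Algebra.smul_def, hk']) i
    simpa using this

/-- Mac Lane's criterion for intermediate fields, in the form required for separating transcendence
bases. -/
theorem IsGood.linearIndepOn_pow (hF : IsFrobeniusChain p F) (hg : IsGood p F g X) {K : Type*}
    [Field K] [Algebra E K] (k : K →+* M) (hk : k.comp (algebraMap E K) = g) (s : Finset K)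
    (hs : LinearIndepOn E id (s : Set K)) : LinearIndepOn E (· ^ p) (s : Set K) := by
  have h1 : LinearIndependent E (fun x : (s : Set K) => (x : K)) := hs
  have h2 := hg.pow_linearIndependent hF ((linearIndependent_iff_fieldRange k hk).1 h1)
  have h3 : LinearIndependent E (fun x : (s : Set K) => (x : K) ^ p) := by
    rw [linearIndependent_iff_fieldRange k hk]
    simpa using h2
  exact h3

/-- The part of a divided `p`-basis outside a separably embedded field is algebraically
independent over it. -/
theorem IsGood.algebraicIndependent [Algebra E M] (hF : IsFrobeniusChain p F)
    (hg : IsGood p F (algebraMap E M) X) {T : Set M} (hT : PIndSet p (F 0) T)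
    (hXT : ∀ j, algebraMap E M '' X j ⊆ T) {W : Set M} (hWT : W ⊆ T)
    (hW : ∀ j, ∀ x ∈ X j, algebraMap E M x ∉ W) :
    AlgebraicIndependent E (Subtype.val : W → M) := by
  have hp := (Fact.out : p.Prime)
  set K := IntermediateField.adjoin E W with hK
  have hWK : W ⊆ K := IntermediateField.subset_adjoin E W
  let a : W → K := fun w => ⟨w, hWK w.2⟩
  have hainj : Function.Injective a := fun x y h => Subtype.ext (congrArg (fun z : K => (z : M)) h)
  suffices h : AlgebraicIndependent E a by
    have := h.map' (f := K.val) Subtype.val_injective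
    exact this
  have htop : IntermediateField.adjoin E (Set.range a) = ⊤ := by
    have h1 : Set.range a = (Subtype.val ⁻¹' W : Set K) := by
      ext x
      constructor
      · rintro ⟨w, rfl⟩; exact w.2
      · intro hx; exact ⟨⟨x, hx⟩, rfl⟩
    rw [h1]
    apply IntermediateField.map_injective K.val
    rw [IntermediateField.adjoin_map, ← AlgHom.fieldRange_eq_map, IntermediateField.fieldRange_val]
    rw [hK]
    congr 1
    ext x
    constructor
    · rintro ⟨y, hy, rfl⟩; exact hy
    · intro hx; exact ⟨⟨x, hWK hx⟩, hx, rfl⟩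
  have halg : Algebra.IsAlgebraic (Algebra.adjoin E (Set.range a)) K := by
    rw [← IntermediateField.isAlgebraic_adjoin_iff_top, htop, Algebra.isAlgebraic_iff_isIntegral]
    exact Algebra.isIntegral_of_surjective IntermediateField.topEquiv.surjective
  -- `W` generates `K`, so it contains a transcendence basis `s`. If some `n` were left over, Mac
  -- Lane's criterion would give an `i` for which `a i` is separable over the field generated by
  -- `insert n s` without `i`.
  obtain ⟨t, hta, ht⟩ := exists_isTranscendenceBasis_subset (R := E) (Set.range a)
  set s : Set W := a ⁻¹' t with hs
  have hts : IsTranscendenceBasis E (fun i : s => a i) := by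
    let σ : s ≃ t := Equiv.ofBijective (fun i => ⟨a i, i.2⟩)
      ⟨fun x y h => Subtype.ext (hainj (congrArg Subtype.val h)), fun ⟨y, hy⟩ => by
        obtain ⟨w, rfl⟩ := hta hy
        exact ⟨⟨w, hy⟩, rfl⟩⟩
    exact ht.comp_equiv σ
  by_cases hsu : ∃ n, n ∉ s
  · exfalso
    obtain ⟨n, hn⟩ := hsu
    have hexp : ExpChar E p := inferInstance
    obtain ⟨i, -, hi⟩ := exists_isTranscendenceBasis_and_isSeparable_of_linearIndepOn_pow' p hp
      (fun s hs => hg.linearIndepOn_pow hF (algebraMap K M) (IsScalarTower.algebraMap_eq E K M).symm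
        s hs) s n hts hn
    set k' := IntermediateField.adjoin E (a '' (insert n s \ {i})) with hk'
    have hexp' : ExpChar k' p := expChar_of_injective_algebraMap (algebraMap E k').injective p
    -- A separable element is rational in its `p`-th power.
    have hmem : a i ∈ IntermediateField.adjoin k' {a i ^ p} := by
      rw [← IntermediateField.adjoin_simple_eq_adjoin_pow_expChar_of_isSeparable k' K hi p]
      exact IntermediateField.mem_adjoin_simple_self k' (a i)
    -- `B = M ^ p(T \ {i})` contains `E = E ^ p(X)`, the members of `W` other than `i`, and the
    -- `p`-th power of `i`. So `i` itself would be in `B`, against independence of `T`.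
    let B : Subfield M := F 0 ⊔ Subfield.closure (T \ {(i : M)})
    have hBT : ∀ x ∈ T, x ≠ i → x ∈ B := fun x hx hxi =>
      (le_sup_right : Subfield.closure (T \ {(i : M)}) ≤ B) (Subfield.subset_closure ⟨hx, hxi⟩)
    have hE : ∀ x : E, algebraMap E M x ∈ B := by
      intro x
      have h1 : (⊤ : Subfield E) ≤ B.comap (algebraMap E M) := by
        rw [← hg.gen]
        refine sup_le ?_ (Subfield.closure_le.2 ?_)
        · rintro _ ⟨y, rfl⟩
          refine (le_sup_left : F 0 ≤ B) ?_
          rw [frobenius_def, map_pow]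
          exact hF.pow_mem 0 _
        · intro y hy
          obtain ⟨j, hj⟩ := Set.mem_iUnion.1 hy
          exact hBT _ (hXT j ⟨y, hj, rfl⟩) fun e => hW j y hj (e ▸ i.2)
      exact h1 (Subfield.mem_top x)
    have hk'B : ∀ x ∈ k', (x : M) ∈ B := by
      intro x hx
      have : k'.toSubfield ≤ B.comap (algebraMap K M) := by
        rw [hk', IntermediateField.adjoin_toSubfield]
        refine Subfield.closure_le.2 ?_
        rintro _ (⟨y, rfl⟩ | ⟨y, hy, rfl⟩)
        · exact hE y
        · exact hBT _ (hWT y.2) fun e => hy.2 (Subtype.ext e)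
      exact this hx
    have hfin : (IntermediateField.adjoin k' {a i ^ p}).toSubfield ≤ B.comap (algebraMap K M) := by
      rw [IntermediateField.adjoin_toSubfield]
      refine Subfield.closure_le.2 ?_
      rintro _ (⟨y, rfl⟩ | rfl)
      · exact hk'B y y.2
      · exact (le_sup_left : F 0 ≤ B) (hF.pow_mem 0 (i : M))
    exact hT.notMem (hF.pow_mem 0) (hWT i.2) le_rfl (hfin hmem)
  · push Not at hsu
    have : AlgebraicIndependent E (fun i : s => a i) := hts.1
    exact this.comp (fun i => ⟨i, hsu i⟩) fun x y h => congrArg (fun z : s => (z : W)) h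

theorem exists_algHom_of_algebraicIndependent {ι K N : Type*} [Field K] [Field N] [Algebra E K]
    [Algebra E N] {x : ι → K} {y : ι → N} (hx : AlgebraicIndependent E x)
    (hy : AlgebraicIndependent E y) :
    ∃ θ : IntermediateField.adjoin E (Set.range x) →ₐ[E] N,
      ∀ i, θ ⟨x i, IntermediateField.subset_adjoin E _ ⟨i, rfl⟩⟩ = y i := by
  refine ⟨(IntermediateField.val _).comp
    (hy.aevalEquivField.toAlgHom.comp hx.aevalEquivField.symm.toAlgHom), fun i => ?_⟩
  have h1 : (⟨x i, IntermediateField.subset_adjoin E _ ⟨i, rfl⟩⟩ :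
      IntermediateField.adjoin E (Set.range x)) =
      hx.aevalEquivField (algebraMap (MvPolynomial ι E) _ (MvPolynomial.X i)) := by
    apply Subtype.ext
    rw [hx.aevalEquivField_algebraMap_apply_coe]
    simp
  rw [h1]
  simp only [AlgHom.comp_apply, AlgEquiv.coe_toAlgHom, AlgEquiv.symm_apply_apply,
    IntermediateField.coe_val]
  rw [hy.aevalEquivField_algebraMap_apply_coe]
  simp

/-- With a finite transcendence basis, `N` would be algebraic over a countable ring and therefore
countable. -/
theorem exists_algebraicIndependent_of_uncountable {N : Type*} [Field N] [Algebra E N] [Countable E]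
    [Uncountable N] (s : Type*) [Finite s] : ∃ τ : s → N, AlgebraicIndependent E τ := by
  obtain ⟨B, hB⟩ := exists_isTranscendenceBasis E N
  have hinf : Infinite B := by
    by_contra hfin
    rw [not_infinite_iff_finite] at hfin
    have h1 := hB.isAlgebraic
    have hc : Countable (Algebra.adjoin E (Set.range (Subtype.val : B → N))) := by
      rw [Algebra.adjoin_range_eq_range_aeval]
      have : Countable (MvPolynomial B E) := by
        rw [← Cardinal.mk_le_aleph0_iff]
        refine (MvPolynomial.cardinalMk_le_max_lift (σ := B) (R := E)).trans ?_
        simp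
      exact Set.countable_range (MvPolynomial.aeval (R := E) (Subtype.val : B → N))
    have h2 : Countable N := by
      have := Algebra.IsAlgebraic.lift_cardinalMk_le_max
        (Algebra.adjoin E (Set.range (Subtype.val : B → N))) N
      rw [← Cardinal.mk_le_aleph0_iff]
      rw [← Cardinal.mk_le_aleph0_iff] at hc
      have h3 := this.trans (max_le (Cardinal.lift_le_aleph0.2 hc) le_rfl)
      exact Cardinal.lift_le_aleph0.1 h3
    exact not_countable h2
  obtain ⟨n, ⟨e⟩⟩ := Finite.exists_equiv_fin s
  exact ⟨fun i => (Infinite.natEmbedding B (e i : ℕ) : N), hB.1.comp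
    (fun i => Infinite.natEmbedding B (e i : ℕ))
    fun x y h => e.injective (Fin.ext ((Infinite.natEmbedding B).injective h))⟩

/-- A finitely generated separable extension of a countable field embeds into every uncountable
separably closed extension. -/
theorem IsGood.exists_algHom (hF : IsFrobeniusChain p F) (hg : IsGood p F g X) {K N : Type*}
    [Field K] [Algebra E K] [Algebra.EssFiniteType E K] (k : K →+* M)
    (hk : k.comp (algebraMap E K) = g) [Field N] [Algebra E N] [Countable E] [Uncountable N]
    [IsSepClosed N] : Nonempty (K →ₐ[E] N) := by
  -- `s` is a separating transcendence basis. Its members go to algebraically independent elements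
  -- of `N`, and the separable algebraic extension above it embeds because `N` is separably closed.
  obtain ⟨s, hs, hsep⟩ :=
    exists_isTranscendenceBasis_and_isSeparable_of_linearIndepOn_pow_of_essFiniteType p
      (Fact.out : p.Prime) (hg.linearIndepOn_pow hF k hk)
  obtain ⟨τ, hτ⟩ := exists_algebraicIndependent_of_uncountable (E := E) (N := N) s
  obtain ⟨θ, -⟩ := exists_algHom_of_algebraicIndependent hs.1 hτ
  have hr : Set.range (Subtype.val : s → K) = ↑s := by ext; simp
  rw [hr] at θ
  let _ := θ.toRingHom.toAlgebra
  have : IsScalarTower E (IntermediateField.adjoin E (s : Set K)) N :=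
    IsScalarTower.of_algebraMap_eq fun x => (θ.commutes x).symm
  exact ⟨(IsSepClosed.lift : K →ₐ[IntermediateField.adjoin E (s : Set K)] N).restrictScalars E⟩

end Separable

/-! ### Extending embeddings into saturated chains -/

section Saturated

open FirstOrder.Language

variable {N : Type w} [Field N] {m : ℕ}

/-- Countable sets of formulas in countably many variables with parameters are realized as soon as
they are finitely satisfiable. -/
def Saturated (G : Fin (m + 2) → Subfield N) : Prop :=
  ∀ (ι J : Type) [Countable ι] [Countable J] (φ : J → FForm m (N ⊕ ι)),
    (∀ s : Finset J, ∃ v : ι → N, ∀ j ∈ s, Holds G (φ j) (Sum.elim id v)) →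
      ∃ v : ι → N, ∀ j, Holds G (φ j) (Sum.elim id v)

variable {G : Fin (m + 2) → Subfield N}

theorem infinite_of_isSepClosed (N : Type*) [Field N] [IsSepClosed N] : Infinite N := by
  by_contra h
  rw [not_infinite_iff_finite] at h
  have : IsAlgClosed N := inferInstance
  exact not_finite N

/-- If `N` were countable, the conditions that `x` differs from each element of `N` would form a
countable, finitely satisfiable set without realization. -/
theorem Saturated.uncountable [Infinite N] (hG : Saturated G) : Uncountable N := by
  classical
  rw [← not_countable_iff]
  intro hc
  obtain ⟨e, he⟩ := exists_surjective_nat N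
  obtain ⟨v, hv⟩ := hG Unit ℕ (fun n => Formula.not
    (Term.equal (Term.var (Sum.inr ())) (Term.var (Sum.inl (e n))))) (by
      intro s
      obtain ⟨x, hx⟩ := Infinite.exists_notMem_finset (s.image e)
      refine ⟨fun _ => x, fun j hj => ?_⟩
      simp only [holds_not, holds_equal, tval_var, Sum.elim_inr, Sum.elim_inl, id]
      exact fun h => hx (Finset.mem_image.2 ⟨j, hj, h.symm⟩))
  obtain ⟨n, hn⟩ := he (v ())
  have := hv n
  simp [hn] at this

variable {p : ℕ} [Fact p.Prime] [CharP N p]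

theorem pow_card_le_degrees {M : Type*} [Field M] {F : Fin (m + 2) → Subfield M} (hF : Monotone F)
    {j : Fin (m + 1)} {ι : Type*} [Fintype ι] {a : ι → M} (ha : ∀ i, a i ∈ F j.succ)
    (h : MonIndep p (F j.castSucc) a) :
    ((p ^ Fintype.card ι : ℕ) : ℕ∞) ≤ degrees F j := by
  classical
  have hcard : Fintype.card (ι → Fin p) = p ^ Fintype.card ι := by simp
  rw [natCast_le_degrees hF, ← hcard]
  let σ := (Fintype.equivFin (ι → Fin p)).symm
  exact ⟨pMon p a ∘ σ, fun i => prod_mem fun k _ => pow_mem (ha k) _, LinearIndependent.comp h σ σ.injective⟩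

variable {M : Type u} [Field M] [CharP M p] {F : Fin (m + 2) → Subfield M}

/-- Images of new elements are found one at a time. The tuple in `M` with one more element shows
that the degree of `F` at `j` admits a longer independent tuple; the degrees agree, so the tuple
already found in `N` is not maximal. -/
theorem exists_monIndep_finset (hF : IsFrobeniusChain p F) (hG : IsFrobeniusChain p G)
    (hd : degrees F = degrees G) {B : Type*} (j : Fin (m + 1)) {g : B → M} {X Y : Set B}
    (hXY : X ⊆ Y) (hgY : ∀ y ∈ Y, g y ∈ F j.succ)
    (hg : ∀ s : Finset B, ↑s ⊆ Y → MonIndep p (F j.castSucc) fun x : s => g x)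
    {f : B → N} (hfX : ∀ x ∈ X, f x ∈ G j.succ)
    (hf : ∀ s : Finset B, ↑s ⊆ X → MonIndep p (G j.castSucc) fun x : s => f x)
    (t : Finset B) (ht : ↑t ⊆ Y) :
    ∃ v : B → N, (∀ x ∈ X, v x = f x) ∧ (∀ x ∈ t, v x ∈ G j.succ) ∧
      MonIndep p (G j.castSucc) fun x : t => v x := by
  classical
  have key : ∀ a b : Finset B, ↑a ⊆ X → ↑b ⊆ Y → (∀ x ∈ b, x ∉ X) →
      ∃ v : B → N, (∀ x ∈ X, v x = f x) ∧ (∀ x ∈ b ∪ a, v x ∈ G j.succ) ∧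
      MonIndep p (G j.castSucc) fun x : (b ∪ a : Finset B) => v x := by
    intro a b ha
    induction b using Finset.induction_on with
    | empty =>
      intro _ _
      rw [Finset.empty_union]
      exact ⟨f, fun _ _ => rfl, fun x hx => hfX x (ha hx), hf _ ha⟩
    | insert x b hxb ih =>
      intro hb hbX
      rw [Finset.coe_insert, Set.insert_subset_iff] at hb
      obtain ⟨v, hv, hvm, hvi⟩ := ih hb.2 fun y hy => hbX y (Finset.mem_insert_of_mem hy)
      have hxX := hbX x (Finset.mem_insert_self x b)
      have hxba : x ∉ b ∪ a := by
        rw [Finset.mem_union]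
        rintro (h | h)
        · exact hxb h
        · exact hxX (ha h)
      have hsub : ((insert x (b ∪ a) : Finset B) : Set B) ⊆ Y := by
        intro y hy
        simp only [Finset.coe_insert, Finset.coe_union, Set.mem_insert_iff, Set.mem_union] at hy
        rcases hy with rfl | hy | hy
        · exact hb.1
        · exact hb.2 hy
        · exact hXY (ha hy)
      have hdeg := pow_card_le_degrees (p := p) hF.mono
        (a := fun y : (insert x (b ∪ a) : Finset B) => g y) (fun i => hgY _ (hsub i.2)) (hg _ hsub)
      rw [Fintype.card_coe, Finset.card_insert_of_notMem hxba, hd] at hdeg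
      obtain ⟨y, hyG, hy⟩ := exists_notMem_of_le_degrees (p := p) hG.mono
        (a := fun y : (b ∪ a : Finset B) => v y) (fun i => hG.pow_mem _ _)
        (by rwa [Fintype.card_coe])
      have hne : ∀ z ∈ b ∪ a, z ≠ x := fun z hz e => hxba (e ▸ hz)
      rw [Finset.insert_union]
      refine ⟨Function.update v x y, fun z hz => ?_, fun z hz => ?_, ?_⟩
      · have hzx : z ≠ x := fun e => hxX (e ▸ hz)
        rw [Function.update_of_ne hzx, hv z hz]
      · rcases Finset.mem_insert.1 hz with rfl | hz
        · simpa using hyG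
        · rw [Function.update_of_ne (hne z hz)]
          exact hvm z hz
      · rw [← monIndep_comp_equiv (Finset.subtypeInsertEquivOption hxba).symm,
          monIndep_option fun i => hG.pow_mem _ _]
        have e1 : ((fun z : (insert x (b ∪ a) : Finset B) => Function.update v x y z) ∘
            (Finset.subtypeInsertEquivOption hxba).symm) ∘ some =
            fun z : (b ∪ a : Finset B) => v z := by
          funext z
          exact Function.update_of_ne (hne z z.2) _ _
        have e2 : ((fun z : (insert x (b ∪ a) : Finset B) => Function.update v x y z) ∘
            (Finset.subtypeInsertEquivOption hxba).symm) none = y := by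
          simp [Finset.subtypeInsertEquivOption]
        rw [e1, e2]
        exact ⟨hvi, hy⟩
  have ht' : t.filter (· ∉ X) ∪ t.filter (· ∈ X) = t := by
    rw [Finset.union_comm, Finset.filter_union_filter_not_eq]
  obtain ⟨v, h1, h2, h3⟩ := key (t.filter (· ∈ X)) (t.filter (· ∉ X)) (by intro x; simp)
    (fun x hx => ht (by simp at hx; exact hx.1)) (by simp)
  rw [ht'] at h2 h3
  exact ⟨v, h1, h2, h3⟩

/-- Images of independent elements in a saturated chain. -/
theorem Saturated.exists_monIndep (hsat : Saturated G) (hF : IsFrobeniusChain p F)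
    (hG : IsFrobeniusChain p G)
    (hd : degrees F = degrees G) {B : Type} [Countable B] (j : Fin (m + 1)) {g : B → M}
    {X Y : Set B} (hXY : X ⊆ Y) (hgY : ∀ y ∈ Y, g y ∈ F j.succ)
    (hg : ∀ s : Finset B, ↑s ⊆ Y → MonIndep p (F j.castSucc) fun x : s => g x)
    {f : B → N} (hfX : ∀ x ∈ X, f x ∈ G j.succ)
    (hf : ∀ s : Finset B, ↑s ⊆ X → MonIndep p (G j.castSucc) fun x : s => f x) :
    ∃ v : B → N, (∀ x ∈ X, v x = f x) ∧ (∀ x ∈ Y, v x ∈ G j.succ) ∧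
      ∀ t : Finset B, ↑t ⊆ Y → MonIndep p (G j.castSucc) fun x : t => v x := by
  classical
  let φ : X ⊕ (Y ⊕ {t : Finset B // ↑t ⊆ Y}) → FForm m (N ⊕ B) := fun o =>
    Sum.elim (fun x : X => Term.equal (Term.var (Sum.inr (x : B))) (Term.var (Sum.inl (f x))))
      (Sum.elim (fun y : Y => memVar p j.succ (Sum.inr (y : B)))
        (fun t : {t : Finset B // ↑t ⊆ Y} =>
          (monIndF p j.castSucc (t.1 : Finset B)).relabel
            fun x : (t.1 : Finset B) => Sum.inr (x : B))) o
  have hφ1 : ∀ v x, Holds G (φ (Sum.inl x)) (Sum.elim id v) ↔ v x = f x := by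
    intro v x; simp [φ]
  have hφ2 : ∀ v y, Holds G (φ (Sum.inr (Sum.inl y))) (Sum.elim id v) ↔ v y ∈ G j.succ := by
    intro v y; simp [φ, hG]
  have hφ3 : ∀ v t, Holds G (φ (Sum.inr (Sum.inr t))) (Sum.elim id v) ↔
      MonIndep p (G j.castSucc) (fun x : (t : Finset B) => v x) := by
    intro v t
    simp only [φ, Sum.elim_inr, holds_relabel]
    rw [holds_monIndF hG]
    rfl
  obtain ⟨v, hv⟩ := hsat B _ φ (by
    intro s
    let t : Finset B := s.biUnion fun o => Sum.elim (fun _ : X => (∅ : Finset B))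
      (Sum.elim (fun y : Y => {(y : B)}) fun t : {t : Finset B // ↑t ⊆ Y} => t.1) o
    have ht : ↑t ⊆ Y := by
      intro x hx
      simp only [t, Finset.coe_biUnion, Set.mem_iUnion] at hx
      obtain ⟨o, -, hx⟩ := hx
      rcases o with o | y | t
      · simp at hx
      · simp at hx; exact hx ▸ y.2
      · exact t.2 hx
    obtain ⟨v, h1, h2, h3⟩ := exists_monIndep_finset hF hG hd j hXY hgY hg hfX hf t ht
    refine ⟨v, ?_⟩
    rintro (x | y | t') hmem
    · exact (hφ1 v x).2 (h1 x x.2)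
    · exact (hφ2 v y).2 (h2 y (Finset.mem_biUnion.2 ⟨_, hmem, by simp⟩))
    · refine (hφ3 v t').2 ?_
      have hsub : (t' : Finset B) ⊆ t := fun x hx =>
        Finset.mem_biUnion.2 ⟨_, hmem, by simpa using hx⟩
      exact h3.comp (f := fun x : (t' : Finset B) => (⟨x, hsub x.2⟩ : t))
        fun x y h => Subtype.ext (congrArg (fun z : t => (z : B)) h))
  refine ⟨v, fun x hx => (hφ1 v ⟨x, hx⟩).1 (hv _), fun y hy => (hφ2 v ⟨y, hy⟩).1 (hv _),
    fun t ht => (hφ3 v ⟨t, ht⟩).1 (hv _)⟩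

/-- Extension of a field embedding over a separably embedded subfield. -/
theorem Saturated.exists_ringHom [IsSepClosed N] (hsat : Saturated G) (hF : IsFrobeniusChain p F)
    {E E₁ : Type} [Field E] [CharP E p] [Countable E] [Field E₁] [Countable E₁] (i : E →+* E₁)
    (g₁ : E₁ →+* M) {X : Fin (m + 1) → Set E} (hg : IsGood p F (g₁.comp i) X) (f : E →+* N) :
    ∃ f₁ : E₁ →+* N, f₁.comp i = f := by
  classical
  have := infinite_of_isSepClosed N
  have := hsat.uncountable
  let φ : (E₁ × E₁) ⊕ ((E₁ × E₁) ⊕ E) → FForm m (N ⊕ E₁) := fun o =>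
    Sum.elim (fun x : E₁ × E₁ => Term.equal (Term.var (Sum.inr (x.1 + x.2)))
        (FTerm.add (Term.var (Sum.inr x.1)) (Term.var (Sum.inr x.2))))
      (Sum.elim (fun x : E₁ × E₁ => Term.equal (Term.var (Sum.inr (x.1 * x.2)))
        (FTerm.mul (Term.var (Sum.inr x.1)) (Term.var (Sum.inr x.2))))
      (fun x : E => Term.equal (Term.var (Sum.inr (i x))) (Term.var (Sum.inl (f x))))) o
  have hφ1 : ∀ v x, Holds G (φ (Sum.inl x)) (Sum.elim id v) ↔ v (x.1 + x.2) = v x.1 + v x.2 := by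
    intro v x; simp [φ]
  have hφ2 : ∀ v x, Holds G (φ (Sum.inr (Sum.inl x))) (Sum.elim id v) ↔
      v (x.1 * x.2) = v x.1 * v x.2 := by
    intro v x; simp [φ]
  have hφ3 : ∀ v x, Holds G (φ (Sum.inr (Sum.inr x))) (Sum.elim id v) ↔ v (i x) = f x := by
    intro v x; simp [φ]
  obtain ⟨v, hv⟩ := hsat E₁ _ φ (by
    intro s
    -- Finitely many conditions involve sums and products of elements of the finite set `t` only.
    -- The field `E(t)` is finitely generated and separable over `E`, so it embeds in `N`.
    let t : Finset E₁ := s.biUnion fun o => Sum.elim (fun x : E₁ × E₁ => {x.1, x.2})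
      (Sum.elim (fun x : E₁ × E₁ => {x.1, x.2}) fun _ => ∅) o
    let _ := i.toAlgebra
    let _ := f.toAlgebra
    let K := IntermediateField.adjoin E (t : Set E₁)
    have : Algebra.EssFiniteType E K :=
      IntermediateField.essFiniteType_iff.2 (IntermediateField.fg_adjoin_finset t)
    obtain ⟨θ⟩ := hg.exists_algHom (K := K) (N := N) hF (g₁.comp (algebraMap K E₁)) (by
      rw [RingHom.comp_assoc, ← IsScalarTower.algebraMap_eq]; rfl)
    have htK : ∀ x ∈ t, x ∈ K := fun x hx => IntermediateField.subset_adjoin E _ hx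
    let v : E₁ → N := fun x => if h : x ∈ K then θ ⟨x, h⟩ else 0
    have hvK : ∀ x (h : x ∈ K), v x = θ ⟨x, h⟩ := fun x h => dif_pos h
    refine ⟨v, ?_⟩
    rintro (x | x | x) hmem
    · have h1 : x.1 ∈ K := htK _ (Finset.mem_biUnion.2 ⟨_, hmem, by simp⟩)
      have h2 : x.2 ∈ K := htK _ (Finset.mem_biUnion.2 ⟨_, hmem, by simp⟩)
      refine (hφ1 v x).2 ?_
      rw [hvK _ h1, hvK _ h2, hvK _ (add_mem h1 h2), ← map_add]
      rfl
    · have h1 : x.1 ∈ K := htK _ (Finset.mem_biUnion.2 ⟨_, hmem, by simp⟩)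
      have h2 : x.2 ∈ K := htK _ (Finset.mem_biUnion.2 ⟨_, hmem, by simp⟩)
      refine (hφ2 v x).2 ?_
      rw [hvK _ h1, hvK _ h2, hvK _ (mul_mem h1 h2), ← map_mul]
      rfl
    · refine (hφ3 v x).2 ?_
      have hx : i x ∈ K := K.algebraMap_mem x
      rw [hvK _ hx]
      exact θ.commutes x)
  have h0 : ∀ x, v (i x) = f x := fun x => (hφ3 v x).1 (hv _)
  refine ⟨{ toFun := v
            map_one' := by rw [← map_one i, h0, map_one]
            map_zero' := by rw [← map_zero i, h0, map_zero]
            map_mul' := fun x y => (hφ2 v (x, y)).1 (hv _)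
            map_add' := fun x y => (hφ1 v (x, y)).1 (hv _) }, RingHom.ext h0⟩

end Saturated

/-! ### Independent families, and the levels of a divided `p`-basis -/

section Family

variable {N : Type*} [Field N] {p : ℕ} [Fact p.Prime] [CharP N p]

theorem MonIndep.injective {k : Subfield N} {ι : Type*} [Fintype ι] {a : ι → N}
    (h : MonIndep p k a) : Function.Injective a := by
  classical
  have hp := (Fact.out : p.Prime).one_lt
  have key : ∀ i, pMon p a (Pi.single i ⟨1, hp⟩ : ι → Fin p) = a i := by
    intro i
    rw [pMon, Finset.prod_eq_single i]
    · simp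
    · intro j _ hj
      simp [Pi.single_eq_of_ne hj]
    · simp
  intro i j hij
  rw [← key i, ← key j] at hij
  have h1 := congrFun (LinearIndependent.injective h hij) i
  by_contra hne
  rw [Pi.single_eq_same, Pi.single_eq_of_ne hne] at h1
  exact absurd (congrArg Fin.val h1) (by simp)

variable {B : Type*} {k : Subfield N} {v : B → N} {Y : Set B}

theorem injOn_of_monIndep (h : ∀ t : Finset B, ↑t ⊆ Y → MonIndep p k fun x : t => v x) :
    Set.InjOn v Y := by
  classical
  intro x hx y hy hxy
  have := (h {x, y} (by
    intro z hz
    simp only [Finset.coe_insert, Finset.coe_singleton, Set.mem_insert_iff,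
      Set.mem_singleton_iff] at hz
    rcases hz with rfl | rfl
    exacts [hx, hy])).injective
  exact congrArg Subtype.val (@this ⟨x, by simp⟩ ⟨y, by simp⟩ hxy)

theorem pIndSet_image (h : ∀ t : Finset B, ↑t ⊆ Y → MonIndep p k fun x : t => v x) :
    PIndSet p k (v '' Y) := by
  classical
  intro s hs
  choose x hxY hx using fun y : s => hs y.2
  have hinj : Function.Injective x := fun a b hab => Subtype.ext (by rw [← hx a, ← hx b, hab])
  have := (h (Finset.univ.image x) (by
    intro z hz
    simp only [Finset.coe_image, Finset.coe_univ, Set.image_univ, Set.mem_range] at hz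
    obtain ⟨y, rfl⟩ := hz
    exact hxY y)).comp (f := fun y : s => (⟨x y, by simp⟩ : (Finset.univ.image x : Finset B)))
    fun a b hab => hinj (congrArg Subtype.val hab)
  convert this using 1
  funext y
  exact (hx y).symm

end Family

section LevelMap

variable {N : Type w} [Field N] {m p : ℕ} [Fact p.Prime] [CharP N p] {G : Fin (m + 2) → Subfield N}
  {E E₁ : Type*} [Field E] [CharP E p] {i : E → E₁} {X : Fin (m + 1) → Set E}
  {X₁ : Fin (m + 1) → Set E₁} {H : E₁ → N}

theorem notMem_of_lt (hG : IsFrobeniusChain p G)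
    (hind : ∀ j, ∀ t : Finset E₁, ↑t ⊆ X₁ j → MonIndep p (G j.castSucc) fun x : t => H x)
    {j k : Fin (m + 1)} (hjk : j < k) {y : E₁} (hy : y ∈ X₁ k) : H y ∉ G j.succ := by
  intro h
  refine (pIndSet_image (hind k)).notMem (W := ∅) (hG.pow_mem _) ⟨y, hy, rfl⟩
    (Set.empty_subset _) ?_
  rw [Subfield.closure_empty, sup_bot_eq]
  exact hG.mono (Fin.le_castSucc_iff.2 (Fin.succ_lt_succ_iff.2 hjk)) h

/-- An element of the independent part at level `k` avoids `F k`, hence everything at lower levels.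
So the parts are disjoint, and maps chosen on each part separately glue to one map. -/
theorem level_unique (hG : IsFrobeniusChain p G)
    (hmem : ∀ j, ∀ x ∈ X₁ j, H x ∈ G j.succ)
    (hind : ∀ j, ∀ t : Finset E₁, ↑t ⊆ X₁ j → MonIndep p (G j.castSucc) fun x : t => H x)
    {j k : Fin (m + 1)} {x y : E₁} (hx : x ∈ X₁ j) (hy : y ∈ X₁ k) (hxy : H x = H y) : j = k := by
  rcases lt_trichotomy j k with h | h | h
  · exact absurd (hxy ▸ hmem j x hx) (notMem_of_lt hG hind h hy)
  · exact h
  · exact absurd (hxy ▸ hmem k y hy) (notMem_of_lt hG hind h hx)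

/-- The images of all parts extend to a divided `p`-basis of `N`, which is independent over `G 0`;
`IsGood.algebraicIndependent` then applies to what lies outside the `p`-basis of `E`. -/
theorem IsGood.algebraicIndependent_family [Algebra E N] (hG : IsFrobeniusChain p G)
    (hf : IsGood p G (algebraMap E N) X) (hXX₁ : ∀ j, i '' X j ⊆ X₁ j)
    (hH : ∀ j, ∀ x ∈ X j, H (i x) = algebraMap E N x)
    (hmem : ∀ j, ∀ x ∈ X₁ j, H x ∈ G j.succ)
    (hind : ∀ j, ∀ t : Finset E₁, ↑t ⊆ X₁ j → MonIndep p (G j.castSucc) fun x : t => H x) :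
    AlgebraicIndependent E fun z : ((⋃ j, X₁ j) \ ⋃ j, i '' X j : Set E₁) => H z := by
  have hinj : Set.InjOn H (⋃ j, X₁ j) := by
    intro x hx y hy hxy
    obtain ⟨j, hx⟩ := Set.mem_iUnion.1 hx
    obtain ⟨k, hy⟩ := Set.mem_iUnion.1 hy
    obtain rfl := level_unique hG hmem hind hx hy hxy
    exact injOn_of_monIndep (hind j) hx hy hxy
  set ζ : Set E₁ := (⋃ j, X₁ j) \ ⋃ j, i '' X j with hζ
  obtain ⟨Y, hY, hYgood⟩ := exists_isGood_id hG (Z := fun j => H '' X₁ j)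
    (fun j => by rintro _ ⟨x, hx, rfl⟩; exact hmem j x hx) (fun j => pIndSet_image (hind j))
  have hT := hYgood.pIndSet_upperPart hG 0
  simp only [RingHom.coe_id, Set.image_id] at hT
  have hYT : ∀ j, H '' X₁ j ⊆ upperPart Y 0 := fun j x hx =>
    Set.mem_iUnion.2 ⟨j, Set.mem_iUnion.2 ⟨Fin.zero_le _, hY j hx⟩⟩
  have := hf.algebraicIndependent hG hT (W := H '' ζ) (fun j => by
    rintro _ ⟨x, hx, rfl⟩
    exact hYT j ⟨i x, hXX₁ j ⟨x, hx, rfl⟩, hH j x hx⟩) (by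
    rintro _ ⟨x, hx, rfl⟩
    obtain ⟨j, hj⟩ := Set.mem_iUnion.1 hx.1
    exact hYT j ⟨x, hj, rfl⟩) (by
    rintro j x hx ⟨z, hz, hzx⟩
    rw [← hH j x hx] at hzx
    have hix : i x ∈ ⋃ j, i '' X j := Set.mem_iUnion.2 ⟨j, x, hx, rfl⟩
    have := hinj hz.1 (Set.mem_iUnion.2 ⟨j, hXX₁ j ⟨x, hx, rfl⟩⟩) hzx
    exact hz.2 (this ▸ hix))
  exact this.comp (fun z : ζ => (⟨H z, z, z.2, rfl⟩ : H '' ζ)) fun a b hab =>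
    Subtype.ext (hinj a.2.1 b.2.1 (congrArg Subtype.val hab))

end LevelMap

/-! ### The extension step of the back and forth -/

section Lift

variable {M : Type u} {N : Type w} [Field M] [Field N] {m p : ℕ} [Fact p.Prime] [CharP M p]
  [CharP N p] {F : Fin (m + 2) → Subfield M} {G : Fin (m + 2) → Subfield N}

/-- An embedding into a saturated chain extends along an extension which is separably embedded in
another chain with the same degrees. -/
theorem Saturated.exists_isGood_extend [IsSepClosed N] (hsat : Saturated G)
    (hF : IsFrobeniusChain p F) (hG : IsFrobeniusChain p G) (hd : degrees F = degrees G)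
    {E E₁ : Type} [Field E] [CharP E p] [Countable E] [Field E₁] [CharP E₁ p] [Countable E₁]
    {i : E →+* E₁} {X : Fin (m + 1) → Set E} {X₁ : Fin (m + 1) → Set E₁}
    (hXX₁ : ∀ j, i '' X j ⊆ X₁ j) {f : E →+* N} (hf : IsGood p G f X) {g₁ : E₁ →+* M}
    (hg₁ : IsGood p F g₁ X₁) : ∃ f₁ : E₁ →+* N, f₁.comp i = f ∧ IsGood p G f₁ X₁ := by
  classical
  have hg : IsGood p F (g₁.comp i) X := by
    refine ⟨hf.gen, fun j x hx => hg₁.mem j _ (hXX₁ j ⟨x, hx, rfl⟩), fun j => ?_⟩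
    refine (hg₁.ind j).mono ?_
    rintro _ ⟨x, hx, rfl⟩
    exact ⟨i x, hXX₁ j ⟨x, hx, rfl⟩, rfl⟩
  have hindg : ∀ j, ∀ t : Finset E₁, ↑t ⊆ X₁ j → MonIndep p (F j.castSucc) fun x : t => g₁ x :=
    fun j t ht => (hg₁.ind j).monIndep (fun a b hab => Subtype.ext (g₁.injective hab))
      fun x => ⟨x, ht x.2, rfl⟩
  let f₀ : E₁ → N := Function.extend i f 0
  have hf₀ : ∀ x, f₀ (i x) = f x := fun x => i.injective.extend_apply _ _ _
  have hv : ∀ j, ∃ v : E₁ → N, (∀ x ∈ i '' X j, v x = f₀ x) ∧ (∀ x ∈ X₁ j, v x ∈ G j.succ) ∧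
      ∀ t : Finset E₁, ↑t ⊆ X₁ j → MonIndep p (G j.castSucc) fun x : t => v x := by
    intro j
    refine hsat.exists_monIndep hF hG hd j (hXX₁ j) (hg₁.mem j) (hindg j) ?_ ?_
    · rintro _ ⟨x, hx, rfl⟩
      rw [hf₀]
      exact hf.mem j x hx
    · intro s hs
      refine (hf.ind j).monIndep ?_ ?_
      · intro a b hab
        obtain ⟨x, hx, hxa⟩ := hs a.2
        obtain ⟨y, hy, hyb⟩ := hs b.2
        apply Subtype.ext
        simp only [← hxa, ← hyb, hf₀] at hab
        rw [← hxa, ← hyb, f.injective hab]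
      · intro a
        obtain ⟨x, hx, hxa⟩ := hs a.2
        exact ⟨x, hx, by rw [← hxa, hf₀]⟩
  choose v hvX hvm hvi using hv
  -- The parts `X₁ j` are disjoint, so the maps `v j` glue on their union. The value `0` elsewhere
  -- is irrelevant.
  let H : E₁ → N := fun x => if h : ∃ j, x ∈ X₁ j then v h.choose x else 0
  have hHv : ∀ j, ∀ x ∈ X₁ j, H x = v j x := by
    intro j x hx
    have h : ∃ j, x ∈ X₁ j := ⟨j, hx⟩
    simp only [H, dif_pos h]
    rw [level_unique hF hg₁.mem hindg h.choose_spec hx rfl]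
  have hHm : ∀ j, ∀ x ∈ X₁ j, H x ∈ G j.succ := fun j x hx => hHv j x hx ▸ hvm j x hx
  have hHi : ∀ j, ∀ t : Finset E₁, ↑t ⊆ X₁ j → MonIndep p (G j.castSucc) fun x : t => H x := by
    intro j t ht
    have : (fun x : t => H x) = fun x : t => v j x := funext fun x => hHv j x (ht x.2)
    rw [this]
    exact hvi j t ht
  have hHX : ∀ j, ∀ x ∈ X j, H (i x) = f x := by
    intro j x hx
    rw [hHv j _ (hXX₁ j ⟨x, hx, rfl⟩), hvX j _ ⟨x, hx, rfl⟩, hf₀]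
  let _ := i.toAlgebra
  let _ := f.toAlgebra
  let _ := (g₁.comp i).toAlgebra
  have hy := IsGood.algebraicIndependent_family (i := i) (X := X) (H := H) hG hf hXX₁ hHX hHm hHi
  have hx := IsGood.algebraicIndependent_family (i := i) (X := X) (H := g₁) hF hg hXX₁
    (fun j x hx => rfl) hg₁.mem hindg
  set ζ : Set E₁ := (⋃ j, X₁ j) \ ⋃ j, i '' X j with hζ
  let γ : E₁ →ₐ[E] M := { g₁ with commutes' := fun _ => rfl }
  have hx' : AlgebraicIndependent E (Subtype.val : ζ → E₁) := AlgebraicIndependent.of_comp γ hx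
  -- The new part `ζ` of the `p`-basis is algebraically independent over `E` on both sides, so
  -- `E(ζ)` maps to `N` with prescribed values on `ζ`.
  obtain ⟨θ, hθ⟩ := exists_algHom_of_algebraicIndependent hx' hy
  let A : Subfield E₁ :=
    (IntermediateField.adjoin E (Set.range (Subtype.val : ζ → E₁))).toSubfield
  have hiA : ∀ x, i x ∈ A := fun x => IntermediateField.algebraMap_mem _ x
  have hζA : ∀ x ∈ ζ, x ∈ A := fun x hx => IntermediateField.subset_adjoin E _ ⟨⟨x, hx⟩, rfl⟩
  have hXA : ∀ j, X₁ j ⊆ A := by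
    intro j x hx
    by_cases h : x ∈ ⋃ j, i '' X j
    · obtain ⟨k, y, hy, rfl⟩ := Set.mem_iUnion.1 h
      exact hiA y
    · exact hζA x ⟨Set.mem_iUnion.2 ⟨j, hx⟩, h⟩
  -- `A = E(ζ)` is already generated by `X₁` over its `p`-th powers. It is therefore well embedded
  -- in `M`, and only a separable extension from `A` to `E₁` remains, which
  -- `Saturated.exists_ringHom` handles.
  have hA : A ≤ pPowers p A ⊔ Subfield.closure (⋃ j, X₁ j) := by
    have h1 : (⊤ : Subfield E) ≤ (pPowers p A ⊔ Subfield.closure (⋃ j, X₁ j)).comap i := by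
      rw [← hf.gen]
      refine sup_le ?_ (Subfield.closure_le.2 ?_)
      · rintro _ ⟨y, rfl⟩
        refine (le_sup_left : pPowers p A ≤ _) (mem_pPowers.2 ⟨i y, hiA y, ?_⟩)
        rw [frobenius_def, map_pow]
      · intro y hy
        obtain ⟨j, hj⟩ := Set.mem_iUnion.1 hy
        exact (le_sup_right : Subfield.closure (⋃ j, X₁ j) ≤ _)
          (Subfield.subset_closure (Set.mem_iUnion.2 ⟨j, hXX₁ j ⟨y, hj, rfl⟩⟩))
    have h2 : A = Subfield.closure (Set.range i ∪ Set.range (Subtype.val : ζ → E₁)) :=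
      IntermediateField.adjoin_toSubfield ..
    rw [h2, ← h2]
    refine Subfield.closure_le.2 ?_
    rintro _ (⟨y, rfl⟩ | ⟨y, rfl⟩)
    · exact h1 (Subfield.mem_top y)
    · exact (le_sup_right : Subfield.closure (⋃ j, X₁ j) ≤ _) (Subfield.subset_closure y.2.1)
  have hgA : IsGood p F (g₁.comp A.subtype) (fun j => Subtype.val ⁻¹' X₁ j) :=
    ⟨gen_subtype hXA hA, fun j x hx => hg₁.mem j _ hx, fun j => (hg₁.ind j).mono (by
      rintro _ ⟨x, hx, rfl⟩; exact ⟨_, hx, rfl⟩)⟩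
  obtain ⟨f₁, hf₁⟩ := hsat.exists_ringHom hF A.subtype g₁ hgA (θ : A →+* N)
  have hfi : ∀ x, f₁ (i x) = f x := by
    intro x
    have h1 : f₁ (i x) = θ ⟨i x, hiA x⟩ := RingHom.congr_fun hf₁ ⟨i x, hiA x⟩
    rw [h1]
    exact θ.commutes x
  have hfH : ∀ j, ∀ x ∈ X₁ j, f₁ x = H x := by
    intro j x hx
    by_cases h : x ∈ ⋃ j, i '' X j
    · obtain ⟨k, y, hy, rfl⟩ := Set.mem_iUnion.1 h
      rw [hfi, hHX k y hy]
    · have hxζ : x ∈ ζ := ⟨Set.mem_iUnion.2 ⟨j, hx⟩, h⟩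
      have h1 : f₁ x = θ ⟨x, hζA x hxζ⟩ := RingHom.congr_fun hf₁ ⟨x, hζA x hxζ⟩
      rw [h1]
      exact hθ ⟨x, hxζ⟩
  refine ⟨f₁, RingHom.ext hfi, hg₁.gen, fun j x hx => hfH j x hx ▸ hHm j x hx, fun j => ?_⟩
  rw [Set.image_congr (hfH j)]
  exact pIndSet_image (hHi j)

end Lift

/-! ### Models of the theory of a chain -/

section FieldOfModel

open FirstOrder.Language

variable {m : ℕ} {K : Type*} [Field K] {F : Fin (m + 2) → Subfield K}
  {M : Type*} [S : (chainLang m).Structure M]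

theorem realize_of_forall_holds (hM : M ⊨ chainTheory F) {α : Type} [Finite α] (φ : FForm m α)
    (h : ∀ v : α → K, Holds F φ v) (v : α → M) : φ.Realize v := by
  let ψ : (chainLang m).Sentence := Formula.iAlls α (φ.relabel (Sum.inr : α → Empty ⊕ α))
  have hψ : ψ ∈ chainTheory F := by
    rw [chainTheory, @mem_completeTheory]
    refine (holds_iAlls F _ _).2 fun i => ?_
    rw [holds_relabel]
    exact h _
  have h1 : (Formula.iAlls α (φ.relabel (Sum.inr : α → Empty ⊕ α))).Realize (default : Empty → M) :=
    hM.realize_of_mem ψ hψ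
  rw [Formula.realize_iAlls] at h1
  have h2 := h1 v
  rw [Formula.realize_relabel] at h2
  exact h2

/-- Addition in a structure for the language of chains. -/
def opAdd (x y : M) : M := Structure.funMap (L := chainLang m) FieldFunc.add ![x, y]

/-- Multiplication in a structure for the language of chains. -/
def opMul (x y : M) : M := Structure.funMap (L := chainLang m) FieldFunc.mul ![x, y]

/-- Negation in a structure for the language of chains. -/
def opNeg (x : M) : M := Structure.funMap (L := chainLang m) FieldFunc.neg ![x]

/-- Inversion in a structure for the language of chains. -/
def opInv (x : M) : M := Structure.funMap (L := chainLang m) FieldFunc.inv ![x]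

variable (m M) in
/-- The zero element of a structure for the language of chains. -/
def opZero : M := Structure.funMap (L := chainLang m) FieldFunc.zero ![]

variable (m M) in
/-- The unit element of a structure for the language of chains. -/
def opOne : M := Structure.funMap (L := chainLang m) FieldFunc.one ![]

/-- The predicates of a structure for the language of chains. -/
def relMem (k : Fin m) (x : M) : Prop :=
  Structure.RelMap (L := chainLang m) (ChainRel.mem k) ![x]

/-- The atomic formula for a predicate. -/
def relF {α : Type*} (k : Fin m) (t : FTerm m α) : FForm m α :=
  Relations.formula (L := chainLang m) (ChainRel.mem k) ![t]

variable {α : Type*} (t s : FTerm m α) (v : α → M)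

theorem realize_add : (t.add s).realize v = opAdd (m := m) (t.realize v) (s.realize v) :=
  congrArg (Structure.funMap (L := chainLang m) FieldFunc.add)
    (funext fun i => by fin_cases i <;> rfl)

theorem realize_mul : (t.mul s).realize v = opMul (m := m) (t.realize v) (s.realize v) :=
  congrArg (Structure.funMap (L := chainLang m) FieldFunc.mul)
    (funext fun i => by fin_cases i <;> rfl)

theorem realize_neg : t.neg.realize v = opNeg (m := m) (t.realize v) :=
  congrArg (Structure.funMap (L := chainLang m) FieldFunc.neg)
    (funext fun i => by fin_cases i; rfl)

theorem realize_inv : t.inv.realize v = opInv (m := m) (t.realize v) :=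
  congrArg (Structure.funMap (L := chainLang m) FieldFunc.inv)
    (funext fun i => by fin_cases i; rfl)

theorem realize_zero : (FTerm.zero : FTerm m α).realize v = opZero m M :=
  congrArg (Structure.funMap (L := chainLang m) FieldFunc.zero) (Subsingleton.elim _ _)

theorem realize_one : (FTerm.one : FTerm m α).realize v = opOne m M :=
  congrArg (Structure.funMap (L := chainLang m) FieldFunc.one) (Subsingleton.elim _ _)

theorem realize_relF (k : Fin m) : (relF k t).Realize v ↔ relMem k (t.realize v) := by
  refine (Formula.realize_rel (L := chainLang m) (R := ChainRel.mem k)).trans ?_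
  refine iff_of_eq (congrArg _ (funext fun i => ?_))
  fin_cases i; rfl

theorem holds_relF (k : Fin m) (v : α → K) :
    Holds F (relF k t) v ↔ tval F t v ∈ F k.castSucc.succ :=
  @Formula.realize_rel (chainLang m) K (chainStructure F) _ _ 1 (ChainRel.mem k) _

theorem realize_eq : (Term.equal t s).Realize v ↔ t.realize v = s.realize v :=
  Formula.realize_equal ..

theorem realize_imp' (φ ψ : FForm m α) : (Formula.imp φ ψ).Realize v ↔ (φ.Realize v → ψ.Realize v) :=
  Formula.realize_imp

theorem realize_not' (φ : FForm m α) : (Formula.not φ).Realize v ↔ ¬ φ.Realize v :=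
  Formula.realize_not

/-- A model of the theory of a chain is a field with predicates for subfields. -/
theorem exists_field_of_realize (hM : M ⊨ chainTheory F) :
    ∃ (_ : Field M) (F' : Fin (m + 2) → Subfield M), S = chainStructure F' := by
  let x : FTerm m (Fin 3) := Term.var 0
  let y : FTerm m (Fin 3) := Term.var 1
  let z : FTerm m (Fin 3) := Term.var 2
  have eqn : ∀ t s : FTerm m (Fin 3), (∀ v : Fin 3 → K, tval F t v = tval F s v) →
      ∀ v : Fin 3 → M, t.realize v = s.realize v := fun t s h v =>
    (realize_eq t s v).1 (realize_of_forall_holds hM _ (fun v => (holds_equal F t s v).2 (h v)) v)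
  have cl : ∀ (k : Fin m) (t : FTerm m (Fin 3)), (∀ v : Fin 3 → K, v 0 ∈ F k.castSucc.succ →
      v 1 ∈ F k.castSucc.succ → tval F t v ∈ F k.castSucc.succ) →
      ∀ v : Fin 3 → M, relMem k (v 0) → relMem k (v 1) → relMem k (t.realize v) := by
    intro k t h v h0 h1
    have := realize_of_forall_holds hM (Formula.imp (relF k x) (Formula.imp (relF k y) (relF k t)))
      (fun v => by
        rw [holds_imp, holds_imp, holds_relF, holds_relF, holds_relF]
        exact h v) v
    rw [realize_imp', realize_imp', realize_relF, realize_relF, realize_relF] at this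
    exact this h0 h1
  let _ : Add M := ⟨opAdd (m := m)⟩
  let _ : Mul M := ⟨opMul (m := m)⟩
  let _ : Neg M := ⟨opNeg (m := m)⟩
  let _ : Inv M := ⟨opInv (m := m)⟩
  let _ : Zero M := ⟨opZero m M⟩
  let _ : One M := ⟨opOne m M⟩
  have ra : ∀ (t s : FTerm m (Fin 3)) (v : Fin 3 → M),
      (t.add s).realize v = t.realize v + s.realize v := realize_add
  have rm : ∀ (t s : FTerm m (Fin 3)) (v : Fin 3 → M),
      (t.mul s).realize v = t.realize v * s.realize v := realize_mul
  have rn : ∀ (t : FTerm m (Fin 3)) (v : Fin 3 → M), t.neg.realize v = - t.realize v := realize_neg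
  have ri : ∀ (t : FTerm m (Fin 3)) (v : Fin 3 → M), t.inv.realize v = (t.realize v)⁻¹ :=
    realize_inv
  have rz : ∀ v : Fin 3 → M, (FTerm.zero : FTerm m (Fin 3)).realize v = 0 := realize_zero
  have ro : ∀ v : Fin 3 → M, (FTerm.one : FTerm m (Fin 3)).realize v = 1 := realize_one
  have hx : ∀ v : Fin 3 → M, x.realize v = v 0 := fun v => rfl
  have hy : ∀ v : Fin 3 → M, y.realize v = v 1 := fun v => rfl
  have hz : ∀ v : Fin 3 → M, z.realize v = v 2 := fun v => rfl
  have add_assoc : ∀ a b c : M, a + b + c = a + (b + c) := fun a b c => by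
    have h := eqn ((x.add y).add z) (x.add (y.add z))
      (fun v => by simp [add_assoc]) ![a, b, c]
    simp only [ra, hx, hy, hz] at h
    exact h
  have zero_add : ∀ a : M, 0 + a = a := fun a => by
    have h := eqn (FTerm.zero.add x) x (fun v => by simp) ![a, a, a]
    simp only [ra, rz, hx] at h
    exact h
  have neg_add_cancel : ∀ a : M, -a + a = 0 := fun a => by
    have h := eqn (x.neg.add x) FTerm.zero (fun v => by simp) ![a, a, a]
    simp only [ra, rn, rz, hx] at h
    exact h
  have mul_assoc : ∀ a b c : M, a * b * c = a * (b * c) := fun a b c => by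
    have h := eqn ((x.mul y).mul z) (x.mul (y.mul z))
      (fun v => by simp [mul_assoc]) ![a, b, c]
    simp only [rm, hx, hy, hz] at h
    exact h
  have mul_comm : ∀ a b : M, a * b = b * a := fun a b => by
    have h := eqn (x.mul y) (y.mul x)
      (fun v => by simp [mul_comm]) ![a, b, b]
    simp only [rm, hx, hy] at h
    exact h
  have one_mul : ∀ a : M, 1 * a = a := fun a => by
    have h := eqn (FTerm.one.mul x) x (fun v => by simp) ![a, a, a]
    simp only [rm, ro, hx] at h
    exact h
  have mul_inv_cancel : ∀ a : M, a ≠ 0 → a * a⁻¹ = 1 := fun a ha => by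
    have := realize_of_forall_holds hM (Formula.imp (Formula.not (Term.equal x FTerm.zero))
      (Term.equal (x.mul x.inv) FTerm.one)) (fun v => by
        simp only [holds_imp, holds_not, holds_equal, tval_mul, tval_inv, tval_one, tval_zero]
        exact mul_inv_cancel₀) ![a, a, a]
    rw [realize_imp', realize_not', realize_eq, realize_eq, rm, ri, ro, rz] at this
    exact this ha
  have inv_zero : (0 : M)⁻¹ = 0 := by
    by_contra h
    have := eqn (FTerm.zero.inv) FTerm.zero (fun v => by simp) fun _ => 0
    rw [ri, rz] at this
    exact h this
  have left_distrib : ∀ a b c : M, a * (b + c) = a * b + a * c := fun a b c => by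
    have h := eqn (x.mul (y.add z)) ((x.mul y).add (x.mul z))
      (fun v => by simp [mul_add]) ![a, b, c]
    simp only [rm, ra, hx, hy, hz] at h
    exact h
  have zero_ne_one : (0 : M) ≠ 1 := by
    have := realize_of_forall_holds hM (Formula.not (Term.equal (FTerm.zero : FTerm m (Fin 3))
      FTerm.one)) (fun v => by simp) fun _ => 0
    rw [realize_not', realize_eq, rz, ro] at this
    exact this
  let fld : Field M := Field.ofMinimalAxioms M add_assoc zero_add neg_add_cancel mul_assoc mul_comm
    one_mul mul_inv_cancel inv_zero left_distrib ⟨0, 1, zero_ne_one⟩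
  have zero_mem : ∀ k : Fin m, relMem k (0 : M) := fun k => by
    have := realize_of_forall_holds hM (relF k (FTerm.zero : FTerm m (Fin 3)))
      (fun v => (holds_relF _ _ _).2 (zero_mem _)) fun _ => 0
    rwa [realize_relF, rz] at this
  have one_mem : ∀ k : Fin m, relMem k (1 : M) := fun k => by
    have := realize_of_forall_holds hM (relF k (FTerm.one : FTerm m (Fin 3)))
      (fun v => (holds_relF _ _ _).2 (one_mem _)) fun _ => 0
    rwa [realize_relF, ro] at this
  let F₀ : Fin m → Subfield M := fun k =>
    { carrier := {x | relMem k x}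
      mul_mem' := fun {a b} ha hb => by
        have := cl k (x.mul y) (fun v => mul_mem) ![a, b, b] ha hb
        rwa [rm] at this
      one_mem' := one_mem k
      add_mem' := fun {a b} ha hb => by
        have := cl k (x.add y) (fun v => add_mem) ![a, b, b] ha hb
        rwa [ra] at this
      zero_mem' := zero_mem k
      neg_mem' := fun {a} ha => by
        have := cl k x.neg (fun v h _ => neg_mem h) ![a, a, a] ha ha
        rwa [rn] at this
      inv_mem' := fun a ha => by
        have := cl k x.inv (fun v h _ => inv_mem h) ![a, a, a] ha ha
        rwa [ri] at this }
  -- The two ends of the chain do not enter the structure. `⊥` and `⊤` are placeholders here; the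
  -- proper ends are put in by `isChainModel_of_realize`.
  refine ⟨fld, Fin.cases ⊥ fun i => Fin.lastCases (motive := fun _ => Subfield M) ⊤ F₀ i, ?_⟩
  refine Structure.ext ?_ ?_
  · funext n f x
    have hu : ∀ g : Fin 1 → M, g = ![g 0] := fun g => funext fun i => by fin_cases i; rfl
    have hb : ∀ g : Fin 2 → M, g = ![g 0, g 1] := fun g => funext fun i => by fin_cases i <;> rfl
    have hn : ∀ g : Fin 0 → M, g = ![] := fun g => Subsingleton.elim _ _
    cases f
    · exact congrArg (S.funMap (FieldFunc.add : (chainLang m).Functions 2)) (hb x)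
    · exact congrArg (S.funMap (FieldFunc.mul : (chainLang m).Functions 2)) (hb x)
    · exact congrArg (S.funMap (FieldFunc.neg : (chainLang m).Functions 1)) (hu x)
    · exact congrArg (S.funMap (FieldFunc.inv : (chainLang m).Functions 1)) (hu x)
    · exact congrArg (S.funMap (FieldFunc.zero : (chainLang m).Functions 0)) (hn x)
    · exact congrArg (S.funMap (FieldFunc.one : (chainLang m).Functions 0)) (hn x)
  · funext n r x
    cases r with
    | mem k =>
      have hu : x = ![x 0] := funext fun i => by fin_cases i; rfl
      have h1 : (Fin.cases (motive := fun _ => Subfield M) ⊥ (fun i => Fin.lastCases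
        (motive := fun _ => Subfield M) ⊤ F₀ i) k.castSucc.succ) = F₀ k := by
        simp
      change S.RelMap (ChainRel.mem k : (chainLang m).Relations 1) x = (x 0 ∈ (Fin.cases
        (motive := fun _ => Subfield M) ⊥ (fun i => Fin.lastCases
        (motive := fun _ => Subfield M) ⊤ F₀ i) k.castSucc.succ))
      rw [h1]
      exact congrArg (S.RelMap (ChainRel.mem k : (chainLang m).Relations 1)) hu

end FieldOfModel

/-! ### Separable closedness as a first-order scheme -/

section SepClosed

open Polynomial

theorem derivative_eq_zero_of_factors {M : Type*} [Field M] (f : M[X]) (hf : f ≠ 0)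
    (h : ∀ g : M[X], Irreducible g → g ∣ f → derivative g = 0) : derivative f = 0 := by
  induction f using WfDvdMonoid.induction_on_irreducible with
  | zero => exact absurd rfl hf
  | unit u hu =>
    obtain ⟨c, -, rfl⟩ := Polynomial.isUnit_iff.1 hu
    simp
  | mul a i ha hi ih =>
    rw [derivative_mul, h i hi (dvd_mul_right i a),
      ih ha fun g hg hga => h g hg (hga.trans (dvd_mul_left a i))]
    simp

/-- By the product rule, some irreducible factor of `f` has nonzero derivative; that factor is
separable and so has a root. -/
theorem exists_root_of_derivative_ne_zero {M : Type*} [Field M] [IsSepClosed M] (f : M[X])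
    (h : derivative f ≠ 0) : ∃ x, f.eval x = 0 := by
  have hf : f ≠ 0 := by rintro rfl; simp at h
  by_contra hcon
  refine h (derivative_eq_zero_of_factors f hf fun g hg hgf => ?_)
  by_contra hg'
  have hsep : g.Separable := (separable_iff_derivative_ne_zero hg).2 hg'
  obtain ⟨x, hx⟩ := IsSepClosed.exists_root g hg.degree_pos.ne' hsep
  exact hcon ⟨x, eval_eq_zero_of_dvd_of_eval_eq_zero hgf hx⟩

/-- A polynomial has nonzero derivative exactly when some coefficient `a i` is nonzero with `i`
nonzero in the field. This gives one sentence for each pair `n`, `i`, with no mention of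
irreducibility. -/
theorem isSepClosed_iff_exists_root {M : Type*} [Field M] :
    IsSepClosed M ↔ ∀ (n : ℕ) (i : Fin (n + 1)), ((i : ℕ) : M) ≠ 0 → ∀ a : Fin (n + 1) → M,
      a i ≠ 0 → ∃ x, ∑ k, a k * x ^ (k : ℕ) = 0 := by
  constructor
  · intro _ n i hi a ha
    let f : M[X] := ∑ k : Fin (n + 1), C (a k) * X ^ (k : ℕ)
    have hcoeff : f.coeff (i : ℕ) = a i := by
      simp only [f, finsetSum_coeff, coeff_C_mul, coeff_X_pow]
      rw [Finset.sum_eq_single i]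
      · simp
      · intro b _ hb
        have : (i : ℕ) ≠ b := fun e => hb (Fin.ext e.symm)
        simp [this]
      · simp
    have hd : derivative f ≠ 0 := by
      intro h0
      obtain ⟨j, hj⟩ : ∃ j, (i : ℕ) = j + 1 := Nat.exists_eq_succ_of_ne_zero (by
        intro e; simp [e] at hi)
      have h1 := congrArg (fun q => coeff q j) h0
      simp only [coeff_derivative, coeff_zero] at h1
      rw [← hj, hcoeff] at h1
      rcases mul_eq_zero.1 h1 with h | h
      · exact ha h
      · apply hi
        rw [hj]
        push_cast
        exact h
    obtain ⟨x, hx⟩ := exists_root_of_derivative_ne_zero f hd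
    refine ⟨x, ?_⟩
    simpa [f, eval_finsetSum] using hx
  · intro h
    refine IsSepClosed.of_exists_root M fun f _ hirr hsep => ?_
    have hd := (separable_iff_derivative_ne_zero hirr).1 hsep
    obtain ⟨j, hj⟩ : ∃ j, (derivative f).coeff j ≠ 0 := by
      by_contra hcon
      push Not at hcon
      exact hd (Polynomial.ext (by simpa using hcon))
    rw [coeff_derivative] at hj
    have hle : j + 1 ≤ f.natDegree := le_natDegree_of_ne_zero (left_ne_zero_of_mul hj)
    obtain ⟨x, hx⟩ := h f.natDegree ⟨j + 1, by omega⟩ (by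
      push_cast; exact right_ne_zero_of_mul hj) (fun k => f.coeff k) (left_ne_zero_of_mul hj)
    refine ⟨x, ?_⟩
    rw [eval_eq_sum_range, ← Fin.sum_univ_eq_sum_range (fun k => f.coeff k * x ^ k)]
    exact hx

end SepClosed

/-! ### The chain axioms hold in every model -/

section ChainModel

open FirstOrder.Language

variable {m : ℕ} {K : Type*} [Field K] {F : Fin (m + 2) → Subfield K}
  {M : Type*} [Field M] {G : Fin (m + 2) → Subfield M}

theorem holds_of_forall_holds
    (hM : @Theory.Model (chainLang m) M (chainStructure G) (chainTheory F)) {α : Type} [Finite α]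
    (φ : FForm m α) (h : ∀ v : α → K, Holds F φ v) (v : α → M) : Holds G φ v :=
  @realize_of_forall_holds m K _ F M (chainStructure G) hM α _ φ h v

theorem exists_holds_iff
    (hM : @Theory.Model (chainLang m) M (chainStructure G) (chainTheory F)) {α : Type} [Finite α]
    (φ : FForm m α) : (∃ v : α → K, Holds F φ v) ↔ ∃ v : α → M, Holds G φ v := by
  constructor
  · intro h
    have := holds_of_forall_holds hM (α := Empty) (Formula.iExs α
      (φ.relabel (Sum.inr : α → Empty ⊕ α))) (fun v => by
        rw [holds_iExs]
        obtain ⟨w, hw⟩ := h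
        exact ⟨w, (holds_relabel F φ _ _).2 hw⟩) default
    rw [holds_iExs] at this
    obtain ⟨w, hw⟩ := this
    exact ⟨w, (holds_relabel G φ Sum.inr _).1 hw⟩
  · rintro ⟨v, hv⟩
    by_contra hcon
    push Not at hcon
    exact (holds_not G φ v).1
      (holds_of_forall_holds hM (Formula.not φ) (fun w => (holds_not F φ w).2 (hcon w)) v) hv

variable {p : ℕ} [Fact p.Prime] [CharP K p]

theorem charP_of_model
    (hM : @Theory.Model (chainLang m) M (chainStructure G) (chainTheory F)) : CharP M p := by
  have := holds_of_forall_holds hM (α := Empty) (Term.equal (FTerm.sum fun _ : Fin p => FTerm.one)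
    FTerm.zero) (fun v => by simp) default
  simp only [holds_equal, tval_sum, tval_one, Finset.sum_const, Finset.card_univ, Fintype.card_fin,
    tval_zero, nsmul_eq_mul, mul_one] at this
  exact (CharP.charP_iff_prime_eq_zero (Fact.out : p.Prime)).2 this

theorem isSepClosed_of_model [IsSepClosed K] [CharP M p]
    (hM : @Theory.Model (chainLang m) M (chainStructure G) (chainTheory F)) : IsSepClosed M := by
  rw [isSepClosed_iff_exists_root]
  intro n i hi a ha
  have hiK : ((i : ℕ) : K) ≠ 0 := by
    rw [Ne, CharP.cast_eq_zero_iff K p]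
    rwa [Ne, CharP.cast_eq_zero_iff M p] at hi
  have := holds_of_forall_holds hM (α := Fin (n + 1)) (Formula.imp
    (Formula.not (Term.equal (Term.var i) FTerm.zero)) (Formula.iExs Unit (Term.equal
      (FTerm.sum fun k : Fin (n + 1) => FTerm.mul (Term.var (Sum.inl k))
        (FTerm.pow (Term.var (Sum.inr ())) (k : ℕ))) FTerm.zero))) (fun v => by
      simp only [holds_imp, holds_not, holds_equal, tval_var, tval_zero, holds_iExs, tval_sum,
        tval_mul, tval_pow, Sum.elim_inl, Sum.elim_inr]
      intro hv
      obtain ⟨x, hx⟩ := isSepClosed_iff_exists_root.1 ‹IsSepClosed K› n i hiK v hv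
      exact ⟨fun _ => x, hx⟩) a
  simp only [holds_imp, holds_not, holds_equal, tval_var, tval_zero, holds_iExs, tval_sum,
    tval_mul, tval_pow, Sum.elim_inl, Sum.elim_inr] at this
  obtain ⟨x, hx⟩ := this ha
  exact ⟨_, hx⟩

theorem isFrobeniusChain_of_model [CharP M p] (hF : IsFrobeniusChain p F)
    (hM : @Theory.Model (chainLang m) M (chainStructure G) (chainTheory F))
    (h0 : G 0 = (frobenius M p).fieldRange) (h1 : G (Fin.last (m + 1)) = ⊤) :
    IsFrobeniusChain p G where
  zero := h0
  last := h1
  mono := by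
    have hpow : ∀ (k : Fin m) (x : M), x ^ p ∈ G k.castSucc.succ := by
      intro k x
      have := holds_of_forall_holds hM (α := Unit) (relF k (FTerm.pow (Term.var ()) p))
        (fun v => (holds_relF _ _ _).2 (by simpa using hF.pow_mem _ _)) (fun _ => x)
      rw [holds_relF] at this
      simpa using this
    rw [Fin.monotone_iff_le_succ]
    intro j
    induction j using Fin.lastCases with
    | last => rw [Fin.succ_last, h1]; exact le_top
    | cast k =>
      by_cases hk : (k : ℕ) = 0
      · have : k.castSucc.castSucc = 0 := Fin.ext hk
        rw [this, h0]
        rintro _ ⟨x, rfl⟩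
        exact hpow k x
      · obtain ⟨l, hl⟩ := Nat.exists_eq_succ_of_ne_zero hk
        let k' : Fin m := ⟨l, by omega⟩
        have hk' : k.castSucc.castSucc = k'.castSucc.succ := Fin.ext hl
        intro x hx
        have := holds_of_forall_holds hM (α := Unit) (Formula.imp (relF k' (Term.var ()))
          (relF k (Term.var ()))) (fun v => by
            rw [holds_imp, holds_relF, holds_relF, ← hk']
            exact fun h => hF.mono (Fin.castSucc_lt_succ).le h) fun _ => x
        rw [holds_imp, holds_relF, holds_relF, ← hk'] at this
        exact this hx

theorem degrees_eq_of_model [CharP M p] (hF : IsFrobeniusChain p F) (hG : IsFrobeniusChain p G)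
    (hM : @Theory.Model (chainLang m) M (chainStructure G) (chainTheory F)) :
    degrees G = degrees F := by
  funext j
  refine ENat.eq_of_forall_natCast_le_iff fun n => ?_
  rw [natCast_le_degrees hG.mono, natCast_le_degrees hF.mono]
  have := exists_holds_iff hM (α := Fin n) ((Formula.iInf fun i : Fin n => memVar p j.succ i) ⊓
    linIndF p j.castSucc fun i : Fin n => Term.var i)
  simp only [holds_inf, holds_iInf, holds_memVar hF, holds_memVar hG, holds_linIndF hF,
    holds_linIndF hG, tval_var] at this
  exact this.symm

/-- A model of the theory of a separably closed chain is such a chain, with the same degrees. -/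
theorem isChainModel_of_realize [IsSepClosed K] (hF : IsFrobeniusChain p F) (M : Type*)
    [S : (chainLang m).Structure M] (hM : M ⊨ chainTheory F) : IsChainModel p (degrees F) M := by
  obtain ⟨fld, G, rfl⟩ := exists_field_of_realize hM
  have hchar : CharP M p := charP_of_model hM
  have hsep : IsSepClosed M := isSepClosed_of_model hM
  -- The prescribed ends replace the arbitrary ones; the structure depends on the middle fields
  -- only, so it is unchanged.
  let G' : Fin (m + 2) → Subfield M := fun j =>
    if j = 0 then (frobenius M p).fieldRange else if j = Fin.last (m + 1) then ⊤ else G j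
  have hGG' : ∀ k : Fin m, G' k.castSucc.succ = G k.castSucc.succ := by
    intro k
    have h1 : k.castSucc.succ ≠ Fin.last (m + 1) := by
      intro h
      have := congrArg Fin.val h
      simp at this
      omega
    simp only [G', if_neg (Fin.succ_ne_zero _), if_neg h1]
  have hS : chainStructure G = chainStructure G' := by
    refine Structure.ext rfl ?_
    funext n r x
    cases r with
    | mem k => exact congrArg (x 0 ∈ ·) (hGG' k).symm
  rw [hS] at hM
  have hG' : IsFrobeniusChain p G' := isFrobeniusChain_of_model hF hM (if_pos rfl) (by
    simp [G', Fin.last_eq_zero_iff])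
  exact ⟨fld, hchar, G', hsep, hG', degrees_eq_of_model hF hG' hM, hS⟩

end ChainModel

/-! ### The language with `λ`-functions and elementary extensions -/

section LambdaModel

open FirstOrder.Language

/-- The inclusion of the language of chains in the language with `λ`-functions. -/
def toLambda (p m : ℕ) : chainLang m →ᴸ lambdaLang p m where
  onFunction := fun _ f => LambdaFunc.field f
  onRelation := fun _ r => r

variable {m p : ℕ} [Fact p.Prime] {M : Type*} [Field M] [CharP M p]

/-- Truth of a formula in the chain `F` with its `λ`-functions. -/
def LHolds (p : ℕ) [Fact p.Prime] [CharP M p] (F : Fin (m + 2) → Subfield M) {α : Type*}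
    (φ : (lambdaLang p m).Formula α) (v : α → M) : Prop :=
  @Formula.Realize (lambdaLang p m) M (lambdaStructure p F) α φ v

variable {F : Fin (m + 2) → Subfield M} {α : Type*}

theorem lholds_onFormula (φ : FForm m α) (v : α → M) :
    LHolds p F ((toLambda p m).onFormula φ) v ↔ Holds F φ v := by
  let _ := lambdaStructure p F
  let _ := chainStructure F
  have : (toLambda p m).IsExpansionOn M := ⟨fun _ _ => rfl, fun _ _ => rfl⟩
  exact LHom.realize_onFormula (toLambda p m) φ

theorem lholds_not (φ : (lambdaLang p m).Formula α) (v : α → M) :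
    LHolds p F (Formula.not φ) v ↔ ¬ LHolds p F φ v := Iff.rfl

theorem lholds_inf (φ ψ : (lambdaLang p m).Formula α) (v : α → M) :
    LHolds p F (φ ⊓ ψ) v ↔ LHolds p F φ v ∧ LHolds p F ψ v :=
  @Formula.realize_inf _ _ (lambdaStructure p F) _ _ _ _

theorem lholds_relabel {β : Type*} (φ : (lambdaLang p m).Formula α) (g : α → β) (v : β → M) :
    LHolds p F (φ.relabel g) v ↔ LHolds p F φ (v ∘ g) :=
  @Formula.realize_relabel _ _ (lambdaStructure p F) _ _ _ _ _

theorem lholds_iInf {β : Type*} [Finite β] (φ : β → (lambdaLang p m).Formula α) (v : α → M) :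
    LHolds p F (Formula.iInf φ) v ↔ ∀ b, LHolds p F (φ b) v :=
  @Formula.realize_iInf _ _ (lambdaStructure p F) _ _ _ _ _

theorem lholds_iSup {β : Type*} [Finite β] (φ : β → (lambdaLang p m).Formula α) (v : α → M) :
    LHolds p F (Formula.iSup φ) v ↔ ∃ b, LHolds p F (φ b) v :=
  @Formula.realize_iSup _ _ (lambdaStructure p F) _ _ _ _ _

theorem lholds_iff (φ ψ : (lambdaLang p m).Formula α) (v : α → M) :
    LHolds p F (Formula.iff φ ψ) v ↔ (LHolds p F φ v ↔ LHolds p F ψ v) :=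
  @Formula.realize_iff _ _ (lambdaStructure p F) _ _ _ _

theorem lholds_iAlls {β : Type*} [Finite β] (φ : (lambdaLang p m).Formula (α ⊕ β)) (v : α → M) :
    LHolds p F (Formula.iAlls β φ) v ↔ ∀ i : β → M, LHolds p F φ (Sum.elim v i) := by
  rw [LHolds, @Formula.realize_iAlls _ _ (lambdaStructure p F) _ _ _ _ _]
  refine forall_congr' fun i => ?_
  rw [LHolds]

theorem realize_of_forall_lholds {N : Type*} [(lambdaLang p m).Structure N]
    (hN : N ⊨ lambdaTheory p F) {α : Type} [Finite α] (φ : (lambdaLang p m).Formula α)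
    (h : ∀ v : α → M, LHolds p F φ v) (v : α → N) : φ.Realize v := by
  let ψ : (lambdaLang p m).Sentence := Formula.iAlls α (φ.relabel (Sum.inr : α → Empty ⊕ α))
  have hψ : ψ ∈ lambdaTheory p F := by
    rw [lambdaTheory, @mem_completeTheory]
    refine (lholds_iAlls _ _).2 fun i => ?_
    rw [lholds_relabel]
    exact h _
  have h1 : (Formula.iAlls α (φ.relabel (Sum.inr : α → Empty ⊕ α))).Realize (default : Empty → N) :=
    hN.realize_of_mem ψ hψ
  rw [Formula.realize_iAlls] at h1
  have h2 := h1 v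
  rw [Formula.realize_relabel] at h2
  exact h2

/-- A model of the theory of a separably closed chain with `λ`-functions is such a chain, with the
same degrees. -/
theorem isLambdaChainModel_of_realize [IsSepClosed M] (hF : IsFrobeniusChain p F) (N : Type*)
    [S : (lambdaLang p m).Structure N] (hN : N ⊨ lambdaTheory p F) :
    IsLambdaChainModel p (degrees F) N := by
  let S₀ : (chainLang m).Structure N := (toLambda p m).reduct N
  have hN₀ : N ⊨ chainTheory F := by
    refine ⟨fun φ hφ => ?_⟩
    rw [chainTheory, @mem_completeTheory] at hφ
    have h1 : (toLambda p m).onFormula φ ∈ lambdaTheory p F := by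
      rw [lambdaTheory, @mem_completeTheory]
      exact (lholds_onFormula φ _).2 hφ
    have h2 := hN.realize_of_mem _ h1
    exact (LHom.realize_onFormula (toLambda p m) φ).1 h2
  obtain ⟨fld, chr, G, hsep, hG, hdeg, hS₀⟩ := isChainModel_of_realize hF N hN₀
  refine ⟨fld, chr, G, hsep, hG, hdeg, Structure.ext ?_ ?_⟩
  · funext n f x
    cases f with
    | field f =>
      have h1 : S₀.funMap (f : (chainLang m).Functions n) x = _ :=
        congrArg (fun T : (chainLang m).Structure N => T.funMap f x) hS₀
      exact h1
    | lam j e =>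
      rename_i n
      let t : (lambdaLang p m).Term (Fin (n + 1) ⊕ Unit) :=
        Term.func (L := lambdaLang p m) (LambdaFunc.lam j e) fun i => Term.var (Sum.inl i)
      -- That a value of the `λ`-symbol satisfies the defining formula `lamF` is true in `M`, hence
      -- in `N`, where `lamF` again defines the natural `λ`-function.
      have h1 := realize_of_forall_lholds hN (Formula.imp
        (Term.equal (Term.var (Sum.inr ())) t) ((toLambda p m).onFormula (lamF p j.succ e)))
        (fun v => by
          refine (@Formula.realize_imp _ _ (lambdaStructure p F) _ _ _ _).2 fun h => ?_
          have h2 := (@Formula.realize_equal _ _ (lambdaStructure p F) _ _ _ _).1 h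
          refine (lholds_onFormula _ v).2 ?_
          have h3 : v = Sum.elim (v ∘ Sum.inl) fun _ => v (Sum.inr ()) := by
            funext z
            rcases z with z | z <;> rfl
          rw [h3, holds_lamF hF]
          exact h2) (Sum.elim x fun _ => S.funMap (LambdaFunc.lam j e) x)
      have h2 := Formula.realize_imp.1 h1 (Formula.realize_equal.2 rfl)
      have h4 : (lamF p j.succ e).Realize (Sum.elim x fun _ => S.funMap (LambdaFunc.lam j e) x) :=
        (LHom.realize_onFormula (toLambda p m) _).1 h2
      have h5 : Holds G (lamF p j.succ e) (Sum.elim x fun _ => S.funMap (LambdaFunc.lam j e) x) := by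
        rw [Holds, ← hS₀]
        exact h4
      exact (holds_lamF hG _ _ _ _).1 h5
  · funext n r x
    have h1 : S₀.RelMap (r : (chainLang m).Relations n) x = _ :=
      congrArg (fun T : (chainLang m).Structure N => T.RelMap r x) hS₀
    exact h1

end LambdaModel

/-! ### Ultrapowers and saturation -/

section Ultrapower

open FirstOrder.Language Filter

/-- The ultrapower of a type. -/
def UPow {I : Type*} (U : Ultrafilter I) (M : Type*) : Type _ :=
  (U : Filter I).Product fun _ : I => M

/-- The class of a family in an ultrapower. -/
def UPow.mk {I : Type*} (U : Ultrafilter I) {M : Type*} (x : I → M) : UPow U M :=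
  (x : (U : Filter I).Product fun _ : I => M)

variable {m p : ℕ} [Fact p.Prime] {M : Type u} [Field M] [CharP M p] {F : Fin (m + 2) → Subfield M}
  {I : Type w} {U : Ultrafilter I}

variable (p F U) in
/-- The ultrapower of a chain with `λ`-functions. -/
@[reducible]
noncomputable def uStr : (lambdaLang p m).Structure (UPow U M) :=
  @Ultraproduct.structure I (fun _ => M) U (lambdaLang p m) (fun _ => lambdaStructure p F)

/-- By Łoś's theorem the ultrapower is a model of the complete theory, and models of that theory are
already known to be chains; this supplies its field structure. -/
theorem isLambdaChainModel_uPow [IsSepClosed M] (hF : IsFrobeniusChain p F) :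
    @IsLambdaChainModel p _ m (degrees F) (UPow U M) (uStr p F U) := by
  let _ := lambdaStructure p F
  let _ := uStr p F U
  refine isLambdaChainModel_of_realize hF (UPow U M) ⟨fun φ hφ => ?_⟩
  rw [lambdaTheory, mem_completeTheory] at hφ
  exact (Ultraproduct.sentence_realize φ).2 (Eventually.of_forall fun _ => hφ)

variable [Field (UPow U M)] [CharP (UPow U M) p] {G : Fin (m + 2) → Subfield (UPow U M)}

theorem lholds_uPow (hS : uStr p F U = lambdaStructure p G) {α : Type*}
    (φ : (lambdaLang p m).Formula α) (x : α → I → M) :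
    LHolds p G φ (fun a => UPow.mk U (x a)) ↔
      ∀ᶠ i in U, LHolds p F φ fun a => x a i := by
  let _ := lambdaStructure p F
  have h : @Formula.Realize (lambdaLang p m) (UPow U M) (uStr p F U) α φ
      (fun a => UPow.mk U (x a)) ↔ ∀ᶠ i in U, LHolds p F φ fun a => x a i :=
    Ultraproduct.realize_formula_cast φ x
  rwa [hS] at h

theorem holds_uPow (hS : uStr p F U = lambdaStructure p G) {α : Type*}
    (φ : FForm m α) (x : α → I → M) :
    Holds G φ (fun a => UPow.mk U (x a)) ↔ ∀ᶠ i in U, Holds F φ fun a => x a i := by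
  rw [← lholds_onFormula (p := p), lholds_uPow hS]
  simp only [lholds_onFormula]

/-- A diagonal argument. `v n` satisfies the first `n + 1` formulas; at coordinate `i` the
representative of `v (g i)` is used, where `g i` is the largest `n ≤ i` for which those formulas
hold at `i`. For each `k`, almost all `i` satisfy `k ≤ i` and `i ∈ A k`, so `k ≤ g i` and the `k`-th
formula holds there. -/
theorem saturated_uPow {U : Ultrafilter ℕ} (hU : (U : Filter ℕ) ≤ atTop) [Field (UPow U M)]
    [CharP (UPow U M) p] {G : Fin (m + 2) → Subfield (UPow U M)}
    (hS : uStr p F U = lambdaStructure p G) : Saturated G := by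
  classical
  intro ι J _ _ φ hfin
  rcases isEmpty_or_nonempty J with hJ | hJ
  · exact ⟨fun _ => 0, fun j => hJ.elim j⟩
  obtain ⟨e, he⟩ := exists_surjective_nat J
  choose v hv using fun n : ℕ => hfin ((Finset.range (n + 1)).image e)
  have hr : ∀ x : UPow U M, ∃ y : ℕ → M, UPow.mk U y = x := fun x => Quotient.exists_rep x
  choose r hr using hr
  let z : (ι → ℕ → M) → UPow U M ⊕ ι → ℕ → M := fun w => Sum.elim r w
  have hz : ∀ w : ι → ℕ → M, (fun a => UPow.mk U (z w a)) =
      Sum.elim id fun x => UPow.mk U (w x) := by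
    intro w
    funext a
    rcases a with a | a
    · exact hr a
    · rfl
  let A : ℕ → Set ℕ := fun n =>
    {i | ∀ k ≤ n, Holds F (φ (e k)) fun a => z (fun x => r (v n x)) a i}
  have hA : ∀ n, A n ∈ U := by
    intro n
    have : ∀ k ∈ Finset.range (n + 1),
        {i | Holds F (φ (e k)) fun a => z (fun x => r (v n x)) a i} ∈ (U : Filter ℕ) := by
      intro k hk
      refine (holds_uPow hS (φ (e k)) _).1 ?_
      rw [hz]
      simp only [hr]
      exact hv n _ (Finset.mem_image_of_mem e hk)
    have h1 := (Filter.biInter_finset_mem _).2 this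
    refine mem_of_superset h1 fun i hi k hk => ?_
    simp only [Set.mem_iInter] at hi
    exact hi k (Finset.mem_range.2 (Nat.lt_succ_of_le hk))
  let g : ℕ → ℕ := fun i => Nat.findGreatest (fun n => i ∈ A n) i
  let w : ι → ℕ → M := fun x i => r (v (g i) x) i
  refine ⟨fun x => UPow.mk U (w x), fun j => ?_⟩
  obtain ⟨k, rfl⟩ := he j
  rw [← hz, holds_uPow hS]
  filter_upwards [hA k, hU (Ici_mem_atTop k)] with i hi hki
  have h1 : i ∈ A (g i) := Nat.findGreatest_spec (P := fun n => i ∈ A n) hki hi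
  have h2 : k ≤ g i := Nat.le_findGreatest hki hi
  have h3 := h1 k h2
  convert h3 using 1
  funext a
  rcases a with a | a <;> rfl

end Ultrapower

/-! ### Elementary extensions and compactness -/

section Elementary

open FirstOrder.Language Filter

variable {m p : ℕ} [Fact p.Prime] {M : Type u} [Field M] [CharP M p] {F : Fin (m + 2) → Subfield M}

/-- Elementary extensions of chains with `λ`-functions. -/
structure IsElemExt (p : ℕ) [Fact p.Prime] [CharP M p] {M' : Type*} [Field M'] [CharP M' p]
    (F : Fin (m + 2) → Subfield M) (F' : Fin (m + 2) → Subfield M') (ι : M →+* M') : Prop where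
  lholds_fin : ∀ {n : ℕ} (φ : (lambdaLang p m).Formula (Fin n)) (v : Fin n → M),
    LHolds p F' φ (fun a => ι (v a)) ↔ LHolds p F φ v

variable {M' : Type w} [Field M'] [CharP M' p] {F' : Fin (m + 2) → Subfield M'} {ι : M →+* M'}

theorem lholds_congr_of_finite {N N' : Type*} [Field N] [CharP N p] [Field N'] [CharP N' p]
    {G : Fin (m + 2) → Subfield N} {G' : Fin (m + 2) → Subfield N'} {α : Type*} {v : α → N}
    {v' : α → N'}
    (h : ∀ (n : ℕ) (φ : (lambdaLang p m).Formula (Fin n)) (e : Fin n → α),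
      LHolds p G φ (v ∘ e) ↔ LHolds p G' φ (v' ∘ e))
    (φ : (lambdaLang p m).Formula α) : LHolds p G φ v ↔ LHolds p G' φ v' := by
  classical
  let s := BoundedFormula.freeVarFinset φ
  let ψ : (lambdaLang p m).Formula s := BoundedFormula.restrictFreeVar φ id
  obtain ⟨n, ⟨e⟩⟩ := Finite.exists_equiv_fin s
  have h1 : LHolds p G ψ (fun a => v a) ↔ LHolds p G φ v :=
    @BoundedFormula.realize_restrictFreeVar _ _ (lambdaStructure p G) _ _ _ _ _ _ _ _ v
      fun _ => rfl
  have h2 : LHolds p G' ψ (fun a => v' a) ↔ LHolds p G' φ v' :=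
    @BoundedFormula.realize_restrictFreeVar _ _ (lambdaStructure p G') _ _ _ _ _ _ _ _ v'
      fun _ => rfl
  have h3 := h n (ψ.relabel e) (fun i => (e.symm i : α))
  rw [lholds_relabel, lholds_relabel] at h3
  have h4 : (v ∘ fun i => (e.symm i : α)) ∘ e = fun a : s => v a := by
    funext a; simp
  have h5 : (v' ∘ fun i => (e.symm i : α)) ∘ e = fun a : s => v' a := by
    funext a; simp
  rw [h4, h5] at h3
  rw [← h1, ← h2, h3]

theorem IsElemExt.lholds (h : IsElemExt p F F' ι) {α : Type*} (φ : (lambdaLang p m).Formula α)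
    (v : α → M) : LHolds p F' φ (fun a => ι (v a)) ↔ LHolds p F φ v :=
  lholds_congr_of_finite (fun _ φ _ => h.lholds_fin φ _) φ

theorem IsElemExt.holds (h : IsElemExt p F F' ι) {α : Type*} (φ : FForm m α)
    (v : α → M) : Holds F' φ (fun a => ι (v a)) ↔ Holds F φ v := by
  rw [← lholds_onFormula (p := p), h.lholds, lholds_onFormula]

theorem IsElemExt.pIndSet (h : IsElemExt p F F' ι) (hF : IsFrobeniusChain p F)
    (hF' : IsFrobeniusChain p F') {j : Fin (m + 2)} {Z : Set M} (hZ : PIndSet p (F j) Z) :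
    PIndSet p (F' j) (ι '' Z) := by
  classical
  refine pIndSet_image fun t ht => ?_
  rw [← holds_monIndF hF', h.holds, holds_monIndF hF]
  exact hZ t ht

theorem IsElemExt.isGood (h : IsElemExt p F F' ι) (hF : IsFrobeniusChain p F)
    (hF' : IsFrobeniusChain p F') {E : Type*} [Field E] [CharP E p] {g : E →+* M}
    {X : Fin (m + 1) → Set E} (hg : IsGood p F g X) : IsGood p F' (ι.comp g) X where
  gen := hg.gen
  mem := fun j x hx => by
    have := (holds_memVar hF j.succ () (fun _ => g x)).2 (hg.mem j x hx)
    rw [← h.holds, holds_memVar hF'] at this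
    exact this
  ind := fun j => by
    rw [RingHom.coe_comp, Set.image_comp]
    exact h.pIndSet hF hF' (hg.ind j)

theorem exists_isElemExt_uPow {I : Type w} {U : Ultrafilter I} [Field (UPow U M)]
    [CharP (UPow U M) p] {G : Fin (m + 2) → Subfield (UPow U M)}
    (hS : uStr p F U = lambdaStructure p G) :
    ∃ ι : M →+* UPow U M, (∀ x, ι x = UPow.mk U fun _ => x) ∧ IsElemExt p F G ι := by
  let ι : M → UPow U M := fun x => UPow.mk U fun _ => x
  have key : ∀ {n : ℕ} (φ : (lambdaLang p m).Formula (Fin n)) (v : Fin n → M),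
      LHolds p G φ (fun a => ι (v a)) ↔ LHolds p F φ v := by
    intro n φ v
    rw [lholds_uPow hS φ fun a _ => v a, eventually_const]
  have key2 : ∀ {n : ℕ} (φ : FForm m (Fin n)) (v : Fin n → M),
      Holds G φ (fun a => ι (v a)) ↔ Holds F φ v := by
    intro n φ v
    rw [← lholds_onFormula (p := p), key, lholds_onFormula]
  have h0 : ι 0 = 0 := by
    have := (key2 (Term.equal (Term.var 0) FTerm.zero) ![0]).2 (by simp)
    rwa [holds_equal] at this
  have h1 : ι 1 = 1 := by
    have := (key2 (Term.equal (Term.var 0) FTerm.one) ![1]).2 (by simp)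
    rwa [holds_equal] at this
  have ha : ∀ x y, ι (x + y) = ι x + ι y := by
    intro x y
    have := (key2 (Term.equal (Term.var 0) (FTerm.add (Term.var 1) (Term.var 2)))
      ![x + y, x, y]).2 (by simp)
    rwa [holds_equal] at this
  have hm : ∀ x y, ι (x * y) = ι x * ι y := by
    intro x y
    have := (key2 (Term.equal (Term.var 0) (FTerm.mul (Term.var 1) (Term.var 2)))
      ![x * y, x, y]).2 (by simp)
    rwa [holds_equal] at this
  exact ⟨{ toFun := ι, map_one' := h1, map_mul' := hm, map_zero' := h0, map_add' := ha },
    fun _ => rfl, ⟨key⟩⟩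

/-- Every chain has a saturated elementary extension. -/
theorem exists_saturated_extension [IsSepClosed M] (hF : IsFrobeniusChain p F) :
    ∃ (M' : Type u) (_ : Field M') (_ : CharP M' p) (F' : Fin (m + 2) → Subfield M')
      (ι : M →+* M'), IsSepClosed M' ∧ IsFrobeniusChain p F' ∧ degrees F' = degrees F ∧
      Saturated F' ∧ IsElemExt p F F' ι := by
  obtain ⟨fld, chr, G, hsep, hG, hdeg, hS⟩ := isLambdaChainModel_uPow (U := hyperfilter ℕ) hF
  obtain ⟨ι, -, hι⟩ := exists_isElemExt_uPow hS
  exact ⟨_, fld, chr, G, ι, hsep, hG, hdeg, saturated_uPow Nat.hyperfilter_le_atTop hS, hι⟩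

/-- A finitely satisfiable set of formulas with parameters is realized in an elementary
extension. -/
theorem exists_isElemExt_realize [IsSepClosed M] (hF : IsFrobeniusChain p F) {J : Type w}
    {β : Type*} (φ : J → (lambdaLang p m).Formula (M ⊕ β))
    (hfin : ∀ s : Finset J, ∃ v : β → M, ∀ j ∈ s, LHolds p F (φ j) (Sum.elim id v)) :
    ∃ (M' : Type (max u w)) (_ : Field M') (_ : CharP M' p) (F' : Fin (m + 2) → Subfield M')
      (ι : M →+* M'), IsSepClosed M' ∧ IsFrobeniusChain p F' ∧ degrees F' = degrees F ∧
      IsElemExt p F F' ι ∧ ∃ v : β → M', ∀ j, LHolds p F' (φ j) (Sum.elim ι v) := by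
  classical
  -- An ultrafilter finer than the tail filter on finite index sets contains `{s | j ∈ s}` for every
  -- `j`, so the solutions `v s` together satisfy every `φ j` in the ultrapower.
  let U : Ultrafilter (Finset J) := Ultrafilter.of atTop
  obtain ⟨fld, chr, G, hsep, hG, hdeg, hS⟩ := isLambdaChainModel_uPow (U := U) hF
  obtain ⟨ι, hι, hιe⟩ := exists_isElemExt_uPow hS
  choose v hv using hfin
  refine ⟨_, fld, chr, G, ι, hsep, hG, hdeg, hιe,
    fun b => UPow.mk U fun s => v s b, fun j => ?_⟩
  have h1 : (Sum.elim ι fun b => UPow.mk U fun s => v s b) =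
      fun a => UPow.mk U (Sum.elim (fun x _ => x) (fun b s => v s b) a : Finset J → M) := by
    funext a
    rcases a with a | a
    · exact hι a
    · rfl
  rw [h1, lholds_uPow hS]
  have h2 : ∀ᶠ s in (U : Filter (Finset J)), j ∈ s := by
    have : ∀ᶠ s in (atTop : Filter (Finset J)), j ∈ s := by
      filter_upwards [Ici_mem_atTop ({j} : Finset J)] with s hs
      exact hs (Finset.mem_singleton_self j)
    exact Ultrafilter.of_le (atTop : Filter (Finset J)) this
  filter_upwards [h2] with s hs
  convert hv s j hs using 1
  funext a
  rcases a with a | a <;> rfl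

end Elementary

/-! ### Back and forth -/

section BackAndForth

open FirstOrder.Language

variable {m p : ℕ} [Fact p.Prime] {M : Type u} [Field M] [CharP M p] {F : Fin (m + 2) → Subfield M}

theorem IsGood.fieldFunMap_map {E : Type*} [Field E] (g : E →+* M) {n : ℕ} (f : FieldFunc n)
    (x : Fin n → E) : fieldFunMap f (fun i => g (x i)) = g (fieldFunMap f x) := by
  cases f <;> simp [fieldFunMap]

theorem IsGood.realize_term (hF : IsFrobeniusChain p F) {E : Type*} [Field E] [CharP E p]
    {g : E →+* M} {X : Fin (m + 1) → Set E} (hg : IsGood p F g X) {β : Type*}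
    (t : (lambdaLang p m).Term β) (v : β → E) :
    @Term.realize (lambdaLang p m) M (lambdaStructure p F) β (fun b => g (v b)) t =
      g (@Term.realize (lambdaLang p m) E (lambdaStructure p (levelField p X)) β v t) := by
  induction t with
  | var => rfl
  | func f ts ih =>
    simp only [Term.realize, ih]
    change lambdaFunMap p F f _ = g (lambdaFunMap p (levelField p X) f _)
    cases f with
    | field f => exact IsGood.fieldFunMap_map g f _
    | lam j e => exact hg.lambdaFun_map hF j.succ e _ _

variable {N : Type w} [Field N] [CharP N p] {G : Fin (m + 2) → Subfield N}

/-- Induction on the formula. Atomic formulas are decided inside `E`: terms are computed there, and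
the predicates cut out the level fields. At a quantifier, the new element of one chain lies in a
larger countable good field, which also embeds in the other chain because that one is saturated. -/
theorem Saturated.realize_iff [IsSepClosed M] [IsSepClosed N] (hF : IsFrobeniusChain p F)
    (hG : IsFrobeniusChain p G) (hd : degrees F = degrees G) (hsF : Saturated F)
    (hsG : Saturated G) {α : Type*} {n : ℕ} (φ : (lambdaLang p m).BoundedFormula α n) :
    ∀ (E : Type) [Field E] [CharP E p] [Countable E] (g : E →+* M) (f : E →+* N)
      (X : Fin (m + 1) → Set E), IsGood p F g X → IsGood p G f X → ∀ (v : α → E) (x : Fin n → E),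
      @BoundedFormula.Realize (lambdaLang p m) M (lambdaStructure p F) α n φ (fun a => g (v a))
        (fun i => g (x i)) ↔
      @BoundedFormula.Realize (lambdaLang p m) N (lambdaStructure p G) α n φ (fun a => f (v a))
        (fun i => f (x i)) := by
  induction φ with
  | falsum => intros; rfl
  | equal t₁ t₂ =>
    intro E _ _ _ g f X hg hf v x
    simp only [BoundedFormula.Realize]
    have h1 : (Sum.elim (fun a => g (v a)) fun i => g (x i)) = fun b => g (Sum.elim v x b) := by
      funext b; rcases b with b | b <;> rfl
    have h2 : (Sum.elim (fun a => f (v a)) fun i => f (x i)) = fun b => f (Sum.elim v x b) := by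
      funext b; rcases b with b | b <;> rfl
    rw [h1, h2, hg.realize_term hF, hg.realize_term hF, hf.realize_term hG, hf.realize_term hG,
      g.injective.eq_iff, f.injective.eq_iff]
  | rel R ts =>
    intro E _ _ _ g f X hg hf v x
    simp only [BoundedFormula.Realize]
    have h1 : (Sum.elim (fun a => g (v a)) fun i => g (x i)) = fun b => g (Sum.elim v x b) := by
      funext b; rcases b with b | b <;> rfl
    have h2 : (Sum.elim (fun a => f (v a)) fun i => f (x i)) = fun b => f (Sum.elim v x b) := by
      funext b; rcases b with b | b <;> rfl
    simp only [h1, h2, hg.realize_term hF, hf.realize_term hG]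
    cases R with
    | mem k => exact (hg.mem_iff hF).trans (hf.mem_iff hG).symm
  | imp φ ψ ih₁ ih₂ =>
    intro E _ _ _ g f X hg hf v x
    simp only [BoundedFormula.Realize]
    rw [ih₁ E g f X hg hf v x, ih₂ E g f X hg hf v x]
  | all φ ih =>
    intro E _ _ _ g f X hg hf v x
    simp only [BoundedFormula.Realize]
    constructor
    · intro h c
      obtain ⟨E₁, _, _, _, i, f₁, X₁, hf₁, hcomp, hX, c', rfl⟩ := hf.exists_extend hG c
      obtain ⟨g₁, hg₁i, hg₁⟩ := hsF.exists_isGood_extend hG hF hd.symm hX hg hf₁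
      have := (ih E₁ g₁ f₁ X₁ hg₁ hf₁ (fun a => i (v a)) (Fin.snoc (fun k => i (x k)) c')).1 (by
        convert h (g₁ c') using 1
        · funext a
          exact RingHom.congr_fun hg₁i (v a)
        · funext k
          refine Fin.lastCases ?_ (fun k => ?_) k
          · simp
          · simp only [Fin.snoc_castSucc]
            exact RingHom.congr_fun hg₁i (x k))
      convert this using 1
      · funext a
        exact (RingHom.congr_fun hcomp (v a)).symm
      · funext k
        refine Fin.lastCases ?_ (fun k => ?_) k
        · simp
        · simp only [Fin.snoc_castSucc]
          exact (RingHom.congr_fun hcomp (x k)).symm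
    · intro h c
      obtain ⟨E₁, _, _, _, i, g₁, X₁, hg₁, hcomp, hX, c', rfl⟩ := hg.exists_extend hF c
      obtain ⟨f₁, hf₁i, hf₁⟩ := hsG.exists_isGood_extend hF hG hd hX hf hg₁
      have := (ih E₁ g₁ f₁ X₁ hg₁ hf₁ (fun a => i (v a)) (Fin.snoc (fun k => i (x k)) c')).2 (by
        convert h (f₁ c') using 1
        · funext a
          exact RingHom.congr_fun hf₁i (v a)
        · funext k
          refine Fin.lastCases ?_ (fun k => ?_) k
          · simp
          · simp only [Fin.snoc_castSucc]
            exact RingHom.congr_fun hf₁i (x k))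
      convert this using 1
      · funext a
        exact (RingHom.congr_fun hcomp (v a)).symm
      · funext k
        refine Fin.lastCases ?_ (fun k => ?_) k
        · simp
        · simp only [Fin.snoc_castSucc]
          exact (RingHom.congr_fun hcomp (x k)).symm

/-- Elements of a field which is separably embedded in two chains with the same degrees satisfy the
same formulas in both. -/
theorem lholds_iff_of_isGood [IsSepClosed M] [IsSepClosed N] (hF : IsFrobeniusChain p F)
    (hG : IsFrobeniusChain p G) (hd : degrees F = degrees G) {E : Type*} [Field E] [CharP E p]
    {g : E →+* M} {f : E →+* N} {X : Fin (m + 1) → Set E} (hg : IsGood p F g X)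
    (hf : IsGood p G f X) {α : Type*} (φ : (lambdaLang p m).Formula α) (v : α → E) :
    LHolds p F φ (fun a => g (v a)) ↔ LHolds p G φ (fun a => f (v a)) := by
  refine lholds_congr_of_finite (fun n φ e => ?_) φ
  -- Saturation is gained by passing to ultrapowers, countability by passing to a countable good
  -- subfield containing the finitely many elements in question.
  obtain ⟨M', _, _, F', ι, _, hF', hdF, hsF, hι⟩ := exists_saturated_extension hF
  obtain ⟨N', _, _, G', κ, _, hG', hdG, hsG, hκ⟩ := exists_saturated_extension hG
  obtain ⟨E₀, _, _, _, i, X₀, hg₀, hf₀, hi⟩ := exists_countable_isGood (hι.isGood hF hF' hg)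
    (hκ.isGood hG hG' hf) (Set.countable_range fun k : Fin n => v (e k))
  choose x hx using fun k : Fin n => hi (v (e k)) ⟨k, rfl⟩
  have := Saturated.realize_iff hF' hG' (by rw [hdF, hdG, hd]) hsF hsG φ E₀ _ _ X₀ hg₀ hf₀ x
    default
  simp only [RingHom.coe_comp, Function.comp_apply, hx] at this
  have h1 := hι.lholds φ fun k => g (v (e k))
  have h2 := hκ.lholds φ fun k => f (v (e k))
  refine h1.symm.trans (Iff.trans ?_ h2)
  unfold LHolds Formula.Realize
  convert this

end BackAndForth

/-! ### Axiomatization -/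

section Axiomatization

open FirstOrder.Language

variable {m p : ℕ} [Fact p.Prime] {M : Type u} [Field M] [CharP M p] {F : Fin (m + 2) → Subfield M}

/-- The prime field is perfect, so the empty set is a `p`-basis of it. It is the common starting
point for the comparison of any two chains. -/
theorem isGood_zmod : IsGood p F (ZMod.castHom (dvd_refl p) M) (fun _ => ∅) where
  gen := by
    have : (frobenius (ZMod p) p).fieldRange = ⊤ :=
      RingHom.fieldRange_eq_top_iff.2 fun x => ⟨x, by rw [frobenius_def, ZMod.pow_card]⟩
    rw [this, top_sup_eq]
  mem := by simp
  ind := fun j => by rw [Set.image_empty]; exact pIndSet_empty _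

variable {N : Type w} [Field N] [CharP N p] {G : Fin (m + 2) → Subfield N}

theorem lholds_sentence_iff [IsSepClosed M] [IsSepClosed N] (hF : IsFrobeniusChain p F)
    (hG : IsFrobeniusChain p G) (hd : degrees F = degrees G) (φ : (lambdaLang p m).Sentence) :
    LHolds p F φ default ↔ LHolds p G φ default := by
  have := lholds_iff_of_isGood hF hG hd isGood_zmod isGood_zmod φ default
  convert this using 2

theorem realize_chainTheory_iff [IsSepClosed M] (hF : IsFrobeniusChain p F) (N : Type*)
    [S : (chainLang m).Structure N] : N ⊨ chainTheory F ↔ IsChainModel p (degrees F) N := by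
  refine ⟨isChainModel_of_realize hF N, ?_⟩
  rintro ⟨_, _, G, _, hG, hd, rfl⟩
  refine @Theory.Model.mk _ _ (_) _ fun φ hφ => ?_
  rw [chainTheory, @mem_completeTheory] at hφ
  have h1 : LHolds p F ((toLambda p m).onFormula φ) default := (lholds_onFormula φ _).2 hφ
  rw [lholds_sentence_iff hF hG hd.symm] at h1
  exact (lholds_onFormula φ _).1 h1

theorem realize_lambdaTheory_iff [IsSepClosed M] (hF : IsFrobeniusChain p F) (N : Type*)
    [S : (lambdaLang p m).Structure N] :
    N ⊨ lambdaTheory p F ↔ IsLambdaChainModel p (degrees F) N := by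
  refine ⟨isLambdaChainModel_of_realize hF N, ?_⟩
  rintro ⟨_, _, G, _, hG, hd, rfl⟩
  refine @Theory.Model.mk _ _ (_) _ fun φ hφ => ?_
  rw [lambdaTheory, @mem_completeTheory] at hφ
  exact (lholds_sentence_iff hF hG hd.symm φ).1 hφ

end Axiomatization

/-! ### Fields closed under `λ`-functions -/

section LamClosed

variable {m p : ℕ} [Fact p.Prime] {M : Type u} [Field M] [CharP M p] {F : Fin (m + 2) → Subfield M}
  {E : Type*} [Field E] [CharP E p] {g : E →+* M}

/-- The image of an embedding is closed under the `λ`-functions of a chain. -/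
def LamClosed (p : ℕ) [Fact p.Prime] [CharP M p] (F : Fin (m + 2) → Subfield M) (g : E →+* M) :
    Prop :=
  ∀ (j : Fin (m + 1)) {n : ℕ} (e : Fin n → Fin p) (a : Fin n → E) (b : E),
    lambdaFun p (F j.succ) e (fun i => g (a i)) (g b) ∈ g.fieldRange

theorem LamClosed.exists_coeff (h : LamClosed p F g) {j : Fin (m + 1)} {n : ℕ} {a : Fin n → E}
    {b : E} {c : (Fin n → Fin p) → M} (ha : PIndependent p (F j.succ) fun i => g (a i))
    (hc : IsExpansion p (F j.succ) (fun i => g (a i)) (g b) c) (e : Fin n → Fin p) :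
    ∃ d, g d = c e := by
  have := h j e a b
  rwa [lambdaFun_eq ha hc] at this

theorem pPowers_top (hF : IsFrobeniusChain p F) : pPowers p (F (Fin.last m).succ) = F 0 := by
  rw [hF.zero, Fin.succ_last, hF.last, pPowers, ← RingHom.fieldRange_eq_map]

/-- For the empty tuple, the `λ`-function of the whole field is the `p`-th root on `M ^ p`. -/
theorem LamClosed.comap_zero (hF : IsFrobeniusChain p F) (h : LamClosed p F g) :
    (F 0).comap g = (frobenius E p).fieldRange := by
  ext x
  rw [Subfield.mem_comap, hF.zero]
  constructor
  · rintro ⟨y, hy⟩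
    rw [frobenius_def] at hy
    have hind : PIndependent p (F (Fin.last m).succ) fun i : Fin 0 => g (Fin.elim0 i) :=
      pIndependent_iff.2 ⟨fun i => i.elim0, monIndep_of_isEmpty _ _⟩
    have hexp : IsExpansion p (F (Fin.last m).succ) (fun i : Fin 0 => g (Fin.elim0 i)) (g x)
        fun _ => y := by
      refine ⟨fun _ => ?_, by simp [hy]⟩
      rw [Fin.succ_last, hF.last]
      trivial
    obtain ⟨d, hd⟩ := h.exists_coeff hind hexp Fin.elim0
    refine ⟨d, g.injective ?_⟩
    rw [frobenius_def, map_pow, hd, hy]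
  · rintro ⟨y, rfl⟩
    exact ⟨g y, by simp [frobenius_def]⟩

theorem LamClosed.isFrobeniusChain (hF : IsFrobeniusChain p F) (h : LamClosed p F g) :
    IsFrobeniusChain p fun j => (F j).comap g where
  zero := h.comap_zero hF
  mono := fun i j hij x hx => hF.mono hij hx
  last := by
    rw [hF.last]
    rfl

/-- The coefficients are computed by `λ`-functions. Over `F 0 = M ^ p` they are `p`-th powers of
values for the whole field. Over a level `k = F j.succ`, Frobenius is applied first: the `a i ^ p`
are `p`-independent in `k`, and the `λ`-values of `b ^ p` at them are exactly the coefficients of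
`b` at `a`. -/
theorem LamClosed.exists_expansion (hF : IsFrobeniusChain p F) (h : LamClosed p F g)
    {j : Fin (m + 2)} {n : ℕ} {a : Fin n → E} {b : E}
    (ha : MonIndep p (F j) fun i => g (a i))
    (hb : g b ∈ F j ⊔ Subfield.closure (Set.range fun i => g (a i))) :
    ∃ c : (Fin n → Fin p) → E, (∀ e, g (c e) ∈ F j) ∧ b = ∑ e, c e * pMon p a e := by
  obtain ⟨c, hc, hbc⟩ := exists_sum_pMon_of_mem (fun i => hF.pow_mem j _) hb
  suffices hd : ∃ d : (Fin n → Fin p) → E, ∀ e, g (d e) = c e by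
    obtain ⟨d, hd⟩ := hd
    refine ⟨d, fun e => hd e ▸ hc e, g.injective ?_⟩
    rw [hbc]
    simp [map_pMon, hd]
  induction j using Fin.cases with
  | zero =>
    choose r hr using fun e => mem_pPowers.1 ((pPowers_top hF).symm ▸ hc e)
    have hind : PIndependent p (F (Fin.last m).succ) fun i => g (a i) := by
      refine pIndependent_iff.2 ⟨fun i => ?_, by rwa [pPowers_top hF]⟩
      rw [Fin.succ_last, hF.last]
      trivial
    have hexp : IsExpansion p (F (Fin.last m).succ) (fun i => g (a i)) (g b) r := by
      refine isExpansion_iff.2 ⟨fun e => (hr e).1, ?_⟩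
      simp only [hr]
      exact hbc
    choose d hd using fun e => h.exists_coeff hind hexp e
    exact ⟨fun e => d e ^ p, fun e => by rw [map_pow, hd, (hr e).2]⟩
  | succ j =>
    have hpow : ∀ e, pMon p (fun i => g (a i) ^ p) e = pMon p (fun i => g (a i)) e ^ p := by
      intro e
      simp only [pMon, ← Finset.prod_pow]
      exact Finset.prod_congr rfl fun i _ => pow_right_comm _ _ _
    have hind : PIndependent p (F j.succ) fun i => g (a i ^ p) := by
      refine pIndependent_iff.2 ⟨fun i => by rw [map_pow]; exact hF.pow_mem _ _, ?_⟩
      have := SepClosedChain.pow_linearIndependent ha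
      simp only [← hpow] at this
      simp only [map_pow]
      exact this
    have hexp : IsExpansion p (F j.succ) (fun i => g (a i ^ p)) (g (b ^ p)) c := by
      refine isExpansion_iff.2 ⟨hc, ?_⟩
      simp only [map_pow, hpow, ← mul_pow]
      rw [hbc, ← frobenius_def, map_sum]
      rfl
    choose d hd using fun e => h.exists_coeff hind hexp e
    exact ⟨d, hd⟩

/-- If the last element depended on the others over `F j`, `LamClosed.exists_expansion` would write
it with coefficients from `E`, so the dependence would be visible over `F j ∩ E`. -/
theorem LamClosed.monIndep_fin (hF : IsFrobeniusChain p F) (h : LamClosed p F g) (j : Fin (m + 2))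
    (n : ℕ) : ∀ x : Fin n → E, MonIndep p ((F j).comap g) x → MonIndep p (F j) fun i => g (x i) := by
  induction n with
  | zero => intro x _; exact monIndep_of_isEmpty _ _
  | succ n ih =>
    intro x hx
    rw [← monIndep_comp_equiv finSuccEquivLast.symm,
      monIndep_option fun i => (h.isFrobeniusChain hF).pow_mem j _] at hx
    rw [← monIndep_comp_equiv finSuccEquivLast.symm, monIndep_option fun i => hF.pow_mem j _]
    refine ⟨ih _ hx.1, fun hmem => hx.2 ?_⟩
    obtain ⟨c, hc, hb⟩ := h.exists_expansion hF (ih _ hx.1) hmem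
    rw [Function.comp_apply, hb]
    exact sum_pMon_mem_sup (k := (F j).comap g) hc

theorem LamClosed.pIndSet (hF : IsFrobeniusChain p F) (h : LamClosed p F g) {j : Fin (m + 2)}
    {Z : Set E} (hZ : PIndSet p ((F j).comap g) Z) : PIndSet p (F j) (g '' Z) := by
  refine pIndSet_image fun t ht => ?_
  obtain ⟨n, ⟨e⟩⟩ := Finite.exists_equiv_fin t
  have := h.monIndep_fin hF j n (fun i => e.symm i)
    ((monIndep_comp_equiv e.symm).2 (hZ t ht))
  exact (monIndep_comp_equiv (a := fun x : t => g x) e.symm).1 this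

variable {N : Type w} [Field N] [CharP N p] {G : Fin (m + 2) → Subfield N} {f : E →+* N}

/-- The traces of the chain on `E` form a chain on `E`, the same for both embeddings: at level zero
it is `E ^ p`, in the middle `hrel` identifies the two, and at the top it is `E`. A divided
`p`-basis of this chain stays independent in both ambient chains. -/
theorem LamClosed.exists_isGood (hF : IsFrobeniusChain p F) (hG : IsFrobeniusChain p G)
    (hg : LamClosed p F g) (hf : LamClosed p G f)
    (hrel : ∀ (k : Fin m) (x : E), g x ∈ F k.castSucc.succ ↔ f x ∈ G k.castSucc.succ) :
    ∃ X, IsGood p F g X ∧ IsGood p G f X := by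
  have hcomap : ∀ j, (F j).comap g = (G j).comap f := by
    intro j
    induction j using Fin.cases with
    | zero => rw [hg.comap_zero hF, hf.comap_zero hG]
    | succ i =>
      induction i using Fin.lastCases with
      | last => rw [Fin.succ_last, hF.last, hG.last]; rfl
      | cast k => ext x; exact hrel k x
  obtain ⟨X, -, hX⟩ := exists_isGood_id (hg.isFrobeniusChain hF) (Z := fun _ => ∅) (by simp)
    fun j => pIndSet_empty _
  have hind : ∀ j : Fin (m + 1), PIndSet p ((F j.castSucc).comap g) (X j) := fun j => by
    simpa using hX.ind j
  refine ⟨X, ⟨hX.gen, fun j x hx => hX.mem j x hx, fun j => hg.pIndSet hF (hind j)⟩,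
    ⟨hX.gen, fun j x hx => ?_, fun j => hf.pIndSet hG (hcomap _ ▸ hind j)⟩⟩
  have : x ∈ (F j.succ).comap g := hX.mem j x hx
  rw [hcomap] at this
  exact this

end LamClosed

/-! ### Quantifier elimination -/

section QuantifierElimination

open FirstOrder.Language

variable {m p : ℕ} [Fact p.Prime] {M : Type u} [Field M] [CharP M p] {F : Fin (m + 2) → Subfield M}

/-- The value of a term in a chain with its `λ`-functions. -/
noncomputable def lval (p : ℕ) [Fact p.Prime] [CharP M p] (F : Fin (m + 2) → Subfield M) {α : Type*}
    (t : (lambdaLang p m).Term α) (v : α → M) : M :=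
  @Term.realize (lambdaLang p m) M (lambdaStructure p F) α v t

variable {α : Type*}

theorem lval_func {n : ℕ} (f : LambdaFunc p m n) (t : Fin n → (lambdaLang p m).Term α) (v : α → M) :
    lval p F (Term.func (L := lambdaLang p m) f t) v = lambdaFunMap p F f fun i => lval p F (t i) v :=
  rfl

theorem lval_field₂ (f : FieldFunc 2) (t s : (lambdaLang p m).Term α) (v : α → M) :
    lval p F (Term.func (L := lambdaLang p m) (LambdaFunc.field f) ![t, s]) v =
      fieldFunMap f ![lval p F t v, lval p F s v] := by
  rw [lval_func]
  refine congrArg (fieldFunMap f) (funext fun i => ?_)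
  fin_cases i <;> rfl

theorem lval_field₁ (f : FieldFunc 1) (t : (lambdaLang p m).Term α) (v : α → M) :
    lval p F (Term.func (L := lambdaLang p m) (LambdaFunc.field f) ![t]) v =
      fieldFunMap f ![lval p F t v] := by
  rw [lval_func]
  refine congrArg (fieldFunMap f) (funext fun i => ?_)
  fin_cases i; rfl

theorem lval_field₀ (f : FieldFunc 0) (v : α → M) :
    lval p F (Term.func (L := lambdaLang p m) (LambdaFunc.field f) ![]) v =
      fieldFunMap f ![] := by
  rw [lval_func]
  exact congrArg (fieldFunMap f) (Subsingleton.elim _ _)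

variable (p F) in
/-- The subfield of values of terms at a tuple. -/
noncomputable def termField (v : α → M) : Subfield M where
  carrier := Set.range fun t : (lambdaLang p m).Term α => lval p F t v
  mul_mem' := by
    rintro _ _ ⟨t, rfl⟩ ⟨s, rfl⟩
    exact ⟨_, lval_field₂ FieldFunc.mul t s v⟩
  one_mem' := ⟨_, lval_field₀ FieldFunc.one v⟩
  add_mem' := by
    rintro _ _ ⟨t, rfl⟩ ⟨s, rfl⟩
    exact ⟨_, lval_field₂ FieldFunc.add t s v⟩
  zero_mem' := ⟨_, lval_field₀ FieldFunc.zero v⟩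
  neg_mem' := by
    rintro _ ⟨t, rfl⟩
    exact ⟨_, lval_field₁ FieldFunc.neg t v⟩
  inv_mem' := by
    rintro _ ⟨t, rfl⟩
    exact ⟨_, lval_field₁ FieldFunc.inv t v⟩

theorem lval_lam (j : Fin (m + 1)) {n : ℕ} (e : Fin n → Fin p)
    (t : Fin n → (lambdaLang p m).Term α) (s : (lambdaLang p m).Term α) (v : α → M) :
    lval p F (Term.func (L := lambdaLang p m) (LambdaFunc.lam j e) (Fin.snoc t s)) v =
      lambdaFun p (F j.succ) e (fun i => lval p F (t i) v) (lval p F s v) := by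
  rw [lval_func]
  simp only [lambdaFunMap, Fin.snoc_last]
  congr 1
  funext i
  simp [Fin.init]

theorem lholds_equal (t s : (lambdaLang p m).Term α) (v : α → M) :
    LHolds p F (Term.equal t s) v ↔ lval p F t v = lval p F s v :=
  @Formula.realize_equal _ _ (lambdaStructure p F) _ _ _ _

theorem lholds_rel (k : Fin m) (t : (lambdaLang p m).Term α) (v : α → M) :
    LHolds p F (Relations.formula (L := lambdaLang p m) (ChainRel.mem k) ![t]) v ↔
      lval p F t v ∈ F k.castSucc.succ :=
  @Formula.realize_rel (lambdaLang p m) M (lambdaStructure p F) _ _ 1 (ChainRel.mem k) _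

theorem isQF_equal (t s : (lambdaLang p m).Term α) :
    BoundedFormula.IsQF (Term.equal t s) :=
  (BoundedFormula.IsAtomic.equal _ _).isQF

theorem isQF_rel (k : Fin m) (t : (lambdaLang p m).Term α) :
    BoundedFormula.IsQF (Relations.formula (L := lambdaLang p m) (ChainRel.mem k) ![t]) :=
  (BoundedFormula.IsAtomic.rel _ _).isQF

variable {N : Type w} [Field N] [CharP N p] {G : Fin (m + 2) → Subfield N}

/-- Tuples with the same quantifier-free type satisfy the same formulas. -/
theorem lholds_iff_of_isQF [IsSepClosed M] [IsSepClosed N] (hF : IsFrobeniusChain p F)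
    (hG : IsFrobeniusChain p G) (hd : degrees F = degrees G) {a : α → M} {b : α → N}
    (hqf : ∀ θ : (lambdaLang p m).Formula α, BoundedFormula.IsQF θ →
      (LHolds p F θ a ↔ LHolds p G θ b)) (φ : (lambdaLang p m).Formula α) :
    LHolds p F φ a ↔ LHolds p G φ b := by
  have heq : ∀ t s : (lambdaLang p m).Term α, lval p F t a = lval p F s a ↔
      lval p G t b = lval p G s b := fun t s => by
    simpa only [lholds_equal] using hqf _ (isQF_equal t s)
  let E := termField p F a
  choose τ hτ using fun x : E => x.2
  -- The map `t(a) ↦ t(b)` on values of terms; it is well defined because equality of two terms is a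
  -- quantifier-free condition.
  let f₀ : E → N := fun x => lval p G (τ x) b
  have hf₀ : ∀ (t : (lambdaLang p m).Term α) (x : E), (x : M) = lval p F t a →
      f₀ x = lval p G t b := fun t x hx => (heq _ _).1 ((hτ x).trans hx)
  have hadd : ∀ x y, f₀ (x + y) = f₀ x + f₀ y := fun x y => by
    rw [hf₀ (Term.func (L := lambdaLang p m) (LambdaFunc.field FieldFunc.add) ![τ x, τ y]) (x + y),
      lval_field₂]
    · rfl
    · rw [lval_field₂]
      exact congrArg₂ (· + ·) (hτ x).symm (hτ y).symm
  have hmul : ∀ x y, f₀ (x * y) = f₀ x * f₀ y := fun x y => by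
    rw [hf₀ (Term.func (L := lambdaLang p m) (LambdaFunc.field FieldFunc.mul) ![τ x, τ y]) (x * y),
      lval_field₂]
    · rfl
    · rw [lval_field₂]
      exact congrArg₂ (· * ·) (hτ x).symm (hτ y).symm
  have hzero : f₀ 0 = 0 := by
    rw [hf₀ (Term.func (L := lambdaLang p m) (LambdaFunc.field FieldFunc.zero) ![]) 0, lval_field₀]
    · rfl
    · rw [lval_field₀]; rfl
  have hone : f₀ 1 = 1 := by
    rw [hf₀ (Term.func (L := lambdaLang p m) (LambdaFunc.field FieldFunc.one) ![]) 1, lval_field₀]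
    · rfl
    · rw [lval_field₀]; rfl
  let f : E →+* N :=
    { toFun := f₀, map_one' := hone, map_mul' := hmul, map_zero' := hzero, map_add' := hadd }
  have hf : ∀ (t : (lambdaLang p m).Term α) (x : E), (x : M) = lval p F t a →
      f x = lval p G t b := hf₀
  have hgc : LamClosed p F E.subtype := by
    intro j n e c d
    refine ⟨⟨lambdaFun p (F j.succ) e (fun i => (c i : M)) d, ?_⟩, rfl⟩
    refine ⟨Term.func (L := lambdaLang p m) (LambdaFunc.lam j e)
      (Fin.snoc (fun i => τ (c i)) (τ d)), (lval_lam ..).trans ?_⟩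
    have h1 : ∀ x : E, lval p F (τ x) a = x := hτ
    simp only [h1]
  have hfc : LamClosed p G f := by
    intro j n e c d
    let t : (lambdaLang p m).Term α := Term.func (L := lambdaLang p m) (LambdaFunc.lam j e)
      (Fin.snoc (fun i => τ (c i)) (τ d))
    refine ⟨⟨lval p F t a, t, rfl⟩, ?_⟩
    rw [hf t _ rfl, lval_lam]
    rfl
  obtain ⟨X, hX, hX'⟩ := hgc.exists_isGood hF hG hfc fun k x => by
    have h1 := hqf _ (isQF_rel k (τ x))
    rw [lholds_rel, lholds_rel] at h1
    have h2 : lval p F (τ x) a = x := hτ x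
    rw [h2] at h1
    exact h1
  have := lholds_iff_of_isGood hF hG hd hX hX' φ fun i => ⟨a i, Term.var i, rfl⟩
  have h1 : (fun i => f ⟨a i, Term.var i, rfl⟩) = b := funext fun i => hf (Term.var i) _ rfl
  rw [h1] at this
  exact this

theorem isQF_iInf {L : FirstOrder.Language.{0, 0}} {β γ : Type*} [Finite β] {φ : β → L.Formula γ}
    (h : ∀ b, BoundedFormula.IsQF (φ b)) : BoundedFormula.IsQF (Formula.iInf φ) := by
  simp only [Formula.iInf, BoundedFormula.iInf]
  generalize Finset.toList _ = l
  induction l with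
  | nil => exact BoundedFormula.IsQF.top
  | cons a l ih => exact (h a).inf ih

theorem isQF_iSup {L : FirstOrder.Language.{0, 0}} {β γ : Type*} [Finite β] {φ : β → L.Formula γ}
    (h : ∀ b, BoundedFormula.IsQF (φ b)) : BoundedFormula.IsQF (Formula.iSup φ) := by
  simp only [Formula.iSup, BoundedFormula.iSup]
  generalize Finset.toList _ = l
  induction l with
  | nil => exact BoundedFormula.isQF_bot
  | cons a l ih => exact (h a).sup ih

/-- Compactness: otherwise `φ(x) ∧ ¬ φ(y)` together with `θ(x) ↔ θ(y)` for all quantifier-free `θ`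
would be finitely satisfiable, hence realized in an elementary extension, against
`lholds_iff_of_isQF`. -/
theorem exists_finset_isQF [IsSepClosed M] (hF : IsFrobeniusChain p F) {n : ℕ}
    (φ : (lambdaLang p m).Formula (Fin n)) :
    ∃ s : Finset {θ : (lambdaLang p m).Formula (Fin n) // BoundedFormula.IsQF θ},
      ∀ a b : Fin n → M, (∀ θ ∈ s, LHolds p F θ.1 a ↔ LHolds p F θ.1 b) →
        LHolds p F φ a → LHolds p F φ b := by
  classical
  by_contra hcon
  push Not at hcon
  let Θ := {θ : (lambdaLang p m).Formula (Fin n) // BoundedFormula.IsQF θ}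
  let x : Fin n → M ⊕ (Fin n ⊕ Fin n) := fun i => Sum.inr (Sum.inl i)
  let y : Fin n → M ⊕ (Fin n ⊕ Fin n) := fun i => Sum.inr (Sum.inr i)
  let ψ : Option Θ → (lambdaLang p m).Formula (M ⊕ (Fin n ⊕ Fin n)) := fun o =>
    o.elim (φ.relabel x ⊓ Formula.not (φ.relabel y))
      fun θ => Formula.iff (θ.1.relabel x) (θ.1.relabel y)
  obtain ⟨M', _, _, F', ι, _, hF', hd, -, v, hv⟩ := exists_isElemExt_realize hF ψ (by
    intro s
    obtain ⟨a, b, h1, h2, h3⟩ := hcon s.eraseNone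
    refine ⟨Sum.elim a b, fun o ho => ?_⟩
    cases o with
    | none =>
      refine (lholds_inf _ _ _).2 ⟨(lholds_relabel _ _ _).2 h2, ?_⟩
      rw [lholds_not, lholds_relabel]
      exact h3
    | some θ =>
      refine (lholds_iff _ _ _).2 ?_
      rw [lholds_relabel, lholds_relabel]
      exact h1 θ (Finset.mem_eraseNone.2 ho))
  have h1 := (lholds_inf _ _ _).1 (hv none)
  rw [lholds_not, lholds_relabel, lholds_relabel] at h1
  refine h1.2 ((lholds_iff_of_isQF hF' hF' rfl (fun θ hθ => ?_) φ).1 h1.1)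
  have h2 := (lholds_iff _ _ _).1 (hv (some ⟨θ, hθ⟩))
  rwa [lholds_relabel, lholds_relabel] at h2

theorem eliminatesQuantifiers [IsSepClosed M] (hF : IsFrobeniusChain p F) :
    EliminatesQuantifiers (lambdaTheory p F) := by
  classical
  intro n φ
  obtain ⟨s, hs⟩ := exists_finset_isQF hF φ
  -- The truth patterns of the formulas in `s` at tuples satisfying `φ`. There are finitely many,
  -- and `ψ` is the disjunction of their descriptions.
  let B := {ε : s → Bool // ∃ a, LHolds p F φ a ∧ ∀ θ : s, LHolds p F θ.1.1 a ↔ ε θ = true}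
  let χ : B → s → (lambdaLang p m).Formula (Fin n) := fun ε θ =>
    if ε.1 θ = true then θ.1.1 else Formula.not θ.1.1
  have hχ : ∀ (ε : B) (θ : s) (b : Fin n → M),
      LHolds p F (χ ε θ) b ↔ (LHolds p F θ.1.1 b ↔ ε.1 θ = true) := by
    intro ε θ b
    by_cases h : ε.1 θ = true
    · simp [χ, h]
    · simp [χ, h, lholds_not]
  let ψ : (lambdaLang p m).Formula (Fin n) := Formula.iSup fun ε : B => Formula.iInf (χ ε)
  refine ⟨ψ, isQF_iSup fun ε => isQF_iInf fun θ => ?_, ?_⟩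
  · by_cases h : ε.1 θ = true
    · simpa only [χ, h, if_true] using θ.1.2
    · simp only [χ, h]
      exact θ.1.2.not
  · intro N v xs
    have h1 : (Formula.iff φ ψ).Realize v := realize_of_forall_lholds (F := F) N.is_model _ (fun b => by
      rw [lholds_iff, lholds_iSup]
      simp only [lholds_iInf, hχ]
      constructor
      · intro hb
        exact ⟨⟨fun θ => decide (LHolds p F θ.1.1 b), b, hb, by simp⟩, by simp⟩
      · rintro ⟨⟨ε, a, ha, hε⟩, hb⟩
        exact hs a b (fun θ hθ => (hε ⟨θ, hθ⟩).trans (hb ⟨θ, hθ⟩).symm) ha) v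
    rw [Subsingleton.elim xs default]
    exact h1

end QuantifierElimination

/-! ### Types and their realizations -/

section Types

open FirstOrder.Language

variable {L : FirstOrder.Language.{0, 0}} {M : Type w} [L.Structure M] [Nonempty M] {A : Set M}
  {n : ℕ}

/-- Sentences with constants for parameters and variables as formulas. -/
def typeCode (L : FirstOrder.Language.{0, 0}) {M : Type w} (A : Set M) (n : ℕ) :
    (L[[A]][[Fin n]]).Sentence ≃ L.Formula (A ⊕ Fin n) :=
  Formula.equivSentence.symm.trans BoundedFormula.constantsVarsEquiv

/-- The type is realized in some model of the complete theory of `M` with constants for `A`. The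
existential closure of a finite conjunction from it is a sentence true there, hence true in `M`. -/
theorem exists_realize_of_finset (q : TypeSpace (L := L) A n) (s : Finset (L.Formula (A ⊕ Fin n)))
    (hs : ∀ φ ∈ s, (typeCode L A n).symm φ ∈ q) :
    ∃ v : Fin n → M, ∀ φ ∈ s, φ.Realize (Sum.elim (fun a : A => (a : M)) v) := by
  obtain ⟨N, u, hu⟩ := Theory.exists_modelType_is_realized_in _ q
  let χ : L.Formula (A ⊕ Fin n) → L[[A]].Formula (Fin n) := BoundedFormula.constantsVarsEquiv.symm
  have h1 : ∀ φ ∈ s, (χ φ).Realize u := by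
    intro φ hφ
    have := hs φ hφ
    rw [← hu, Theory.CompleteType.mem_typeOf] at this
    simpa [typeCode] using this
  let σ : L[[A]].Sentence := Formula.iExs (Fin n) (Formula.iInf fun φ : s =>
    (χ φ).relabel (Sum.inr : Fin n → Empty ⊕ Fin n))
  have hN : N ⊨ σ := by
    refine (Formula.realize_iExs (L := L[[A]])).2 ⟨u, ?_⟩
    rw [Formula.realize_iInf]
    intro φ
    rw [Formula.realize_relabel]
    exact h1 φ φ.2
  have hM : M ⊨ σ := by
    by_contra hcon
    have hmem : Formula.not σ ∈ L[[A]].completeTheory M := by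
      rw [mem_completeTheory]
      exact hcon
    exact (N.is_model.realize_of_mem _ hmem) hN
  obtain ⟨v, hv⟩ := (Formula.realize_iExs (L := L[[A]])).1 hM
  rw [Formula.realize_iInf] at hv
  refine ⟨v, fun φ hφ => ?_⟩
  have h2 := hv ⟨φ, hφ⟩
  rw [Formula.realize_relabel] at h2
  have h3 := (BoundedFormula.realize_constantsVarsEquiv (φ := χ φ) (v := v) (xs := default)).2 h2
  simp only [χ, Equiv.apply_symm_apply] at h3
  exact h3

theorem typeSpace_ext {q q' : TypeSpace (L := L) A n}
    (h : ∀ φ, (typeCode L A n).symm φ ∈ q ↔ (typeCode L A n).symm φ ∈ q') : q = q' := by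
  refine SetLike.ext fun ψ => ?_
  simpa using h (typeCode L A n ψ)

theorem not_mem_typeSpace_iff (q : TypeSpace (L := L) A n) (φ : L.Formula (A ⊕ Fin n)) :
    (typeCode L A n).symm (Formula.not φ) ∈ q ↔ (typeCode L A n).symm φ ∉ q :=
  q.not_mem_iff _

end Types

/-! ### Counting ideals, and embeddings from ideals of relations -/

section Ideals

open MvPolynomial

/-- Ideals of a noetherian ring are spanned by finite lists, of which there are few. -/
theorem mk_ideal_le {R : Type w} [CommRing R] [IsNoetherianRing R] (hR : #R ≤ 𝔠) :
    #(Ideal R) ≤ 𝔠 := by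
  have h1 : Function.Surjective fun l : List R => Ideal.span {x | x ∈ l} := fun I => by
    obtain ⟨s, hs⟩ := (isNoetherianRing_iff_ideal_fg R).1 inferInstance I
    refine ⟨s.toList, ?_⟩
    simp only [Finset.mem_toList]
    exact hs
  exact (mk_le_of_surjective h1).trans ((mk_list_le_max R).trans (max_le aleph0_le_continuum hR))

/-- An ideal of a polynomial ring in countably many variables is determined by its restrictions to
finitely many variables. -/
theorem injective_comap_rename (k : Type*) [Field k] :
    Function.Injective fun (I : Ideal (MvPolynomial ℕ k)) (n : ℕ) =>
      I.comap (rename (R := k) (fun i : Fin n => (i : ℕ))).toRingHom := by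
  have key : ∀ f : MvPolynomial ℕ k, ∃ (n : ℕ) (g : MvPolynomial (Fin n) k),
      rename (fun i : Fin n => (i : ℕ)) g = f := by
    intro f
    obtain ⟨s, g, rfl⟩ := exists_finset_rename f
    obtain ⟨N, hN⟩ := s.bddAbove
    refine ⟨N + 1, rename (fun i : s => (⟨i, Nat.lt_succ_of_le (hN i.2)⟩ : Fin (N + 1))) g, ?_⟩
    rw [rename_rename]
    rfl
  intro I J h
  ext f
  obtain ⟨n, g, rfl⟩ := key f
  have := congrFun h n
  exact (SetLike.ext_iff.1 this g)

theorem mk_ideal_mvPolynomial_nat_le {k : Type w} [Field k] (hk : #k ≤ 𝔠) :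
    #(Ideal (MvPolynomial ℕ k)) ≤ 𝔠 := by
  refine (mk_le_of_injective (injective_comap_rename k)).trans ?_
  have h1 : ∀ n : ℕ, #(Ideal (MvPolynomial (Fin n) k)) ≤ 𝔠 := by
    intro n
    refine mk_ideal_le ?_
    refine (MvPolynomial.cardinalMk_le_max_lift (σ := Fin n) (R := k)).trans ?_
    simp only [lift_uzero]
    refine max_le (max_le hk ?_) aleph0_le_continuum
    simpa using (nat_lt_continuum n).le
  rw [mk_pi]
  refine (prod_le_prod _ (fun _ => 𝔠) h1).trans ?_
  simp

open scoped IntermediateField.algebraAdjoinAdjoin in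
theorem exists_algHom_of_ker_eq {ι k K N : Type*} [Field k] [Field K] [Field N] [Algebra k K]
    [Algebra k N] {x : ι → K} {y : ι → N}
    (h : RingHom.ker (aeval (R := k) x) = RingHom.ker (aeval (R := k) y)) :
    ∃ θ : IntermediateField.adjoin k (Set.range x) →ₐ[k] N,
      ∀ i, θ ⟨x i, IntermediateField.subset_adjoin k _ ⟨i, rfl⟩⟩ = y i := by
  let q : (MvPolynomial ι k ⧸ RingHom.ker (aeval (R := k) x)) →ₐ[k] N :=
    Ideal.Quotient.liftₐ _ (aeval y) fun a ha => by rwa [h] at ha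
  have hq : Function.Injective q := by
    rw [injective_iff_map_eq_zero]
    intro a ha
    obtain ⟨a, rfl⟩ := Ideal.Quotient.mk_surjective a
    have : a ∈ RingHom.ker (aeval (R := k) y) := ha
    rw [← h] at this
    exact Ideal.Quotient.eq_zero_iff_mem.2 this
  let e₁ : (MvPolynomial ι k ⧸ RingHom.ker (aeval (R := k) x)) ≃ₐ[k] (aeval (R := k) x).range :=
    Ideal.quotientKerEquivRange (aeval (R := k) x)
  let e₂ : (aeval (R := k) x).range ≃ₐ[k] Algebra.adjoin k (Set.range x) :=
    Subalgebra.equivOfEq _ _ (Algebra.adjoin_range_eq_range_aeval k x).symm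
  let g : Algebra.adjoin k (Set.range x) →ₐ[k] N := q.comp ((e₁.trans e₂).symm : _ →ₐ[k] _)
  have hg : Function.Injective g := hq.comp (e₁.trans e₂).symm.injective
  refine ⟨IsFractionRing.liftAlgHom hg, fun i => ?_⟩
  have h1 : (⟨x i, IntermediateField.subset_adjoin k _ ⟨i, rfl⟩⟩ :
      IntermediateField.adjoin k (Set.range x)) =
      algebraMap (Algebra.adjoin k (Set.range x)) _
        (e₁.trans e₂ (Ideal.Quotient.mk _ (X i))) := by
    apply Subtype.ext
    change x i = aeval (R := k) x (X i)
    rw [aeval_X]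
  rw [h1, IsFractionRing.liftAlgHom_apply, IsFractionRing.lift_algebraMap]
  change q ((e₁.trans e₂).symm (e₁.trans e₂ (Ideal.Quotient.mk _ (X i)))) = y i
  rw [AlgEquiv.symm_apply_apply]
  change aeval y (X i) = y i
  rw [aeval_X]

end Ideals

/-! ### Stability -/

section Stability

open FirstOrder.Language

variable {m p : ℕ} [Fact p.Prime] {M : Type w} [Field M] [CharP M p] {F : Fin (m + 2) → Subfield M}

theorem exists_small_isGood (hF : IsFrobeniusChain p F) {A : Set M} (hA : #A ≤ 𝔠) :
    ∃ (M₀ : Subfield M) (X₀ : Fin (m + 1) → Set M₀), A ⊆ M₀ ∧ #M₀ ≤ 𝔠 ∧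
      IsGood p F M₀.subtype X₀ := by
  obtain ⟨C, X', hAC, hcard, hX'C, hmem, hind, hgen⟩ :=
    (isGood_zmod (p := p) (F := F)).exists_closed hF A
  set M₀ := (ZMod.castHom (dvd_refl p) M).fieldRange ⊔ Subfield.closure C with hM₀
  have hle : M₀ = Subfield.closure C := by
    have h1 : (ZMod.castHom (dvd_refl p) M).fieldRange ≤ Subfield.closure C := by
      rintro _ ⟨x, rfl⟩
      obtain ⟨k, rfl⟩ := ZMod.intCast_surjective x
      rw [map_intCast]
      exact intCast_mem _ k
    rw [hM₀, sup_eq_right.2 h1]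
  simp only [Set.image_empty, Set.empty_union] at hind hgen
  refine ⟨M₀, fun j => Subtype.val ⁻¹' X' j, ?_, ?_,
    isGood_subtype (fun j x hx => ?_) hgen hmem hind⟩
  · intro x hx
    rw [hle]
    exact Subfield.subset_closure (hAC hx)
  · rw [hle]
    refine (Subfield.cardinalMk_closure_le_max _).trans (max_le (hcard.trans ?_)
      aleph0_le_continuum)
    exact max_le hA aleph0_le_continuum
  · rw [hle]
    exact Subfield.subset_closure (hX'C j hx)

theorem exists_realization [IsSepClosed M] (hF : IsFrobeniusChain p F) {A : Set M} {n : ℕ}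
    (q : @TypeSpace (chainLang m) M (chainStructure F) A n) :
    ∃ (N : Type w) (_ : Field N) (_ : CharP N p) (G : Fin (m + 2) → Subfield N) (ι : M →+* N)
      (c : Fin n → N), IsSepClosed N ∧ IsFrobeniusChain p G ∧ degrees G = degrees F ∧
      IsElemExt p F G ι ∧ ∀ φ, (typeCode (chainLang m) A n).symm φ ∈ q ↔
        Holds G φ (Sum.elim (fun a => ι a) c) := by
  classical
  let _ := chainStructure F
  let J := {φ : FForm m (A ⊕ Fin n) // (typeCode (chainLang m) A n).symm φ ∈ q}
  obtain ⟨N, _, _, G, ι, hsep, hG, hd, hι, c, hc⟩ := exists_isElemExt_realize hF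
    (fun φ : J => (toLambda p m).onFormula (φ.1.relabel (Sum.map (fun a : A => (a : M)) id))) (by
      intro s
      obtain ⟨v, hv⟩ := exists_realize_of_finset q (s.image Subtype.val) (by
        intro φ hφ
        obtain ⟨ψ, -, rfl⟩ := Finset.mem_image.1 hφ
        exact ψ.2)
      refine ⟨v, fun φ hφ => (lholds_onFormula _ _).2 ((holds_relabel F _ _ _).2 ?_)⟩
      have h1 := hv φ.1 (Finset.mem_image_of_mem _ hφ)
      rw [Sum.elim_comp_map]
      exact h1)
  have key : ∀ φ, (typeCode (chainLang m) A n).symm φ ∈ q →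
      Holds G φ (Sum.elim (fun a => ι a) c) := by
    intro φ hφ
    have := (holds_relabel G _ _ _).1 ((lholds_onFormula _ _).1 (hc ⟨φ, hφ⟩))
    rw [Sum.elim_comp_map] at this
    exact this
  refine ⟨N, _, _, G, ι, c, hsep, hG, hd, hι, fun φ => ⟨key φ, fun h => ?_⟩⟩
  by_contra hn
  exact key _ ((not_mem_typeSpace_iff q φ).2 hn) h

/-- Codes for types over `A`, relative to a separably embedded field `M₀` containing `A`: the
vanishing ideal of a countable sequence of generators, the levels of those generators which are in
the divided `p`-basis, and the indices of the tuple. -/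
def IsTypeData (p : ℕ) [Fact p.Prime] [CharP M p] (F : Fin (m + 2) → Subfield M) {A : Set M}
    {M₀ : Subfield M} (hA : A ⊆ M₀) (X₀ : Fin (m + 1) → Set M₀) {n : ℕ}
    (q : @TypeSpace (chainLang m) M (chainStructure F) A n)
    (D : Ideal (MvPolynomial ℕ M₀) × (Fin (m + 1) → Set ℕ) × (Fin n → ℕ)) : Prop :=
  ∃ (N : Type w) (_ : Field N) (_ : CharP N p) (G : Fin (m + 2) → Subfield N) (g : M₀ →+* N)
    (x : ℕ → N), IsSepClosed N ∧ IsFrobeniusChain p G ∧ degrees G = degrees F ∧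
    (∀ j, ∀ y ∈ X₀ j, g y ∈ G j.succ) ∧ (∀ j, ∀ k ∈ D.2.1 j, x k ∈ G j.succ) ∧
    (∀ j, PIndSet p (G j.castSucc) (g '' X₀ j ∪ x '' D.2.1 j)) ∧
    (g.fieldRange ⊔ Subfield.closure (Set.range x) ≤
      pPowers p (g.fieldRange ⊔ Subfield.closure (Set.range x)) ⊔
        Subfield.closure (⋃ j, (g '' X₀ j ∪ x '' D.2.1 j))) ∧
    RingHom.ker (MvPolynomial.eval₂Hom g x) = D.1 ∧
    ∀ φ, (typeCode (chainLang m) A n).symm φ ∈ q ↔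
      Holds G φ (Sum.elim (fun a => g ⟨a, hA a.2⟩) fun i => x (D.2.2 i))

/-- The type is realized in an elementary extension, and `M₀` with the realization is closed off to
a good field by countably many further generators, which are enumerated as `x`. -/
theorem exists_isTypeData [IsSepClosed M] (hF : IsFrobeniusChain p F) {A : Set M}
    {M₀ : Subfield M} (hA : A ⊆ M₀) {X₀ : Fin (m + 1) → Set M₀} (hX₀ : IsGood p F M₀.subtype X₀)
    {n : ℕ} (q : @TypeSpace (chainLang m) M (chainStructure F) A n) :
    ∃ D, IsTypeData p F hA X₀ q D := by
  obtain ⟨N, _, _, G, ι, c, hsep, hG, hd, hι, hc⟩ := exists_realization hF q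
  have hg := hι.isGood hF hG hX₀
  -- Including `0` makes `C` nonempty even when `n = 0`, so that it can be enumerated by `ℕ`.
  obtain ⟨C, X', hSC, hcard, hX'C, hmem, hind, hgen⟩ := hg.exists_closed hG (insert 0 (Set.range c))
  have hCc : C.Countable := by
    rw [← Cardinal.le_aleph0_iff_set_countable]
    exact hcard.trans (max_le (Cardinal.le_aleph0_iff_set_countable.2
      ((Set.countable_range c).insert 0)) le_rfl)
  obtain ⟨x, hx⟩ := hCc.exists_eq_range ⟨0, hSC (Set.mem_insert _ _)⟩
  subst hx
  choose idx hidx using fun i => hSC (Set.mem_insert_of_mem 0 (Set.mem_range_self (f := c) i))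
  have himage : ∀ j, x '' (x ⁻¹' X' j) = X' j := fun j =>
    Set.image_preimage_eq_of_subset (hX'C j)
  refine ⟨(RingHom.ker (MvPolynomial.eval₂Hom (ι.comp M₀.subtype) x), fun j => x ⁻¹' X' j, idx),
    N, inferInstance, inferInstance, G, ι.comp M₀.subtype, x, hsep, hG, hd, hg.mem, fun j k hk => hmem j _ hk, ?_, ?_, rfl,
    ?_⟩
  · simpa only [himage] using hind
  · simpa only [himage] using hgen
  · intro φ
    rw [hc φ]
    simp only [hidx]
    rfl

/-- Equal ideals of relations give an embedding of `M₀(x)` over `M₀` into the second chain taking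
`x` to `x'`, and equal level data make it respect the divided `p`-basis. Both realizations then come
from one field well embedded in two chains, and `lholds_iff_of_isGood` applies. -/
theorem IsTypeData.unique [IsSepClosed M] {A : Set M} {M₀ : Subfield M} {hA : A ⊆ M₀}
    {X₀ : Fin (m + 1) → Set M₀} {n : ℕ} {q q' : @TypeSpace (chainLang m) M (chainStructure F) A n}
    {D : Ideal (MvPolynomial ℕ M₀) × (Fin (m + 1) → Set ℕ) × (Fin n → ℕ)}
    (h : IsTypeData p F hA X₀ q D) (h' : IsTypeData p F hA X₀ q' D) : q = q' := by
  obtain ⟨N, _, _, G, g, x, _, hG, hd, hgm, hxm, hind, hgen, hker, hq⟩ := h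
  obtain ⟨N', _, _, G', g', x', _, hG', hd', hgm', hxm', hind', -, hker', hq'⟩ := h'
  let _ := g.toAlgebra
  let _ := g'.toAlgebra
  obtain ⟨θ, hθ⟩ := exists_algHom_of_ker_eq (k := M₀) (x := x) (y := x') (hker.trans hker'.symm)
  set B := (IntermediateField.adjoin M₀ (Set.range x)).toSubfield with hB
  have hB' : B = g.fieldRange ⊔ Subfield.closure (Set.range x) := by
    rw [hB, IntermediateField.adjoin_toSubfield, Subfield.closure_union]
    congr 1
    exact Subfield.closure_eq g.fieldRange
  rw [← hB'] at hgen
  have hgB : ∀ y, g y ∈ B := fun y => IntermediateField.algebraMap_mem _ y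
  have hxB : ∀ k, x k ∈ B := fun k => IntermediateField.subset_adjoin _ _ ⟨k, rfl⟩
  have hθg : ∀ y, θ ⟨g y, hgB y⟩ = g' y := fun y => θ.commutes y
  have hθx : ∀ k, θ ⟨x k, hxB k⟩ = x' k := hθ
  have hgood : IsGood p G B.subtype
      (fun j => Subtype.val ⁻¹' (g '' X₀ j ∪ x '' D.2.1 j)) := by
    refine isGood_subtype (fun j => Set.union_subset ?_ ?_) hgen ?_ hind
    · rintro _ ⟨y, -, rfl⟩
      exact hgB y
    · rintro _ ⟨k, -, rfl⟩
      exact hxB k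
    · rintro j _ (⟨y, hy, rfl⟩ | ⟨k, hk, rfl⟩)
      · exact hgm j y hy
      · exact hxm j k hk
  have hgood' : IsGood p G' (θ : B →+* N')
      (fun j => Subtype.val ⁻¹' (g '' X₀ j ∪ x '' D.2.1 j)) := by
    refine ⟨hgood.gen, ?_, fun j => (hind' j).mono ?_⟩
    · rintro j ⟨z, hz⟩ (⟨y, hy, rfl⟩ | ⟨k, hk, rfl⟩)
      · exact (hθg y).symm ▸ hgm' j y hy
      · exact (hθx k).symm ▸ hxm' j k hk
    · rintro _ ⟨⟨z, hz⟩, (⟨y, hy, rfl⟩ | ⟨k, hk, rfl⟩), rfl⟩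
      · exact Or.inl ⟨y, hy, (hθg y).symm⟩
      · exact Or.inr ⟨k, hk, (hθx k).symm⟩
  refine @typeSpace_ext (chainLang m) M (chainStructure F) _ A n q q' fun φ => ?_
  rw [hq, hq', ← lholds_onFormula (p := p), ← lholds_onFormula (p := p)]
  have := lholds_iff_of_isGood hG hG' (hd.trans hd'.symm) hgood hgood' ((toLambda p m).onFormula φ)
    (Sum.elim (fun a : A => (⟨g ⟨a, hA a.2⟩, hgB _⟩ : B)) fun i => ⟨x (D.2.2 i), hxB _⟩)
  convert this using 2
  · funext a
    rcases a with a | a <;> rfl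
  · funext a
    rcases a with a | a
    · exact (hθg _).symm
    · exact (hθx _).symm

theorem mk_typeSpace_le [IsSepClosed M] (hF : IsFrobeniusChain p F) {A : Set M} (hA : #A ≤ 𝔠)
    (n : ℕ) : #(@TypeSpace (chainLang m) M (chainStructure F) A n) ≤ 𝔠 := by
  obtain ⟨M₀, X₀, hAM₀, hcard, hX₀⟩ := exists_small_isGood hF hA
  choose D hD using fun q => exists_isTypeData hF hAM₀ hX₀ (n := n) q
  have hinj : Function.Injective D := fun q q' h => (hD q).unique (h ▸ hD q')
  refine (mk_le_of_injective hinj).trans ?_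
  have h1 : #((Fin (m + 1) → Set ℕ) × (Fin n → ℕ)) ≤ 𝔠 := by
    have h2 : #(Fin (m + 1) → Set ℕ) ≤ 𝔠 := by
      rw [← power_def, mk_set_nat]
      refine (power_le_power_left continuum_ne_zero (mk_le_aleph0 (α := Fin (m + 1)))).trans ?_
      rw [continuum_power_aleph0]
    have h3 : #(Fin n → ℕ) ≤ 𝔠 := mk_le_aleph0.trans aleph0_le_continuum
    rw [← mul_def]
    exact (mul_le_mul' h2 h3).trans continuum_mul_self.le
  rw [mk_prod, lift_uzero]
  refine (mul_le_mul' (mk_ideal_mvPolynomial_nat_le hcard) ?_).trans continuum_mul_self.le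
  rw [← lift_continuum.{w, 0}, lift_le]
  exact h1

theorem isStable_chainTheory {K : Type u} [Field K] [CharP K p] [IsSepClosed K]
    {F : Fin (m + 2) → Subfield K} (hF : IsFrobeniusChain p F) :
    IsStable.{w} (chainTheory F) := by
  -- An ideal in countably many variables is given by a sequence of ideals in finitely many
  -- variables, so the count of codes needs a cardinal with `κ ^ ℵ₀ = κ`; the continuum is one.
  refine ⟨𝔠, aleph0_le_continuum, fun M S _ hM A hA n => ?_⟩
  obtain ⟨_, _, G, _, hG, -, rfl⟩ := isChainModel_of_realize hF M hM
  exact mk_typeSpace_le hG hA n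

end Stability

end SepClosedChain

theorem theorem2p1 (p : ℕ) [Fact p.Prime] (m : ℕ) (K : Type u) [Field K] [CharP K p]
    [IsSepClosed K] (F : Fin (m + 2) → Subfield K)
    (hF : SepClosedChain.IsFrobeniusChain p F) :
    -- the theory of `(K, K_1, …, K_m)` is stable
    SepClosedChain.IsStable.{w} (SepClosedChain.chainTheory F) ∧
    -- it is axiomatized by the stated properties together with the degrees
    (∀ (M : Type w) [(SepClosedChain.chainLang m).Structure M],
      M ⊨ SepClosedChain.chainTheory F ↔
        SepClosedChain.IsChainModel p (SepClosedChain.degrees F) M) ∧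
    -- the same in the language with `λ`-functions, where it eliminates quantifiers
    (∀ (M : Type w) [(SepClosedChain.lambdaLang p m).Structure M],
      M ⊨ SepClosedChain.lambdaTheory p F ↔
        SepClosedChain.IsLambdaChainModel p (SepClosedChain.degrees F) M) ∧
    SepClosedChain.EliminatesQuantifiers (SepClosedChain.lambdaTheory p F) := by
  exact ⟨SepClosedChain.isStable_chainTheory hF,
    fun M _ => SepClosedChain.realize_chainTheory_iff hF M,
    fun M _ => SepClosedChain.realize_lambdaTheory_iff hF M,
    SepClosedChain.eliminatesQuantifiers hF⟩
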